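/- Conventions. Let $M$ be a transitive model (a set or a proper class) of ZFC. All topological spaces are $T_0$. For a topological space $\langle X,\tau\rangle$ of $M$ (that is, $X,\tau\in M$ and $M\models$ "$\tau$ is a $T_0$ topology on $X$"), a *preinterpretation* over $M$ is a $T_0$ topological space $\langle\hat X,\hat\tau\rangle$ with maps $\pi\colon X\to\hat X$ and $\pi\colon\tau\to\hat\tau$ such that (a) for all $x\in X$, $O\in\tau$: $x\in O$ if and only if $\pi(x)\in\pi(O)$; (b) $\pi(O\cap P)=\pi(O)\cap\pi(P)$ for $O,P\in\tau$, and $\pi(\bigcup A)=\bigcup_{P\in A}\pi(P)$ for every $A\in M$ with $A\subseteq\tau$; (c) $\pi(\emptyset)=\emptyset$ and $\pi(X)=\hat X$; (d) $\{\pi(O):O\in\tau\}$ is a basis of $\hat\tau$. A *reduction* of a preinterpretation $\pi_0\colon X\to\hat X_0$ to $\pi_1\colon X\to\hat X_1$ is a map $h\colon\hat X_0\to\hat X_1$ with $\pi_1=h\circ\pi_0$ on $X$ and $h^{-1}(\pi_1(O))=\pi_0(O)$ for all $O\in\tau$. An *interpretation* of $X$ is a preinterpretation to which every preinterpretation of $X$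 has a reduction. A map $X\to\hat X$ *extends to an interpretation* if it is the point part of one. If $M\models$ "$f\colon X\to Y$ is continuous" and $\pi\colon X\to\hat X$, $\chi\colon Y\to\hat Y$ are interpretations, an *interpretation of $f$* is a continuous map $\hat f\colon\hat X\to\hat Y$ with $\hat f(\pi(x))=\chi(f(x))$ for all $x\in X$. A space is *Čech complete* if it is a $G_\delta$ subspace of a compact Hausdorff space, and *interpretable* if it is regular Hausdorff and the image of a Čech complete space under an open continuous map. **Theorem.** Let $M$ be a transitive model of ZFC, let $\langle\langle X_i,\tau_i\rangle : i\in\omega\rangle\in M$ be a sequence such that $M\models$ "$\langle X_i,\tau_i\rangle$ is an interpretable space" for every $i\in\omega$, and let $\pi_i\colon X_i\to\hat X_i$ be an interpretation of $X_i$ over $M$ for every $i\in\omega$. Let $X=\big(\prod_{i}X_i\big)^M$ be the product space as computed in $M$, and let $\hat X=\prod_i\hat X_i$ carry the product topology. 1. The product map $\pi=\prod_i\pi_i\colon X\to\hat X$, $\pi(x)(i)=\pi_i(x(i))$, extends to an interpretation of $X$ over $M$. 2. For every $i\in\omega$, the coordinate projection $X\to X_i$ (which is continuous in $M$) has exactly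 one interpretation with respect to $\pi$ and $\pi_i$, namely the coordinate projection $\hat X\to\hat X_i$. -/

import Mathlib

universe u

namespace Interp

/-! ## Transitive models of ZFC -/

/-- The relation symbols of the language of set theory: one binary symbol. -/
inductive MemSymbol : ℕ → Type
  | mem : MemSymbol 2

/-- The first-order language `{∈}` of set theory. -/
def setLanguage : FirstOrder.Language := ⟨fun _ => Empty, MemSymbol⟩

/-- A class `M` of sets as a structure for the language of set theory, with the true `∈`. -/
instance memStructure (M : Set ZFSet.{u}) : setLanguage.Structure M where
  funMap := fun f _ => Empty.elim f
  RelMap := fun r => match r with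
    | MemSymbol.mem => fun v => (v 0).1 ∈ (v 1).1

/-- `(M, ∈) ⊨ ZFC`: every axiom is relativized to `M` (all quantifiers range over `M`). The two
schemata are stated for the sets and relations that are first-order definable over `(M, ∈)` with
parameters from `M`. -/
structure IsZFCModel (M : Set ZFSet.{u}) : Prop where
  nonempty : Nonempty M
  extensionality : ∀ x y : M, (∀ z : M, z.1 ∈ x.1 ↔ z.1 ∈ y.1) → x = y
  foundation : ∀ x : M, (∃ y : M, y.1 ∈ x.1) →
    ∃ y : M, y.1 ∈ x.1 ∧ ∀ z : M, ¬ (z.1 ∈ x.1 ∧ z.1 ∈ y.1)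
  pairing : ∀ x y : M, ∃ p : M, ∀ z : M, z.1 ∈ p.1 ↔ z = x ∨ z = y
  union : ∀ x : M, ∃ s : M, ∀ z : M, z.1 ∈ s.1 ↔ ∃ y : M, y.1 ∈ x.1 ∧ z.1 ∈ y.1
  powerset : ∀ x : M, ∃ p : M, ∀ z : M, z.1 ∈ p.1 ↔ ∀ w : M, w.1 ∈ z.1 → w.1 ∈ x.1
  infinity : ∃ a : M, (∃ e : M, (∀ z : M, z.1 ∉ e.1) ∧ e.1 ∈ a.1) ∧
    ∀ x : M, x.1 ∈ a.1 → ∃ y : M, y.1 ∈ a.1 ∧ ∀ z : M, z.1 ∈ y.1 ↔ z.1 ∈ x.1 ∨ z = x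
  separation : ∀ D : Set M, Set.Definable₁ (Set.univ : Set M) setLanguage D →
    ∀ a : M, ∃ b : M, ∀ x : M, x.1 ∈ b.1 ↔ x.1 ∈ a.1 ∧ x ∈ D
  replacement : ∀ R : M → M → Prop,
    Set.Definable₂ (Set.univ : Set M) setLanguage {q : M × M | R q.1 q.2} →
    ∀ a : M, (∀ x : M, x.1 ∈ a.1 → ∃! y : M, R x y) →
      ∃ b : M, ∀ y : M, y.1 ∈ b.1 ↔ ∃ x : M, x.1 ∈ a.1 ∧ R x y
  choice : ∀ a : M, (∀ x : M, x.1 ∈ a.1 → ∃ z : M, z.1 ∈ x.1) →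
    (∀ x y : M, x.1 ∈ a.1 → y.1 ∈ a.1 → (∃ z : M, z.1 ∈ x.1 ∧ z.1 ∈ y.1) → x = y) →
      ∃ c : M, ∀ x : M, x.1 ∈ a.1 → ∃! z : M, z.1 ∈ x.1 ∧ z.1 ∈ c.1

/-- `M` is a transitive model of set theory with choice; `M` may be a set or a proper class. -/
structure IsTransitiveModel (M : Set ZFSet.{u}) : Prop where
  transitive : ∀ x ∈ M, ∀ y ∈ x, y ∈ M
  zfc : IsZFCModel M

/-! ## Countable sequences as sets -/

/-- The von Neumann natural numbers. -/
def natSet : ℕ → ZFSet.{u}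
  | 0 => ∅
  | n + 1 => insert (natSet n) (natSet n)

/-- The sequence `⟨v n : n ∈ ω⟩` as a set of ordered pairs. -/
noncomputable def seqGraph (v : ℕ → ZFSet.{u}) : ZFSet.{u} :=
  ZFSet.range fun n : ℕ => ZFSet.pair (natSet n) (v n)

theorem rank_natSet (n : ℕ) : (natSet.{u} n).rank = n := by
  induction n with
  | zero => simp [natSet]
  | succ n ih => simp [natSet, ih]

theorem natSet_injective : Function.Injective natSet.{u} := fun m n h => by
  have := congrArg ZFSet.rank h
  simpa [rank_natSet] using this

theorem pair_mem_seqGraph {v : ℕ → ZFSet.{u}} {n : ℕ} {y : ZFSet.{u}} :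
    ZFSet.pair (natSet n) y ∈ seqGraph v ↔ y = v n := by
  simp only [seqGraph, ZFSet.mem_range, ZFSet.pair_inj]
  constructor
  · rintro ⟨m, hm, rfl⟩
    rw [natSet_injective hm]
  · rintro rfl
    exact ⟨n, rfl, rfl⟩

/-! ## Topological notions relativized to `M`

In what follows a space is a pair `X`, `τ` of sets, `τ` being the set of open subsets of `X`.
Quantifiers over arbitrary sets are restricted to `M`. Bounded notions, finiteness and `ω` are
absolute for transitive models and are not relativized. -/

/-- `M ⊨ ⟨X, τ⟩` is a (T₀) topological space. -/
structure IsSpaceIn (M : Set ZFSet.{u}) (X τ : ZFSet.{u}) : Prop where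
  carrier_mem : X ∈ M
  opens_mem : τ ∈ M
  subset : ∀ O ∈ τ, O ⊆ X
  empty_mem : ∅ ∈ τ
  univ_mem : X ∈ τ
  inter_mem : ∀ O ∈ τ, ∀ P ∈ τ, O ∩ P ∈ τ
  sUnion_mem : ∀ A ∈ M, A ⊆ τ → ZFSet.sUnion A ∈ τ
  t0 : ∀ x ∈ X, ∀ y ∈ X, (∀ O ∈ τ, x ∈ O ↔ y ∈ O) → x = y

def IsHausdorff (X τ : ZFSet.{u}) : Prop :=
  ∀ x ∈ X, ∀ y ∈ X, x ≠ y → ∃ O ∈ τ, ∃ P ∈ τ, x ∈ O ∧ y ∈ P ∧ O ∩ P = ∅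

/-- Points are separated from closed sets `X \ O` by disjoint open sets. -/
def IsRegular (X τ : ZFSet.{u}) : Prop :=
  ∀ O ∈ τ, ∀ x ∈ O, ∃ P ∈ τ, ∃ Q ∈ τ, x ∈ P ∧ X \ O ⊆ Q ∧ P ∩ Q = ∅

/-- `M ⊨ ⟨X, τ⟩` is compact: every open cover in `M` has a finite subcover. -/
def IsCompactIn (M : Set ZFSet.{u}) (X τ : ZFSet.{u}) : Prop :=
  ∀ C ∈ M, C ⊆ τ → ZFSet.sUnion C = X →
    ∃ F ∈ M, F ⊆ C ∧ (F : Set ZFSet.{u}).Finite ∧ ZFSet.sUnion F = X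

/-- `M ⊨ Y` is a `G_δ` subset of `⟨X, τ⟩`: the intersection of a sequence, in `M`, of open sets. -/
def IsGδIn (M : Set ZFSet.{u}) (X τ Y : ZFSet.{u}) : Prop :=
  ∃ U : ℕ → ZFSet.{u}, seqGraph U ∈ M ∧ (∀ n, U n ∈ τ) ∧
    ∀ y, y ∈ Y ↔ y ∈ X ∧ ∀ n, y ∈ U n

/-- `σ` is the subspace topology of `Y` in a space with topology `τ`. -/
def IsSubspaceTopology (τ Y σ : ZFSet.{u}) : Prop :=
  ∀ P, P ∈ σ ↔ ∃ O ∈ τ, P = O ∩ Y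

/-- `M ⊨ ⟨Y, σ⟩` is Čech complete: a `G_δ` subspace of a compact Hausdorff space. -/
def IsCechCompleteIn (M : Set ZFSet.{u}) (Y σ : ZFSet.{u}) : Prop :=
  IsSpaceIn M Y σ ∧ ∃ K κ : ZFSet.{u}, IsSpaceIn M K κ ∧ IsHausdorff K κ ∧ IsCompactIn M K κ ∧
    IsGδIn M K κ Y ∧ IsSubspaceTopology κ Y σ

/-- `M ⊨ f : ⟨X, τ⟩ → ⟨Y, σ⟩` is a continuous function. -/
def IsContinuousIn (M : Set ZFSet.{u}) (X τ Y σ f : ZFSet.{u}) : Prop :=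
  f ∈ M ∧ ZFSet.IsFunc X Y f ∧
    ∀ O ∈ σ, ZFSet.sep (fun x => ∃ y ∈ O, ZFSet.pair x y ∈ f) X ∈ τ

/-- `f` maps `τ`-open sets onto `σ`-open subsets of `Y`. -/
def IsOpenFun (τ Y σ f : ZFSet.{u}) : Prop :=
  ∀ O ∈ τ, ZFSet.sep (fun y => ∃ x ∈ O, ZFSet.pair x y ∈ f) Y ∈ σ

/-- `M ⊨ ⟨X, τ⟩` is interpretable: it is regular Hausdorff and the image of a Čech complete space
under an open continuous map. -/
def IsInterpretableIn (M : Set ZFSet.{u}) (X τ : ZFSet.{u}) : Prop :=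
  IsSpaceIn M X τ ∧ IsRegular X τ ∧ IsHausdorff X τ ∧
    ∃ Y σ f : ZFSet.{u}, IsCechCompleteIn M Y σ ∧ IsContinuousIn M Y σ X τ f ∧
      IsOpenFun σ X τ f ∧ ∀ x ∈ X, ∃ y ∈ Y, ZFSet.pair y x ∈ f

/-! ## Interpretations -/

/-- A topological preinterpretation over `M` of the space `⟨X, τ⟩` of `M` in the (T₀) topological
space `Xh`: a map `pt` on points and a map `op` on open sets. -/
structure Preinterpretation (M : Set ZFSet.{u}) (X τ : ZFSet.{u})
    (Xh : Type u) [TopologicalSpace Xh] [T0Space Xh] where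
  pt : X → Xh
  op : τ → Set Xh
  mem_iff : ∀ (x : X) (O : τ), x.1 ∈ O.1 ↔ pt x ∈ op O
  op_inter : ∀ O P Q : τ, Q.1 = O.1 ∩ P.1 → op Q = op O ∩ op P
  op_sUnion : ∀ A ∈ M, A ⊆ τ → ∀ O : τ, O.1 = ZFSet.sUnion A →
    op O = {y | ∃ P : τ, P.1 ∈ A ∧ y ∈ op P}
  op_empty : ∀ O : τ, O.1 = ∅ → op O = ∅
  op_univ : ∀ O : τ, O.1 = X → op O = Set.univ
  isBasis : TopologicalSpace.IsTopologicalBasis (Set.range op)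

section

variable {M : Set ZFSet.{u}} {X τ Y σ : ZFSet.{u}}
  {Xh Yh : Type u} [TopologicalSpace Xh] [T0Space Xh] [TopologicalSpace Yh] [T0Space Yh]

/-- `h` is a reduction of the preinterpretation `π₀` to the preinterpretation `π₁` of `⟨X, τ⟩`. -/
def IsReduction (π₀ : Preinterpretation M X τ Xh) (π₁ : Preinterpretation M X τ Yh)
    (h : Xh → Yh) : Prop :=
  (∀ x, π₁.pt x = h (π₀.pt x)) ∧ ∀ O, h ⁻¹' π₁.op O = π₀.op O

/-- `π` is an interpretation of the space `⟨X, τ⟩` of `M`: the largest preinterpretation in the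
ordering given by the existence of a reduction. -/
def IsInterpretation (π : Preinterpretation M X τ Xh) : Prop :=
  IsSpaceIn M X τ ∧
    ∀ (Z : Type u) [TopologicalSpace Z] [T0Space Z] (χ : Preinterpretation M X τ Z),
      ∃ h : Z → Xh, IsReduction χ π h

/-- The map `p` on points extends to an interpretation. -/
def ExtendsToInterpretation (M : Set ZFSet.{u}) (X τ : ZFSet.{u}) (p : X → Xh) : Prop :=
  ∃ π : Preinterpretation M X τ Xh, π.pt = p ∧ IsInterpretation π

/-- `fh` is an interpretation of the function `f : ⟨X, τ⟩ → ⟨Y, σ⟩`, continuous in `M`, with respect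
to the maps `p`, `q` on points of the interpretations of the two spaces. -/
def IsInterpretationOfMap (M : Set ZFSet.{u}) (X τ Y σ : ZFSet.{u}) (p : X → Xh) (q : Y → Yh)
    (f : ZFSet.{u}) (fh : Xh → Yh) : Prop :=
  IsContinuousIn M X τ Y σ f ∧ Continuous fh ∧
    ∀ (x : X) (y : Y), ZFSet.pair x.1 y.1 ∈ f → fh (p x) = q y

end

/-! ## The countable product in `M` -/

/-- The set `∏ₙ Xₙ` as computed in `M`: all sequences in `M` with `n`-th term in `X n`. -/
noncomputable def prodSet (M : Set ZFSet.{u}) (X : ℕ → ZFSet.{u}) : ZFSet.{u} :=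
  ZFSet.range fun v : {v : ∀ n, X n // seqGraph (fun n => (v n).1) ∈ M} =>
    seqGraph fun n => (v.1 n).1

/-- The box `{x ∈ ∏ₙ Xₙ : ∀ n ∈ F, x n ∈ U n}` of the product in `M`. -/
noncomputable def prodBox (M : Set ZFSet.{u}) (X : ℕ → ZFSet.{u}) (F : Finset ℕ)
    (U : ℕ → ZFSet.{u}) : ZFSet.{u} :=
  ZFSet.sep (fun x => ∀ n ∈ F, ∃ y ∈ U n, ZFSet.pair (natSet n) y ∈ x) (prodSet M X)

/-- The product topology as computed in `M`: the sets in `M` that contain, around each of their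
points, an open box with finite support. -/
noncomputable def prodTopology (M : Set ZFSet.{u}) (X τ : ℕ → ZFSet.{u}) : ZFSet.{u} :=
  ZFSet.sep (fun O => O ∈ M ∧ ∀ x ∈ O, ∃ (F : Finset ℕ) (U : ℕ → ZFSet.{u}),
    (∀ n ∈ F, U n ∈ τ n) ∧ x ∈ prodBox M X F U ∧ prodBox M X F U ⊆ O) (ZFSet.powerset (prodSet M X))

/-- The coordinate projection `∏ₙ Xₙ → Xᵢ` of `M`, as a set of ordered pairs `(x, x i)`. -/
noncomputable def projGraph (M : Set ZFSet.{u}) (X : ℕ → ZFSet.{u}) (i : ℕ) : ZFSet.{u} :=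
  ZFSet.pairSep (fun x y => ZFSet.pair (natSet i) y ∈ x) (prodSet M X) (X i)

theorem mem_prodSet_iff {M : Set ZFSet.{u}} {X : ℕ → ZFSet.{u}} {x : ZFSet.{u}} :
    x ∈ prodSet M X ↔ x ∈ M ∧ ∃ v : ∀ n, X n, x = seqGraph fun n => (v n).1 := by
  simp only [prodSet, ZFSet.mem_range, Subtype.exists]
  constructor
  · rintro ⟨v, hv, rfl⟩
    exact ⟨hv, v, rfl⟩
  · rintro ⟨hx, v, rfl⟩
    exact ⟨v, hx, rfl⟩

/-- The `n`-th coordinate of a point of the product in `M`. -/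
noncomputable def coord {M : Set ZFSet.{u}} {X : ℕ → ZFSet.{u}} (x : prodSet M X) (n : ℕ) : X n :=
  (mem_prodSet_iff.1 x.2).2.choose n

theorem seqGraph_coord {M : Set ZFSet.{u}} {X : ℕ → ZFSet.{u}} (x : prodSet M X) :
    seqGraph (fun n => (coord x n).1) = x.1 :=
  (mem_prodSet_iff.1 x.2).2.choose_spec.symm

/-- The product map `∏ₙ pₙ : ∏ₙ Xₙ → ∏ₙ X̂ₙ`, defined on the product in `M`. -/
noncomputable def prodMap (M : Set ZFSet.{u}) {X : ℕ → ZFSet.{u}} {Xh : ℕ → Type u}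
    (p : ∀ n, X n → Xh n) : prodSet M X → ∀ n, Xh n :=
  fun x n => p n (coord x n)

end Interp

/-! Each point of a preinterpretation gives a filter of open sets that is completely prime for the
families lying in `M` (`IsPoint`). The space of all such filters is itself a preinterpretation, so
by maximality an interpretation realizes every one of them (`IsInterpretation.exists_point`). On the
product, a point `y` is put into the interpretation of `O` when some open box of `M` inside `O` has
all its sides in the filters of the coordinates of `y` (`prodOp`). A box is a finite intersection of
cylinders, so a completely prime filter on the product is determined by its projections to the
factors; this yields the reductions (`isInterpretation_prod`).

The hard clause is preservation of unions: if in `M` a box is covered by a set `A` of boxes, then no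
point of the product of the interpretations may escape `A` (`exists_box_of_cover`). Suppose a point
with filters `G k` escapes. Each factor is an open continuous image of a `G_δ` subset of a compact
space `K k`. Complete primeness produces, outside `M`, an infinite sequence of boxes with open sides
in the `K k`, whose images lie in the filters and whose closures sink into the first box and into
more and more of the sets defining the `G_δ`. None of them is covered by finitely many members of
`A`, because finite covers cannot be escaped (`exists_box_of_finite`). Having an infinite branch is
absolute, so `M` itself contains such a sequence, although the filters need not be in `M`
(`exists_branch`).

Inside `M` a Tychonoff argument, one coordinate at a time, gives points `c k` of `K k` none of whose
basic neighborhoods meets a box of the sequence in a finitely covered set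
(`IsUncoveredSeq.exists_isGood`). Shrinking puts `c k` into the `G_δ`, so its image is a point of
the original box; by continuity that image lies in no member of `A`
(`IsUncoveredSeq.exists_notMem`), which contradicts the cover.

The projections are the only interpretations of themselves because interpretations of regular spaces
are Hausdorff and the points of `M` are dense.

To carry out arguments inside `M`, `Def` and `DT` let instance search derive first-order
definability, which turns Separation, Replacement and Choice into usable lemmas. -/

namespace Interp

/-! ### Definability over `(M, ∈)`. -/

variable {M : Set ZFSet.{u}}

/-- A predicate on assignments of elements of `M` to the variables is first-order definable over
`(M, ∈)` with parameters. -/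
class Def (M : Set ZFSet.{u}) (P : (ℕ → M) → Prop) : Prop where
  out : Set.Definable (Set.univ : Set M) setLanguage {v | P v}

/-- A term with values in `M` whose graph is first-order definable over `(M, ∈)`. -/
class DT (M : Set ZFSet.{u}) (t : (ℕ → M) → ZFSet.{u}) : Prop where
  mem : ∀ v, t v ∈ M
  eq : Def M fun v => (v 0).1 = t fun n => v (n + 1)

namespace Def

theorem congr {P Q : (ℕ → M) → Prop} (h : Def M P) (e : ∀ v, Q v ↔ P v) : Def M Q := by
  obtain rfl : Q = P := funext fun v => propext (e v)
  exact h

theorem subst {P : (ℕ → M) → Prop} (h : Def M P) (f : ℕ → ℕ) : Def M fun v => P fun n => v (f n) :=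
  ⟨h.out.preimage_comp f⟩

instance and {P Q : (ℕ → M) → Prop} [hP : Def M P] [hQ : Def M Q] : Def M fun v => P v ∧ Q v :=
  ⟨hP.out.inter hQ.out⟩

instance or {P Q : (ℕ → M) → Prop} [hP : Def M P] [hQ : Def M Q] : Def M fun v => P v ∨ Q v :=
  ⟨hP.out.union hQ.out⟩

instance not {P : (ℕ → M) → Prop} [hP : Def M P] : Def M fun v => ¬ P v :=
  ⟨hP.out.compl⟩

instance imp {P Q : (ℕ → M) → Prop} [Def M P] [Def M Q] : Def M fun v => P v → Q v :=
  (inferInstance : Def M fun v => ¬ P v ∨ Q v).congr fun _ => imp_iff_not_or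

instance iff {P Q : (ℕ → M) → Prop} [Def M P] [Def M Q] : Def M fun v => (P v ↔ Q v) :=
  (inferInstance : Def M fun v => (P v → Q v) ∧ (Q v → P v)).congr fun _ => iff_def

instance const {p : Prop} : Def M fun _ => p := by
  by_cases h : p
  · exact ⟨by simp [h]⟩
  · exact ⟨by simp [h]⟩

/-- Variables are handled as de Bruijn indices: the bound variable becomes variable `0` and the free
ones move up by one. This form makes the hypothesis again an instance problem. -/
instance ex {P : (ℕ → M) → M → Prop} [h : Def M fun v => P (fun n => v (n + 1)) (v 0)] :
    Def M fun v => ∃ x, P v x := by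
  obtain ⟨φ, hφ⟩ := h.out
  refine ⟨(FirstOrder.Language.BoundedFormula.relabel (n := 1)
    (fun k : ℕ => k.rec (Sum.inr 0) fun m _ => Sum.inl m) φ).ex, ?_⟩
  ext v
  simp only [Set.mem_ofPred_eq, FirstOrder.Language.Formula.Realize, FirstOrder.Language.BoundedFormula.realize_ex,
    FirstOrder.Language.BoundedFormula.realize_relabel]
  refine exists_congr fun x => ?_
  have := Set.ext_iff.1 hφ fun k : ℕ => k.rec x fun m _ => v m
  simp only [Set.mem_ofPred_eq, FirstOrder.Language.Formula.Realize] at this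
  refine this.trans (iff_of_eq ?_)
  congr 1
  · ext k
    cases k <;> rfl
  · exact Subsingleton.elim _ _

instance all {P : (ℕ → M) → M → Prop} [Def M fun v => P (fun n => v (n + 1)) (v 0)] :
    Def M fun v => ∀ x, P v x :=
  (inferInstance : Def M fun v => ¬ ∃ x, ¬ P v x).congr fun _ => by simp

instance var_mem (i j : ℕ) : Def M fun v => (v i).1 ∈ (v j).1 := by
  refine ⟨Set.Definable.mono (Set.empty_definable_iff.2 ?_) (Set.empty_subset _)⟩
  refine ⟨FirstOrder.Language.Relations.formula (L := setLanguage) (n := 2) MemSymbol.mem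
    ![FirstOrder.Language.Term.var i, FirstOrder.Language.Term.var j], ?_⟩
  ext v
  simp only [Set.mem_ofPred_eq]
  rfl

theorem var_eq (i j : ℕ) : Def M fun v => v i = v j := by
  refine ⟨Set.Definable.mono (Set.empty_definable_iff.2 ?_) (Set.empty_subset _)⟩
  refine ⟨FirstOrder.Language.Term.equal (FirstOrder.Language.Term.var i) (FirstOrder.Language.Term.var j), ?_⟩
  ext v
  simp

theorem var_eq_const (i : ℕ) (c : M) : Def M fun v => v i = c := by
  refine ⟨FirstOrder.Language.Term.equal (FirstOrder.Language.Term.var i) (FirstOrder.Language.Constants.term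
    (setLanguage.con (⟨c, trivial⟩ : (Set.univ : Set M)))), ?_⟩
  ext v
  simp

/-- Variables may be replaced by variables or by parameters. This turns a statement uniform in
parameters into one about fixed sets, as Separation and Replacement require. -/
theorem inst {P : (ℕ → M) → Prop} (h : Def M P) (f : (ℕ → M) → ℕ → M)
    (hf : ∀ k, (∃ n, ∀ v, f v k = v n) ∨ ∃ c, ∀ v, f v k = c) : Def M fun v => P (f v) := by
  obtain ⟨φ, hφ⟩ := h.out
  have : ∀ k, ∃ t : (setLanguage.withConstants (Set.univ : Set M)).Term ℕ, ∀ v, t.realize v = f v k := by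
    intro k
    rcases hf k with ⟨n, hn⟩ | ⟨c, hc⟩
    · exact ⟨FirstOrder.Language.Term.var n, fun v => by simp [hn]⟩
    · exact ⟨FirstOrder.Language.Constants.term (setLanguage.con (⟨c, trivial⟩ : (Set.univ : Set M))),
        fun v => by simp [hc]⟩
  choose t ht using this
  refine ⟨φ.subst t, ?_⟩
  ext v
  simp only [Set.mem_ofPred_eq, FirstOrder.Language.Formula.Realize, FirstOrder.Language.BoundedFormula.realize_subst, ht]
  exact Set.ext_iff.1 hφ (f v)

/-- Fix the values of all variables but the first. -/
theorem fix {P : (ℕ → M) → ZFSet.{u} → Prop} (h : Def M fun v => P (fun n => v (n + 1)) (v 0).1)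
    (w : ℕ → M) : Def M fun v => P w (v 0).1 :=
  h.inst (fun v k => k.rec (v 0) fun m _ => w m) fun k => match k with
    | 0 => .inl ⟨0, fun _ => rfl⟩
    | m + 1 => .inr ⟨w m, fun _ => rfl⟩

/-- Fix the values of all variables but the first two. -/
theorem fix₂ {P : (ℕ → M) → ZFSet.{u} → ZFSet.{u} → Prop}
    (h : Def M fun v => P (fun n => v (n + 2)) (v 0).1 (v 1).1) (w : ℕ → M) :
    Def M fun v => P w (v 0).1 (v 1).1 :=
  h.inst (fun v k => k.rec (v 0) fun m _ => m.rec (v 1) fun l _ => w l) fun k => match k with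
    | 0 => .inl ⟨0, fun _ => rfl⟩
    | 1 => .inl ⟨1, fun _ => rfl⟩
    | m + 2 => .inr ⟨w m, fun _ => rfl⟩

end Def

namespace DT

theorem subst {t : (ℕ → M) → ZFSet.{u}} (h : DT M t) (f : ℕ → ℕ) : DT M fun v => t fun n => v (f n) :=
  ⟨fun _ => h.mem _, h.eq.subst fun n => n.rec 0 fun m _ => f m + 1⟩

instance var (i : ℕ) : DT M fun v => (v i).1 :=
  ⟨fun v => (v i).2, (Def.var_eq 0 (i + 1)).congr fun _ => Subtype.ext_iff.symm⟩

theorem const {c : ZFSet.{u}} (hc : c ∈ M) : DT M fun _ => c :=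
  ⟨fun _ => hc, (Def.var_eq_const 0 ⟨c, hc⟩).congr fun _ =>
    (Subtype.ext_iff (a2 := ⟨c, hc⟩)).symm⟩

end DT

namespace Def

/-- A term is eliminated by quantifying over its value, which lies in `M`. -/
theorem comp {t : (ℕ → M) → ZFSet.{u}} {P : (ℕ → M) → ZFSet.{u} → Prop} [ht : DT M t]
    [hP : Def M fun v => P (fun n => v (n + 1)) (v 0).1] : Def M fun v => P v (t v) := by
  have := ht.eq
  refine (inferInstance : Def M fun v => ∃ x : M, x.1 = t v ∧ P v x.1).congr fun v => ?_
  exact ⟨fun h => ⟨⟨_, ht.mem v⟩, rfl, h⟩, fun ⟨x, hx, h⟩ => hx ▸ h⟩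

instance mem {s t : (ℕ → M) → ZFSet.{u}} [hs : DT M s] [ht : DT M t] : Def M fun v => s v ∈ t v := by
  have := ht.subst (· + 1)
  have : Def M fun v => (v 0).1 ∈ t fun n => v (n + 1) :=
    comp (P := fun v x => (v 0).1 ∈ x) 
  exact comp (P := fun v x => x ∈ t v)

instance eq {s t : (ℕ → M) → ZFSet.{u}} [hs : DT M s] [ht : DT M t] : Def M fun v => s v = t v := by
  have := ht.eq
  exact comp (P := fun v x => x = t v)

instance exZ {P : (ℕ → M) → ZFSet.{u} → Prop} [Def M fun v => P (fun n => v (n + 1)) (v 0).1] :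
    Def M fun v => ∃ x ∈ M, P v x :=
  (inferInstance : Def M fun v => ∃ x : M, P v x.1).congr fun _ => by simp

instance allZ {P : (ℕ → M) → ZFSet.{u} → Prop} [Def M fun v => P (fun n => v (n + 1)) (v 0).1] :
    Def M fun v => ∀ x ∈ M, P v x :=
  (inferInstance : Def M fun v => ∀ x : M, P v x.1).congr fun _ => by simp

end Def

/-- The power set as computed in `M`. -/
noncomputable def pw (M : Set ZFSet.{u}) (x : ZFSet.{u}) : ZFSet.{u} := 
  ZFSet.sep (fun y => y ∈ M) (ZFSet.powerset x)

theorem mem_pw {x y : ZFSet.{u}} : y ∈ pw M x ↔ y ⊆ x ∧ y ∈ M := by simp [pw]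

variable [hM : Fact (IsTransitiveModel M)]

theorem mem_of_mem {x y : ZFSet.{u}} (hx : x ∈ M) (hy : y ∈ x) : y ∈ M :=
  hM.out.transitive x hx y hy

namespace Def

instance exB {t : (ℕ → M) → ZFSet.{u}} {P : (ℕ → M) → ZFSet.{u} → Prop} [ht : DT M t]
    [Def M fun v => P (fun n => v (n + 1)) (v 0).1] : Def M fun v => ∃ x ∈ t v, P v x := by
  have := ht.subst (· + 1)
  refine (inferInstance : Def M fun v => ∃ x ∈ M, x ∈ t v ∧ P v x).congr fun v => ?_
  exact ⟨fun ⟨x, hx, h⟩ => ⟨x, mem_of_mem (ht.mem v) hx, hx, h⟩, fun ⟨x, _, hx, h⟩ => ⟨x, hx, h⟩⟩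

instance allB {t : (ℕ → M) → ZFSet.{u}} {P : (ℕ → M) → ZFSet.{u} → Prop} [ht : DT M t]
    [Def M fun v => P (fun n => v (n + 1)) (v 0).1] : Def M fun v => ∀ x ∈ t v, P v x :=
  (inferInstance : Def M fun v => ¬ ∃ x ∈ t v, ¬ P v x).congr fun _ => by simp

instance subset {s t : (ℕ → M) → ZFSet.{u}} [hs : DT M s] [ht : DT M t] :
    Def M fun v => s v ⊆ t v := by
  have := ht.subst (· + 1)
  exact (inferInstance : Def M fun v => ∀ x ∈ s v, x ∈ t v).congr fun v => Iff.rfl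

end Def

/-- By transitivity all elements of a member of `M` lie in `M`, so equality with the term can be
tested by a quantifier over `M`. -/
theorem DT.of_mem {t : (ℕ → M) → ZFSet.{u}} (h : ∀ v, t v ∈ M)
    (hd : Def M fun v => (v 0).1 ∈ t fun n => v (n + 1)) : DT M t := by
  refine ⟨h, ?_⟩
  have : Def M fun v => (v 0).1 ∈ t fun n => v (n + 2) := hd.subst fun n => n.rec 0 fun m _ => m + 2
  refine (inferInstance : Def M fun v => ∀ x : M, x.1 ∈ (v 0).1 ↔ x.1 ∈ t fun n => v (n + 1)).congr
    fun v => ?_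
  refine ⟨fun e x => by rw [e], fun e => ZFSet.ext fun z => ⟨fun hz => ?_, fun hz => ?_⟩⟩
  · exact (e ⟨z, mem_of_mem (v 0).2 hz⟩).1 hz
  · exact (e ⟨z, mem_of_mem (h _) hz⟩).2 hz

/-! ### The axioms -/

/-- The set provided by the axiom has the right elements among members of `M`; transitivity makes it
the true pair. Unions, subsets and power sets are treated in the same way. -/
theorem pair_set_mem {x y : ZFSet.{u}} (hx : x ∈ M) (hy : y ∈ M) : ({x, y} : ZFSet.{u}) ∈ M := by
  obtain ⟨p, hp⟩ := hM.out.zfc.pairing ⟨x, hx⟩ ⟨y, hy⟩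
  convert p.2
  ext z
  refine ⟨fun h => ?_, fun h => ?_⟩
  · rcases ZFSet.mem_pair.1 h with rfl | rfl
    · exact (hp ⟨z, hx⟩).2 (.inl rfl)
    · exact (hp ⟨z, hy⟩).2 (.inr rfl)
  · have := (hp ⟨z, mem_of_mem p.2 h⟩).1 h
    simpa [Subtype.ext_iff] using this

theorem sUnion_mem {x : ZFSet.{u}} (hx : x ∈ M) : ZFSet.sUnion x ∈ M := by
  obtain ⟨p, hp⟩ := hM.out.zfc.union ⟨x, hx⟩
  convert p.2
  ext z
  refine ⟨fun h => ?_, fun h => ?_⟩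
  · obtain ⟨y, hy, hz⟩ := ZFSet.mem_sUnion.1 h
    exact (hp ⟨z, mem_of_mem (mem_of_mem hx hy) hz⟩).2 ⟨⟨y, mem_of_mem hx hy⟩, hy, hz⟩
  · obtain ⟨y, hy, hz⟩ := (hp ⟨z, mem_of_mem p.2 h⟩).1 h
    exact ZFSet.mem_sUnion.2 ⟨y.1, hy, hz⟩

theorem pw_mem {x : ZFSet.{u}} (hx : x ∈ M) : pw M x ∈ M := by
  obtain ⟨p, hp⟩ := hM.out.zfc.powerset ⟨x, hx⟩
  convert p.2
  ext z
  rw [mem_pw]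
  refine ⟨fun h => ?_, fun h => ?_⟩
  · exact (hp ⟨z, h.2⟩).2 fun w hw => h.1 hw
  · exact ⟨fun w hw => (hp ⟨z, mem_of_mem p.2 h⟩).1 h ⟨w, mem_of_mem (mem_of_mem p.2 h) hw⟩ hw,
      mem_of_mem p.2 h⟩

theorem sep_mem {P : ZFSet.{u} → Prop} [h : Def M fun v => P (v 0).1] {a : ZFSet.{u}} (ha : a ∈ M) :
    ZFSet.sep P a ∈ M := by
  obtain ⟨b, hb⟩ := hM.out.zfc.separation {x | P x.1} (h.out.preimage_comp fun _ => 0) ⟨a, ha⟩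
  convert b.2
  ext z
  rw [ZFSet.mem_sep]
  exact ⟨fun h => (hb ⟨z, mem_of_mem ha h.1⟩).2 h, fun h => (hb ⟨z, mem_of_mem b.2 h⟩).1 h⟩

theorem exists_replacement {R : ZFSet.{u} → ZFSet.{u} → Prop} [h : Def M fun v => R (v 0).1 (v 1).1]
    {a : ZFSet.{u}} (ha : a ∈ M) (hR : ∀ x ∈ a, ∃! y, y ∈ M ∧ R x y) :
    ∃ b ∈ M, ∀ y, y ∈ b ↔ y ∈ M ∧ ∃ x ∈ a, R x y := by
  have hd : (Set.univ : Set M).Definable setLanguage {w : Fin 2 → M | R (w 0).1 (w 1).1} :=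
    h.out.preimage_comp fun n : ℕ => if n = 0 then (0 : Fin 2) else 1
  obtain ⟨b, hb⟩ := hM.out.zfc.replacement (fun x y => R x.1 y.1) hd ⟨a, ha⟩ (by
      rintro x hx
      obtain ⟨y, ⟨h1, h2⟩, h3⟩ := hR x.1 hx
      exact ⟨⟨y, h1⟩, h2, fun z hz => Subtype.ext (h3 _ ⟨z.2, hz⟩)⟩)
  refine ⟨b.1, b.2, fun y => ⟨fun hy => ?_, fun ⟨hy, x, hx, hr⟩ => ?_⟩⟩
  · obtain ⟨x, hx, hr⟩ := (hb ⟨y, mem_of_mem b.2 hy⟩).1 hy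
    exact ⟨mem_of_mem b.2 hy, x, hx, hr⟩
  · exact (hb ⟨y, hy⟩).2 ⟨⟨x, mem_of_mem ha hx⟩, hx, hr⟩

end Interp

namespace Interp

/-! ### Images, functions and pairs as definable terms. -/

variable {M : Set ZFSet.{u}}

/-- The set `{t x : x ∈ a}`. -/
noncomputable def img (a : ZFSet.{u}) (t : ZFSet.{u} → ZFSet.{u}) : ZFSet.{u} :=
  ZFSet.range fun x : a => t x

/-- The function `x ↦ t x` on the set `a`, as a set of pairs. -/
noncomputable def lam (a : ZFSet.{u}) (t : ZFSet.{u} → ZFSet.{u}) : ZFSet.{u} :=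
  img a fun x => ZFSet.pair x (t x)

/-- The value of the function `f`, a set of pairs, at `x`. -/
noncomputable def ap (f x : ZFSet.{u}) : ZFSet.{u} :=
  ZFSet.sUnion (ZFSet.sep (fun y => ZFSet.pair x y ∈ f) (ZFSet.sUnion (ZFSet.sUnion f)))

/-- The first component of an ordered pair. -/
noncomputable def fst (p : ZFSet.{u}) : ZFSet.{u} :=
  ZFSet.sUnion (ZFSet.sep (fun x => ∃ y ∈ ZFSet.sUnion p, p = ZFSet.pair x y) (ZFSet.sUnion p))

/-- The second component of an ordered pair. -/
noncomputable def snd (p : ZFSet.{u}) : ZFSet.{u} :=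
  ZFSet.sUnion (ZFSet.sep (fun y => ∃ x ∈ ZFSet.sUnion p, p = ZFSet.pair x y) (ZFSet.sUnion p))

theorem mem_img {a : ZFSet.{u}} {t : ZFSet.{u} → ZFSet.{u}} {y : ZFSet.{u}} :
    y ∈ img a t ↔ ∃ x ∈ a, y = t x := by
  simp [img, eq_comm]

theorem mem_lam {a : ZFSet.{u}} {t : ZFSet.{u} → ZFSet.{u}} {y : ZFSet.{u}} :
    y ∈ lam a t ↔ ∃ x ∈ a, y = ZFSet.pair x (t x) := mem_img

theorem pair_mem_lam {a : ZFSet.{u}} {t : ZFSet.{u} → ZFSet.{u}} {x y : ZFSet.{u}} :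
    ZFSet.pair x y ∈ lam a t ↔ x ∈ a ∧ y = t x := by
  simp only [mem_lam, ZFSet.pair_inj]
  exact ⟨fun ⟨z, hz, h1, h2⟩ => h1 ▸ ⟨hz, h1 ▸ h2⟩, fun h => ⟨x, h.1, rfl, h.2⟩⟩

theorem mem_sUnion_of_pair_mem_right {f x y : ZFSet.{u}} (h : ZFSet.pair x y ∈ f) :
    y ∈ ZFSet.sUnion (ZFSet.sUnion f) :=
  ZFSet.mem_sUnion_of_mem (y := y) (z := {x, y}) (by simp)
    (ZFSet.mem_sUnion_of_mem (by simp [ZFSet.pair]) h)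

theorem sUnion_eq_of_unique {a y : ZFSet.{u}} (hy : y ∈ a) (h : ∀ z ∈ a, z = y) :
    ZFSet.sUnion a = y := by
  rw [show a = {y} from ZFSet.ext fun z => by rw [ZFSet.mem_singleton]; exact ⟨h z, fun e => e ▸ hy⟩]
  exact ZFSet.sUnion_singleton

theorem ap_eq {f x y : ZFSet.{u}} (h : ZFSet.pair x y ∈ f) (hf : ∀ z, ZFSet.pair x z ∈ f → z = y) :
    ap f x = y :=
  sUnion_eq_of_unique (ZFSet.mem_sep.2 ⟨mem_sUnion_of_pair_mem_right h, h⟩)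
    fun z hz => hf z (ZFSet.mem_sep.1 hz).2

theorem ap_lam {a x : ZFSet.{u}} {t : ZFSet.{u} → ZFSet.{u}} (hx : x ∈ a) : ap (lam a t) x = t x :=
  ap_eq (pair_mem_lam.2 ⟨hx, rfl⟩) fun _ hz => (pair_mem_lam.1 hz).2

@[simp]
theorem ap_seqGraph (v : ℕ → ZFSet.{u}) (n : ℕ) : ap (seqGraph v) (natSet n) = v n :=
  ap_eq (pair_mem_seqGraph.2 rfl) fun _ => pair_mem_seqGraph.1

@[simp]
theorem fst_pair (x y : ZFSet.{u}) : fst (ZFSet.pair x y) = x := by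
  refine sUnion_eq_of_unique (ZFSet.mem_sep.2 ⟨?_, y, ?_, rfl⟩) fun z hz => ?_
  · simp [ZFSet.pair]
  · simp [ZFSet.pair]
  · obtain ⟨_, w, _, h⟩ := ZFSet.mem_sep.1 hz
    exact (ZFSet.pair_inj.1 h).1.symm

@[simp]
theorem snd_pair (x y : ZFSet.{u}) : snd (ZFSet.pair x y) = y := by
  refine sUnion_eq_of_unique (ZFSet.mem_sep.2 ⟨?_, x, ?_, rfl⟩) fun z hz => ?_
  · simp [ZFSet.pair]
  · simp [ZFSet.pair]
  · obtain ⟨_, w, _, h⟩ := ZFSet.mem_sep.1 hz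
    exact (ZFSet.pair_inj.1 h).2.symm

variable [hM : Fact (IsTransitiveModel M)]

namespace DT

omit hM in
theorem congr {s t : (ℕ → M) → ZFSet.{u}} (h : DT M s) (e : ∀ v, t v = s v) : DT M t := by
  obtain rfl : t = s := funext e
  exact h

instance sUnion {t : (ℕ → M) → ZFSet.{u}} [ht : DT M t] : DT M fun v => ZFSet.sUnion (t v) := by
  have := ht.subst (· + 1)
  refine .of_mem (fun v => sUnion_mem (ht.mem v)) ?_
  exact (inferInstance : Def M fun v => ∃ z ∈ t fun n => v (n + 1), (v 0).1 ∈ z).congr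
    fun v => ZFSet.mem_sUnion

instance pairSet {s t : (ℕ → M) → ZFSet.{u}} [hs : DT M s] [ht : DT M t] :
    DT M fun v => {s v, t v} := by
  have := hs.eq
  have := ht.eq
  refine .of_mem (fun v => pair_set_mem (hs.mem v) (ht.mem v)) ?_
  simp only [ZFSet.mem_pair]
  infer_instance

instance singleton {t : (ℕ → M) → ZFSet.{u}} [ht : DT M t] : DT M fun v => {t v} :=
  (pairSet (s := t) (t := t)).congr fun _ => (ZFSet.pair_eq_singleton _).symm

instance pair {s t : (ℕ → M) → ZFSet.{u}} [hs : DT M s] [ht : DT M t] :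
    DT M fun v => ZFSet.pair (s v) (t v) := by
  unfold ZFSet.pair
  infer_instance

instance union {s t : (ℕ → M) → ZFSet.{u}} [hs : DT M s] [ht : DT M t] : DT M fun v => s v ∪ t v :=
  (inferInstance : DT M fun v => ZFSet.sUnion {s v, t v}).congr fun _ => (ZFSet.sUnion_pair _ _).symm

instance insert {s t : (ℕ → M) → ZFSet.{u}} [hs : DT M s] [ht : DT M t] :
    DT M fun v => insert (s v) (t v) :=
  (inferInstance : DT M fun v => {s v} ∪ t v).congr fun _ => ZFSet.insert_eq _ _

instance pw {t : (ℕ → M) → ZFSet.{u}} [ht : DT M t] : DT M fun v => pw M (t v) := by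
  have := ht.subst (· + 1)
  refine .of_mem (fun v => pw_mem (ht.mem v)) ?_
  exact (inferInstance : Def M fun v => (v 0).1 ⊆ t fun n => v (n + 1)).congr
    fun v => by simp [mem_pw]

instance sep {a : (ℕ → M) → ZFSet.{u}} {P : (ℕ → M) → ZFSet.{u} → Prop} [ha : DT M a]
    [hP : Def M fun v => P (fun n => v (n + 1)) (v 0).1] : DT M fun v => ZFSet.sep (P v) (a v) := by
  have := ha.subst (· + 1)
  refine .of_mem (fun v => ?_) ?_
  · have := hP.fix v
    exact sep_mem (ha.mem v)
  · exact (inferInstance : Def M fun v => (v 0).1 ∈ a (fun n => v (n + 1)) ∧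
      P (fun n => v (n + 1)) (v 0).1).congr fun v => ZFSet.mem_sep

instance inter {s t : (ℕ → M) → ZFSet.{u}} [hs : DT M s] [ht : DT M t] : DT M fun v => s v ∩ t v := by
  have := ht.subst (· + 1)
  exact sep (a := s) (P := fun v x => x ∈ t v)

instance sdiff {s t : (ℕ → M) → ZFSet.{u}} [hs : DT M s] [ht : DT M t] : DT M fun v => s v \ t v := by
  have := ht.subst (· + 1)
  exact sep (a := s) (P := fun v x => x ∉ t v)

instance img {a : (ℕ → M) → ZFSet.{u}} {t : (ℕ → M) → ZFSet.{u} → ZFSet.{u}} [ha : DT M a]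
    [ht : DT M fun v => t (fun n => v (n + 1)) (v 0).1] : DT M fun v => img (a v) (t v) := by
  have hm : ∀ v, ∀ x ∈ a v, t v x ∈ M := fun v x hx => 
    ht.mem fun n => n.rec ⟨x, mem_of_mem (ha.mem v) hx⟩ fun m _ => v m
  refine .of_mem (fun v => ?_) ?_
  · have := Def.fix₂ (M := M) (P := fun w x y => y = t w x) 
      (ht.eq.subst fun n => n.rec 1 fun m _ => m.rec 0 fun l _ => l + 2) v
    obtain ⟨b, hb, h⟩ := exists_replacement (M := M) (R := fun x y => y = t v x) (ha.mem v)
      fun x hx => ⟨t v x, ⟨hm v x hx, rfl⟩, fun y hy => hy.2⟩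
    convert hb
    ext y
    rw [h, mem_img]
    exact ⟨fun ⟨x, hx, e⟩ => ⟨e ▸ hm v x hx, x, hx, e⟩, fun h => h.2⟩
  · have := ha.subst (· + 1)
    have : DT M fun v => t (fun n => v (n + 1 + 1)) (v 0).1 :=
      ht.subst fun n => n.rec 0 fun m _ => m + 2
    exact (inferInstance : Def M fun v => ∃ x ∈ a fun n => v (n + 1),
      (v 0).1 = t (fun n => v (n + 1)) x).congr fun v => mem_img

instance lam {a : (ℕ → M) → ZFSet.{u}} {t : (ℕ → M) → ZFSet.{u} → ZFSet.{u}} [ha : DT M a]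
    [ht : DT M fun v => t (fun n => v (n + 1)) (v 0).1] : DT M fun v => lam (a v) (t v) := by
  unfold Interp.lam
  infer_instance

instance prod {s t : (ℕ → M) → ZFSet.{u}} [hs : DT M s] [ht : DT M t] :
    DT M fun v => ZFSet.prod (s v) (t v) := by
  have := ht.subst (· + 1)
  refine (inferInstance : DT M fun v => ZFSet.sUnion
    (Interp.img (s v) fun x => Interp.img (t v) fun y => ZFSet.pair x y)).congr fun v => ?_
  ext z
  simp only [ZFSet.mem_prod, ZFSet.mem_sUnion, mem_img]
  exact ⟨fun ⟨x, hx, y, hy, h⟩ => ⟨_, ⟨x, hx, rfl⟩, mem_img.2 ⟨y, hy, h⟩⟩,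
    fun ⟨_, ⟨x, hx, e⟩, h⟩ => ⟨x, hx, by rw [e] at h; exact mem_img.1 h⟩⟩

instance ap {s t : (ℕ → M) → ZFSet.{u}} [hs : DT M s] [ht : DT M t] :
    DT M fun v => ap (s v) (t v) := by
  have := hs.subst (· + 1)
  have := ht.subst (· + 1)
  unfold Interp.ap
  infer_instance

instance fst {t : (ℕ → M) → ZFSet.{u}} [ht : DT M t] : DT M fun v => fst (t v) := by
  have := ht.subst (· + 1)
  have := ht.subst (· + 2)
  unfold Interp.fst
  infer_instance

instance snd {t : (ℕ → M) → ZFSet.{u}} [ht : DT M t] : DT M fun v => snd (t v) := by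
  have := ht.subst (· + 1)
  have := ht.subst (· + 2)
  unfold Interp.snd
  infer_instance

instance ite {P : (ℕ → M) → Prop} [∀ v, Decidable (P v)] {s t : (ℕ → M) → ZFSet.{u}} [hP : Def M P]
    [hs : DT M s] [ht : DT M t] : DT M fun v => if P v then s v else t v := by
  have := hs.eq
  have := ht.eq
  have : Def M fun v => P fun n => v (n + 1) := hP.subst (· + 1)
  refine ⟨fun v => ?_, ?_⟩
  · split
    exacts [hs.mem v, ht.mem v]
  · refine (inferInstance : Def M fun v => (P (fun n => v (n + 1)) ∧ (v 0).1 = s fun n => v (n + 1)) ∨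
      (¬ P (fun n => v (n + 1)) ∧ (v 0).1 = t fun n => v (n + 1))).congr fun v => ?_
    split <;> simp [*]

omit hM in
theorem val {t : ZFSet.{u} → ZFSet.{u}} (h : DT M fun v => t (v 0).1) {x : ZFSet.{u}} (hx : x ∈ M) :
    t x ∈ M := h.mem fun _ => ⟨x, hx⟩

theorem val₀ {c : ZFSet.{u}} (h : DT M fun _ => c) : c ∈ M := by
  obtain ⟨x⟩ := hM.out.zfc.nonempty
  exact h.mem fun _ => x

instance empty : DT M fun _ => ∅ := by
  obtain ⟨x⟩ := hM.out.zfc.nonempty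
  have := DT.const x.2
  exact (inferInstance : DT M fun _ => ZFSet.sep (fun _ => False) x.1).congr fun _ => by ext; simp

end DT

end Interp

namespace Interp

variable {M : Set ZFSet.{u}}

/-! ### Recursion on `∈` -/

/-- The function defined by `F x = H x (F ↾ x)`. -/
noncomputable def memRec (H : ZFSet.{u} → ZFSet.{u} → ZFSet.{u}) : ZFSet.{u} → ZFSet.{u} :=
  ZFSet.mem_wf.fix fun x F => H x (ZFSet.range fun z : x => ZFSet.pair z (F z z.2))

theorem memRec_eq (H : ZFSet.{u} → ZFSet.{u} → ZFSet.{u}) (x : ZFSet.{u}) :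
    memRec H x = H x (lam x (memRec H)) := by
  rw [memRec, WellFounded.fix_eq]
  rfl

/-- `g` satisfies the recursion for `H` on its domain. -/
def IsApprox (H : ZFSet.{u} → ZFSet.{u} → ZFSet.{u}) (g : ZFSet.{u}) : Prop :=
  ∀ p ∈ g, p = ZFSet.pair (fst p) (H (fst p) (ZFSet.sep (fun q => fst q ∈ fst p) g)) ∧
    ∀ z ∈ fst p, ∃ w ∈ ZFSet.sUnion (ZFSet.sUnion g), ZFSet.pair z w ∈ g

theorem restrict_eq_lam {F : ZFSet.{u} → ZFSet.{u}} {g x : ZFSet.{u}}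
    (h₁ : ∀ q ∈ g, fst q ∈ x → q = ZFSet.pair (fst q) (F (fst q)))
    (h₂ : ∀ z ∈ x, ZFSet.pair z (F z) ∈ g) :
    ZFSet.sep (fun q => fst q ∈ x) g = lam x F := by
  ext q
  rw [ZFSet.mem_sep, mem_lam]
  refine ⟨fun h => ⟨fst q, h.2, h₁ q h.1 h.2⟩, ?_⟩
  rintro ⟨z, hz, rfl⟩
  exact ⟨h₂ z hz, by simpa⟩

/-- An approximation contains the values at all elements of each of its arguments, so `∈`-induction
applies. -/
theorem IsApprox.eq_memRec {H : ZFSet.{u} → ZFSet.{u} → ZFSet.{u}} {g : ZFSet.{u}}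
    (hg : IsApprox H g) (x : ZFSet.{u}) : ∀ y, ZFSet.pair x y ∈ g → y = memRec H x := by
  induction x using ZFSet.inductionOn with
  | h x ih =>
    intro y hy
    obtain ⟨h1, h2⟩ := hg _ hy
    simp only [fst_pair] at h1 h2
    rw [(ZFSet.pair_inj.1 h1).2, memRec_eq]
    congr 1
    refine restrict_eq_lam (fun q hq hqx => ?_) fun z hz => ?_
    · have := (hg q hq).1
      rw [← ih _ hqx _ (this ▸ hq)]
      exact this
    · obtain ⟨w, -, hw⟩ := h2 z hz
      rwa [← ih z hz w hw]

theorem isApprox_iff {H : ZFSet.{u} → ZFSet.{u} → ZFSet.{u}} {g : ZFSet.{u}} :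
    IsApprox H g ↔ ∀ p ∈ g, p = ZFSet.pair (fst p) (memRec H (fst p)) ∧
      ∀ z ∈ fst p, ZFSet.pair z (memRec H z) ∈ g := by
  refine ⟨fun hg p hp => ?_, fun hg p hp => ?_⟩
  · obtain ⟨h1, h2⟩ := hg p hp
    refine ⟨?_, fun z hz => ?_⟩
    · rw [← hg.eq_memRec _ _ (h1 ▸ hp)]
      exact h1
    · obtain ⟨w, -, hw⟩ := h2 z hz
      rwa [← hg.eq_memRec z w hw]
  · obtain ⟨h1, h2⟩ := hg p hp
    refine ⟨?_, fun z hz => ⟨_, mem_sUnion_of_pair_mem_right (h2 z hz), h2 z hz⟩⟩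
    rw [restrict_eq_lam (fun q hq _ => (hg q hq).1) h2, ← memRec_eq H]
    exact h1

theorem DT.comp {t : (ℕ → M) → ZFSet.{u}} {F : (ℕ → M) → ZFSet.{u} → ZFSet.{u}} [ht : DT M t]
    [hF : DT M fun v => F (fun n => v (n + 1)) (v 0).1] : DT M fun v => F v (t v) := by
  refine ⟨fun v => hF.mem fun n => n.rec ⟨t v, ht.mem v⟩ fun m _ => v m, ?_⟩
  have := ht.subst (· + 1)
  have : Def M fun v => (v 1).1 = F (fun n => v (n + 1 + 1)) (v 0).1 :=
    hF.eq.subst fun n => n.rec 1 fun m _ => m.rec 0 fun l _ => l + 2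
  exact Def.comp (t := fun v => t fun n => v (n + 1))
    (P := fun v x => (v 0).1 = F (fun n => v (n + 1)) x)

theorem DT.comp₂ {s t : (ℕ → M) → ZFSet.{u}} {F : ZFSet.{u} → ZFSet.{u} → ZFSet.{u}}
    (hF : DT M fun v => F (v 0).1 (v 1).1) [ht : DT M t] [hs : DT M s] :
    DT M fun v => F (s v) (t v) := by
  have := hF.subst fun n => n.rec 1 fun _ _ => 0
  have := ht.subst (· + 1)
  have : DT M fun v => F (v 0).1 (t fun n => v (n + 1)) :=
    DT.comp (t := fun v => t fun n => v (n + 1)) (F := fun v y => F (v 0).1 y)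
  exact DT.comp (F := fun v x => F x (t v))

theorem Def.comp₂ {s t : (ℕ → M) → ZFSet.{u}} {R : ZFSet.{u} → ZFSet.{u} → Prop}
    (hR : Def M fun v => R (v 0).1 (v 1).1) [ht : DT M t] [hs : DT M s] :
    Def M fun v => R (s v) (t v) := by
  have := hR.subst fun n => n.rec 1 fun _ _ => 0
  have := ht.subst (· + 1)
  have : Def M fun v => R (v 0).1 (t fun n => v (n + 1)) :=
    Def.comp (t := fun v => t fun n => v (n + 1)) (P := fun v y => R (v 0).1 y)
  exact Def.comp (P := fun v x => R x (t v))

variable [hM : Fact (IsTransitiveModel M)]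

/-- The recursion theorem inside `M`: the value at `x` is the one assigned by any approximation in
`M`. Approximations for the elements of `x` are gathered by Replacement. Since Replacement needs
unique values, `R` selects the least approximation defined at a given argument. -/
theorem DT.memRec {H : ZFSet.{u} → ZFSet.{u} → ZFSet.{u}}
    (hH : DT M fun v => H (v 0).1 (v 1).1) : DT M fun v => memRec H (v 0).1 := by
  have hI (i : ℕ) : Def M fun v => IsApprox H (v i).1 := by
    have : DT M fun v => H (Interp.fst (v 0).1) (ZFSet.sep (fun q => Interp.fst q ∈ Interp.fst (v 0).1) (v (i + 1)).1) :=
      hH.comp₂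
    unfold IsApprox
    infer_instance
  let Q (x g : ZFSet.{u}) : Prop := ∃ y ∈ ZFSet.sUnion (ZFSet.sUnion g), ZFSet.pair x y ∈ g
  have hQ {x g} (hg : IsApprox H g) : Q x g ↔ ZFSet.pair x (Interp.memRec H x) ∈ g :=
    ⟨fun ⟨y, _, hy⟩ => hg.eq_memRec x y hy ▸ hy, fun h => ⟨_, mem_sUnion_of_pair_mem_right h, h⟩⟩
  let R (x g : ZFSet.{u}) : Prop := IsApprox H g ∧ Q x g ∧ ∀ g' ∈ M, IsApprox H g' → Q x g' → g ⊆ g'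
  have hR : Def M fun v => R (v 0).1 (v 1).1 := by
    have := hI
    infer_instance
  have key : ∀ x ∈ M, Interp.memRec H x ∈ M ∧ ∃ g ∈ M, R x g := by
    intro x
    induction x using ZFSet.inductionOn with
    | h x ih =>
      intro hx
      obtain ⟨b, hb, hbx⟩ := exists_replacement (M := M) (R := R) hx fun z hz => by
        obtain ⟨-, g, hg, h1, h2, h3⟩ := ih z hz (mem_of_mem hx hz)
        exact ⟨g, ⟨hg, h1, h2, h3⟩, fun g' hg' =>
          le_antisymm (α := ZFSet) (hg'.2.2.2 g hg h1 h2) (h3 g' hg'.1 hg'.2.1 hg'.2.2.1)⟩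
      have hb1 : ∀ p ∈ ZFSet.sUnion b, p = ZFSet.pair (Interp.fst p) (Interp.memRec H (Interp.fst p)) ∧
          ∀ z ∈ Interp.fst p, ZFSet.pair z (Interp.memRec H z) ∈ ZFSet.sUnion b := by
        intro p hp
        obtain ⟨g, hg, hp⟩ := ZFSet.mem_sUnion.1 hp
        obtain ⟨_, z, _, h1, h2, h3⟩ := (hbx g).1 hg
        obtain ⟨h4, h5⟩ := isApprox_iff.1 h1 p hp
        exact ⟨h4, fun z hz => ZFSet.mem_sUnion_of_mem (h5 z hz) hg⟩
      have hb2 : ∀ z ∈ x, ZFSet.pair z (Interp.memRec H z) ∈ ZFSet.sUnion b := by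
        intro z hz
        obtain ⟨-, g, hg, h1, h2, h3⟩ := ih z hz (mem_of_mem hx hz)
        exact ZFSet.mem_sUnion_of_mem ((hQ h1).1 h2) ((hbx g).2 ⟨hg, z, hz, h1, h2, h3⟩)
      have hF : Interp.memRec H x ∈ M := by
        rw [memRec_eq, ← restrict_eq_lam (fun q hq _ => (hb1 q hq).1) hb2]
        have := DT.const hx
        have := DT.const hb
        exact (hH.comp₂ : DT M fun _ => H x (ZFSet.sep (fun q => Interp.fst q ∈ x) (ZFSet.sUnion b))).val₀
      -- The union of the least approximations below `x`, extended by the value at `x`, is the least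
      -- approximation at `x`.
      refine ⟨hF, Insert.insert (ZFSet.pair x (Interp.memRec H x)) (ZFSet.sUnion b), ?_, ?_, ?_, ?_⟩
      · have := DT.const hx
        have := DT.const hb
        have := DT.const hF
        exact DT.val₀ (M := M) inferInstance
      · rw [isApprox_iff]
        intro p hp
        rcases ZFSet.mem_insert_iff.1 hp with rfl | hp
        · simpa using fun z hz => Or.inr (ZFSet.mem_sUnion.1 (hb2 z hz))
        · exact ⟨(hb1 p hp).1, fun z hz => ZFSet.mem_insert_of_mem _ ((hb1 p hp).2 z hz)⟩
      · exact ⟨_, mem_sUnion_of_pair_mem_right (ZFSet.mem_insert _ _), ZFSet.mem_insert _ _⟩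
      · intro g' hg' h1 h2 p hp
        rw [hQ h1] at h2
        rcases ZFSet.mem_insert_iff.1 hp with rfl | hp
        · exact h2
        · obtain ⟨g, hg, hp⟩ := ZFSet.mem_sUnion.1 hp
          obtain ⟨_, z, hz, _, _, h3⟩ := (hbx g).1 hg
          exact h3 g' hg' h1 ((hQ h1).2 ((isApprox_iff.1 h1 _ h2).2 z (by simpa))) hp
  refine ⟨fun v => (key _ (v 0).2).1, ?_⟩
  have := hI
  refine (inferInstance : Def M fun v => ∃ g : M, IsApprox H g.1 ∧ ZFSet.pair (v 1).1 (v 0).1 ∈ g.1).congr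
    fun v => ?_
  constructor
  · intro h
    obtain ⟨_, g, hg, h1, h2, _⟩ := key _ (v 1).2
    exact ⟨⟨g, hg⟩, h1, by rw [h]; exact (hQ h1).1 h2⟩
  · rintro ⟨g, h1, h2⟩
    exact h1.eq_memRec _ _ h2

end Interp

namespace Interp

variable {M : Set ZFSet.{u}}

/-! ### The natural numbers -/

/-- The set of von Neumann natural numbers. -/
noncomputable def om : ZFSet.{u} := ZFSet.range natSet.{u}

theorem mem_om {x : ZFSet.{u}} : x ∈ om ↔ ∃ n, x = natSet n := by
  simp [om, eq_comm]

@[simp]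
theorem natSet_mem_om (n : ℕ) : natSet.{u} n ∈ om := mem_om.2 ⟨n, rfl⟩

theorem forall_om {P : ZFSet.{u} → Prop} : (∀ x ∈ om, P x) ↔ ∀ n, P (natSet n) := by
  simp [om]

theorem exists_om {P : ZFSet.{u} → Prop} : (∃ x ∈ om, P x) ↔ ∃ n, P (natSet n) := by
  simp [om]

theorem mem_natSet {n : ℕ} {x : ZFSet.{u}} : x ∈ natSet n ↔ ∃ m < n, x = natSet m := by
  induction n with
  | zero => simp [natSet]
  | succ n ih =>
    rw [natSet, ZFSet.mem_insert_iff, ih]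
    constructor
    · rintro (rfl | ⟨m, hm, rfl⟩)
      exacts [⟨n, by omega, rfl⟩, ⟨m, by omega, rfl⟩]
    · rintro ⟨m, hm, rfl⟩
      rcases (Nat.lt_succ_iff.1 hm).eq_or_lt with rfl | h
      exacts [.inl rfl, .inr ⟨m, h, rfl⟩]

@[simp]
theorem natSet_mem_natSet {m n : ℕ} : natSet.{u} m ∈ natSet n ↔ m < n := by
  rw [mem_natSet]
  exact ⟨fun ⟨k, hk, h⟩ => natSet_injective h ▸ hk, fun h => ⟨m, h, rfl⟩⟩

theorem forall_mem_natSet {n : ℕ} {P : ZFSet.{u} → Prop} :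
    (∀ i ∈ natSet n, P i) ↔ ∀ i < n, P (natSet i) := by
  refine ⟨fun h i hi => h _ (natSet_mem_natSet.2 hi), fun h i hi => ?_⟩
  obtain ⟨m, hm, rfl⟩ := mem_natSet.1 hi
  exact h m hm

@[simp]
theorem natSet_inj {m n : ℕ} : natSet.{u} m = natSet n ↔ m = n := natSet_injective.eq_iff

theorem natSet_zero : natSet.{u} 0 = ∅ := rfl

theorem natSet_succ (n : ℕ) : natSet.{u} (n + 1) = insert (natSet n) (natSet n) := rfl

theorem sUnion_natSet_succ (n : ℕ) : ZFSet.sUnion (natSet.{u} (n + 1)) = natSet n := by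
  ext x
  simp only [ZFSet.mem_sUnion, mem_natSet]
  constructor
  · rintro ⟨_, ⟨m, hm, rfl⟩, hx⟩
    obtain ⟨k, hk, rfl⟩ := mem_natSet.1 hx
    exact ⟨k, by omega, rfl⟩
  · rintro ⟨m, hm, rfl⟩
    exact ⟨_, ⟨n, by omega, rfl⟩, by simpa⟩

/-- The right side is a bounded formula, by which `om` can be separated from any inductive set of
`M`. -/
theorem mem_om_iff {x : ZFSet.{u}} : x ∈ om ↔ (x = ∅ ∨ ∃ z ∈ x, x = insert z z) ∧
    ∀ y ∈ x, y = ∅ ∨ ∃ z ∈ y, y = insert z z := by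
  have h (n : ℕ) : natSet.{u} n = ∅ ∨ ∃ z ∈ natSet n, natSet n = insert z z := by
    cases n with
    | zero => exact .inl rfl
    | succ n => exact .inr ⟨natSet n, by simp, rfl⟩
  constructor
  · intro hx
    obtain ⟨n, rfl⟩ := mem_om.1 hx
    refine ⟨h n, fun y hy => ?_⟩
    obtain ⟨m, -, rfl⟩ := mem_natSet.1 hy
    exact h m
  · induction x using ZFSet.inductionOn with
    | h x ih =>
      rintro ⟨rfl | ⟨z, hz, rfl⟩, h2⟩
      · exact mem_om.2 ⟨0, rfl⟩
      · obtain ⟨n, rfl⟩ := mem_om.1 (ih z hz ⟨h2 z hz, fun y hy => h2 y (by simp [hy])⟩)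
        exact mem_om.2 ⟨n + 1, rfl⟩

theorem seqGraph_eq_lam (t : ZFSet.{u} → ZFSet.{u}) :
    seqGraph (fun n => t (natSet n)) = lam om t := by
  ext p
  rw [mem_lam, exists_om]
  simp [seqGraph, eq_comm]

theorem seqGraph_eq_lam_ap (v : ℕ → ZFSet.{u}) : seqGraph v = lam om (ap (seqGraph v)) := by
  simp [← seqGraph_eq_lam]

variable [hM : Fact (IsTransitiveModel M)]

theorem om_mem : om ∈ M := by
  obtain ⟨a, ⟨e, he, hea⟩, ha⟩ := hM.out.zfc.infinity
  have hn (n : ℕ) : natSet n ∈ a.1 := by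
    induction n with
    | zero =>
      rwa [natSet_zero, ← (ZFSet.eq_empty e.1).2 fun z hz => he ⟨z, mem_of_mem e.2 hz⟩ hz]
    | succ n ih =>
      obtain ⟨y, hy, h⟩ := ha ⟨_, mem_of_mem a.2 ih⟩ ih
      convert hy
      ext z
      rw [natSet, ZFSet.mem_insert_iff]
      constructor
      · rintro (rfl | hz)
        · exact (h ⟨_, mem_of_mem a.2 ih⟩).2 (.inr rfl)
        · exact (h ⟨z, mem_of_mem (mem_of_mem a.2 ih) hz⟩).2 (.inl hz)
      · intro hz
        exact ((h ⟨z, mem_of_mem y.2 hz⟩).1 hz).symm.imp (congrArg Subtype.val) id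
  have := DT.const a.2
  refine (inferInstance : DT M fun _ => ZFSet.sep (fun x => (x = ∅ ∨ ∃ z ∈ x, x = insert z z) ∧
    ∀ y ∈ x, y = ∅ ∨ ∃ z ∈ y, y = insert z z) a.1).congr (t := fun _ => om) (fun _ => ?_) |>.val₀
  ext x
  rw [ZFSet.mem_sep, ← mem_om_iff]
  refine ⟨fun h => ⟨?_, h⟩, fun h => h.2⟩
  obtain ⟨n, rfl⟩ := mem_om.1 h
  exact hn n

instance DT.om : DT M fun _ => om := .const om_mem

theorem natSet_mem (n : ℕ) : natSet n ∈ M := mem_of_mem om_mem (natSet_mem_om n)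

theorem seqGraph_mem (t : ZFSet.{u} → ZFSet.{u}) [h : DT M fun v => t (v 0).1] :
    seqGraph (fun n => t (natSet n)) ∈ M := by
  rw [seqGraph_eq_lam]
  have : DT M fun v => t (v 0).1 := h
  exact DT.val₀ (M := M) inferInstance

theorem apply_mem {v : ℕ → ZFSet.{u}} (hv : seqGraph v ∈ M) (n : ℕ) : v n ∈ M := by
  have := DT.const hv
  have := DT.const (natSet_mem (M := M) n)
  rw [← ap_seqGraph v n]
  exact DT.val₀ (M := M) inferInstance

/-! ### Choice and collection -/

/-- The axiom speaks of disjoint families, so the set of candidates for `x` is tagged with `x`.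
Intersecting the choice set with the union of the family leaves the graph of a function. -/
theorem exists_choice {S b : ZFSet.{u}} (hS : S ∈ M) (hb : b ∈ M) {R : ZFSet.{u} → ZFSet.{u} → Prop}
    [hR : Def M fun v => R (v 0).1 (v 1).1] (h : ∀ x ∈ S, ∃ y ∈ b, R x y) :
    ∃ c ∈ M, ∀ x ∈ S, ap c x ∈ b ∧ R x (ap c x) := by
  have := DT.const hS
  have := DT.const hb
  let P (x : ZFSet.{u}) : ZFSet.{u} := ZFSet.prod {x} (ZFSet.sep (fun y => R x y) b)
  have hP {x p} : p ∈ P x ↔ ∃ y ∈ b, R x y ∧ p = ZFSet.pair x y := by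
    simp only [P, ZFSet.mem_prod, ZFSet.mem_singleton, ZFSet.mem_sep]
    simp [and_assoc]
  have hPd : DT M fun v => P (v 0).1 := by
    have := hR.subst fun n => n.rec 1 fun _ _ => 0
    infer_instance
  have ha : img S P ∈ M := DT.val₀ (M := M) inferInstance
  obtain ⟨c, hc⟩ := hM.out.zfc.choice ⟨_, ha⟩ (by
    intro A hA
    obtain ⟨x, hx, e⟩ := mem_img.1 hA
    obtain ⟨y, hy, hr⟩ := h x hx
    have := hP.2 ⟨y, hy, hr, rfl⟩
    rw [← e] at this
    exact ⟨⟨_, mem_of_mem A.2 this⟩, this⟩) (by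
    rintro A B hA hB ⟨p, hpA, hpB⟩
    obtain ⟨x, hx, e⟩ := mem_img.1 hA
    obtain ⟨x', hx', e'⟩ := mem_img.1 hB
    rw [e, hP] at hpA
    rw [e', hP] at hpB
    obtain ⟨y, -, -, h1⟩ := hpA
    obtain ⟨y', -, -, h2⟩ := hpB
    obtain rfl := (ZFSet.pair_inj.1 (h1.symm.trans h2)).1
    exact Subtype.ext (e.trans e'.symm))
  have := DT.const c.2
  have := DT.const ha
  refine ⟨c.1 ∩ ZFSet.sUnion (img S P), DT.val₀ (M := M) inferInstance, fun x hx => ?_⟩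
  have hxP : P x ∈ img S P := mem_img.2 ⟨x, hx, rfl⟩
  obtain ⟨z, ⟨hz, hzc⟩, hu⟩ := hc ⟨_, mem_of_mem ha hxP⟩ hxP
  obtain ⟨y, hy, hr, e⟩ := hP.1 hz
  rw [ap_eq (y := y)]
  · exact ⟨hy, hr⟩
  · rw [← e]
    exact ZFSet.mem_inter.2 ⟨hzc, ZFSet.mem_sUnion_of_mem hz hxP⟩
  · intro w hw
    obtain ⟨hwc, hw⟩ := ZFSet.mem_inter.1 hw
    obtain ⟨Q, hQ, hw'⟩ := ZFSet.mem_sUnion.1 hw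
    obtain ⟨x', hx', rfl⟩ := mem_img.1 hQ
    have : x = x' := by
      obtain ⟨_, _, _, e⟩ := hP.1 hw'
      exact (ZFSet.pair_inj.1 e).1
    subst this
    have := hu ⟨_, mem_of_mem c.2 hwc⟩ ⟨hw', hwc⟩
    rw [← this] at e
    exact (ZFSet.pair_inj.1 e).2

/-- The set of all elements of `M` whose rank is smaller than that of `x`. -/
noncomputable def lev (M : Set ZFSet.{u}) : ZFSet.{u} → ZFSet.{u} :=
  memRec fun x s => ZFSet.sUnion (img x fun z => pw M (ap s z))

/-- `lev M x` is a level of the cumulative hierarchy of `M`, indexed by a set instead of its rank.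
Inclusion of levels compares ranks by a formula over `M`. -/
theorem mem_lev {x : ZFSet.{u}} (hx : x ∈ M) : ∀ z, z ∈ lev M x ↔ z ∈ M ∧ z.rank < x.rank := by
  induction x using ZFSet.inductionOn with
  | h x ih =>
    intro z
    have : z ∈ lev M x ↔ ∃ w ∈ x, z ⊆ lev M w ∧ z ∈ M := by
      rw [lev, memRec_eq, ZFSet.mem_sUnion]
      simp only [mem_img]
      constructor
      · rintro ⟨_, ⟨w, hw, rfl⟩, h⟩
        rw [ap_lam hw, mem_pw] at h
        exact ⟨w, hw, h⟩
      · rintro ⟨w, hw, h⟩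
        exact ⟨_, ⟨w, hw, rfl⟩, by rw [ap_lam hw, mem_pw]; exact h⟩
    rw [this, ZFSet.lt_rank_iff]
    constructor
    · rintro ⟨w, hw, h, hz⟩
      exact ⟨hz, w, hw, ZFSet.rank_le_iff.2 fun u hu => ((ih w hw (mem_of_mem hx hw) u).1 (h hu)).2⟩
    · rintro ⟨hz, w, hw, h⟩
      exact ⟨w, hw, fun u hu => (ih w hw (mem_of_mem hx hw) u).2
        ⟨mem_of_mem hz hu, ZFSet.rank_le_iff.1 h hu⟩, hz⟩

instance DT.lev {t : (ℕ → M) → ZFSet.{u}} [DT M t] : DT M fun v => lev M (t v) := by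
  have : DT M fun v => Interp.lev M (v 0).1 := DT.memRec inferInstance
  exact DT.comp (F := fun _ x => Interp.lev M x)

/-- Scott's trick: the level of a witness of least rank is unique, so Replacement applies to it.
Such a witness is a subset of its level. -/
theorem exists_collection {a : ZFSet.{u}} (ha : a ∈ M) {R : ZFSet.{u} → ZFSet.{u} → Prop}
    [hR : Def M fun v => R (v 0).1 (v 1).1] (h : ∀ x ∈ a, ∃ y ∈ M, R x y) :
    ∃ b ∈ M, ∀ x ∈ a, ∃ y ∈ b, R x y := by
  let Q (x l : ZFSet.{u}) : Prop := ∃ y ∈ M, R x y ∧ l = lev M y ∧ ∀ y' ∈ M, R x y' → lev M y ⊆ lev M y'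
  have hQ : Def M fun v => Q (v 0).1 (v 1).1 := by
    have : Def M fun v => R (v 1).1 (v 0).1 := hR.comp₂
    have : Def M fun v => R (v 2).1 (v 0).1 := hR.comp₂
    infer_instance
  have hQ' : ∀ x ∈ a, ∃ y ∈ M, R x y ∧ ∀ y' ∈ M, R x y' → lev M y ⊆ lev M y' := by
    intro x hx
    obtain ⟨y, ⟨hy, hr⟩, hmin⟩ := (InvImage.wf ZFSet.rank Ordinal.lt_wf).has_min {y | y ∈ M ∧ R x y} (h x hx)
    refine ⟨y, hy, hr, fun y' hy' hr' z hz => ?_⟩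
    rw [mem_lev hy] at hz
    rw [mem_lev hy']
    exact ⟨hz.1, hz.2.trans_le (not_lt.1 (hmin y' ⟨hy', hr'⟩))⟩
  obtain ⟨b, hb, hbx⟩ := exists_replacement (M := M) (R := Q) ha fun x hx => by
    obtain ⟨y, hy, hr, hm⟩ := hQ' x hx
    have := DT.const hy
    refine ⟨lev M y, ⟨DT.val₀ (M := M) inferInstance, y, hy, hr, rfl, hm⟩, ?_⟩
    rintro l ⟨-, y', hy', hr', rfl, hm'⟩
    exact le_antisymm (α := ZFSet) (hm' _ hy hr) (hm _ hy' hr')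
  have := DT.const hb
  refine ⟨ZFSet.sUnion (img b fun l => pw M l), DT.val₀ (M := M) inferInstance, fun x hx => ?_⟩
  obtain ⟨y, hy, hr, hm⟩ := hQ' x hx
  have := DT.const hy
  refine ⟨y, ZFSet.mem_sUnion.2 ⟨_, mem_img.2 ⟨lev M y, (hbx _).2
    ⟨DT.val₀ (M := M) inferInstance, x, hx, y, hy, hr, rfl, hm⟩, rfl⟩, mem_pw.2 ⟨fun z hz => ?_, hy⟩⟩, hr⟩
  exact (mem_lev hy z).2 ⟨mem_of_mem hy hz, ZFSet.rank_lt_of_mem hz⟩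

theorem exists_choice_class {S : ZFSet.{u}} (hS : S ∈ M) {R : ZFSet.{u} → ZFSet.{u} → Prop}
    [hR : Def M fun v => R (v 0).1 (v 1).1] (h : ∀ x ∈ S, ∃ y ∈ M, R x y) :
    ∃ c ∈ M, ∀ x ∈ S, R x (ap c x) := by
  obtain ⟨b, hb, hbR⟩ := exists_collection hS h
  obtain ⟨c, hc, h⟩ := exists_choice hS hb hbR
  exact ⟨c, hc, fun x hx => (h x hx).2⟩

/-- A choice function is iterated by recursion along `ω`; the predecessor of a successor number is
its union. -/
theorem exists_dependent_choice {S : ZFSet.{u}} (hS : S ∈ M) {R : ZFSet.{u} → ZFSet.{u} → Prop}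
    [hR : Def M fun v => R (v 0).1 (v 1).1] (h : ∀ x ∈ S, ∃ y ∈ S, R x y) {a : ZFSet.{u}} (ha : a ∈ S) :
    ∃ s : ℕ → ZFSet.{u}, seqGraph s ∈ M ∧ s 0 = a ∧ (∀ n, s n ∈ S) ∧ ∀ n, R (s n) (s (n + 1)) := by
  classical
  obtain ⟨c, hc, h⟩ := exists_choice hS hS h
  have := DT.const hc
  have := DT.const (mem_of_mem hS ha)
  let H (x s : ZFSet.{u}) : ZFSet.{u} := if x = ∅ then a else ap c (ap s (ZFSet.sUnion x))
  have hF : DT M fun v => memRec H (v 0).1 := DT.memRec inferInstance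
  have h0 : memRec H (natSet 0) = a := by
    rw [memRec_eq]
    simp [H, natSet]
  have hs (n : ℕ) : memRec H (natSet (n + 1)) = ap c (memRec H (natSet n)) := by
    rw [memRec_eq]
    simp only [H]
    rw [if_neg, sUnion_natSet_succ, ap_lam (by simp)]
    exact fun e => ZFSet.notMem_empty (natSet n) (e ▸ ZFSet.mem_insert _ _)
  have hm (n : ℕ) : memRec H (natSet n) ∈ S := by
    induction n with
    | zero => rwa [h0]
    | succ n ih => rw [hs]; exact (h _ ih).1
  exact ⟨fun n => memRec H (natSet n), seqGraph_mem (memRec H), h0, hm,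
    fun n => by simpa only [hs] using (h _ (hm n)).2⟩

/-- If a relation of `M` has an infinite branch, then it has one in `M`. -/
theorem exists_branch {S : ZFSet.{u}} (hS : S ∈ M) {R : ZFSet.{u} → ZFSet.{u} → Prop}
    [hR : Def M fun v => R (v 0).1 (v 1).1] (Z : Set ZFSet.{u}) (hZS : ∀ x ∈ Z, x ∈ S)
    (hZ : ∀ x ∈ Z, ∃ y ∈ Z, R x y) {a : ZFSet.{u}} (ha : a ∈ Z) :
    ∃ s : ℕ → ZFSet.{u}, seqGraph s ∈ M ∧ s 0 = a ∧ (∀ n, s n ∈ S) ∧ ∀ n, R (s n) (s (n + 1)) := by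
  have := DT.const hS
  -- Stages of the well-founded part of `R`, indexed by arbitrary sets in place of ordinals: `x`
  -- enters at stage `b` if all its successors entered at stages belonging to `b`. No element of `Z`
  -- ever enters.
  let H (b s : ZFSet.{u}) : ZFSet.{u} := ZFSet.sep (fun x => ∀ z ∈ S, R x z → ∃ β ∈ b, z ∈ ap s β) S
  have hH : DT M fun v => H (v 0).1 (v 1).1 := by
    have : Def M fun v => R (v 1).1 (v 0).1 := hR.comp₂
    infer_instance
  have hF : DT M fun v => memRec H (v 0).1 := DT.memRec hH
  have hF' (i : ℕ) : DT M fun v => memRec H (v i).1 := DT.comp (F := fun _ x => memRec H x)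
  have hmem {b x} : x ∈ memRec H b ↔ x ∈ S ∧ ∀ z ∈ S, R x z → ∃ β ∈ b, z ∈ memRec H β := by
    rw [memRec_eq, ZFSet.mem_sep]
    refine and_congr_right fun _ => forall₃_congr fun z _ _ => exists_congr fun β =>
      and_congr_right fun hβ => by rw [ap_lam hβ]
  have hdisj (b : ZFSet.{u}) : ∀ x ∈ Z, x ∉ memRec H b := by
    induction b using ZFSet.inductionOn with
    | h b ih =>
      intro x hx hxb
      obtain ⟨y, hy, hr⟩ := hZ x hx
      obtain ⟨β, hβ, hyβ⟩ := (hmem.1 hxb).2 y (hZS y hy) hr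
      exact ih β hβ y hy hyβ
  have hD : ZFSet.sep (fun x => ∀ b ∈ M, x ∉ memRec H b) S ∈ M := DT.val₀ (M := M) inferInstance
  -- If every successor of `x` entered at some stage, Collection would bound these stages by one set
  -- and `x` would enter as well. Hence every element outside all stages has a successor outside all
  -- stages.
  obtain ⟨s, h1, h2, h3, h4⟩ := exists_dependent_choice hD (R := R) (by
    intro x hx
    obtain ⟨hx, hxb⟩ := ZFSet.mem_sep.1 hx
    by_contra! hcon
    have hcov : ∀ z ∈ ZFSet.sep (fun z => R x z) S, ∃ b ∈ M, z ∈ memRec H b := by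
      intro z hz
      obtain ⟨hz, hr⟩ := ZFSet.mem_sep.1 hz
      by_contra! hb
      exact hcon z (ZFSet.mem_sep.2 ⟨hz, hb⟩) hr
    have := DT.const (mem_of_mem hS hx)
    have : Def M fun v => R x (v 0).1 := hR.comp₂
    obtain ⟨b, hb, h⟩ := exists_collection (M := M) (DT.val₀ inferInstance) hcov
    refine hxb b hb (hmem.2 ⟨hx, fun z hz hr => h z (ZFSet.mem_sep.2 ⟨hz, hr⟩)⟩)) 
    (a := a) (ZFSet.mem_sep.2 ⟨hZS a ha, fun b _ => hdisj b a ha⟩)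
  exact ⟨s, h1, h2, fun n => (ZFSet.mem_sep.1 (h3 n)).1, h4⟩

end Interp

namespace Interp

variable {M : Set ZFSet.{u}} [hM : Fact (IsTransitiveModel M)]

/-! ### Finite sets and sequences of the model -/

theorem mem_of_finite {F : ZFSet.{u}} (hF : (F : Set ZFSet.{u}).Finite) (h : ∀ x ∈ F, x ∈ M) :
    F ∈ M := by
  suffices ∀ s : Set ZFSet.{u}, s.Finite → ∀ F : ZFSet.{u}, (F : Set ZFSet.{u}) = s →
      (∀ x ∈ F, x ∈ M) → F ∈ M from this _ hF F rfl h
  intro s hs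
  induction s, hs using Set.Finite.induction_on with
  | empty =>
    intro F hF _
    rw [show F = ∅ from SetLike.coe_injective (hF.trans ZFSet.coe_empty.symm)]
    exact DT.val₀ (M := M) inferInstance
  | @insert a s ha _ ih =>
    intro F hF h
    have haF : a ∈ F := by
      rw [← SetLike.mem_coe, hF]
      exact Set.mem_insert _ _
    have h1 : F \ {a} ∈ M := ih _ (by
      rw [ZFSet.coe_sdiff, hF, ZFSet.coe_singleton]
      simp [ha]) fun x hx => h x (ZFSet.mem_sdiff.1 hx).1
    have := DT.const h1
    have := DT.const (h a haF)
    rw [show F = insert a (F \ {a}) by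
      ext x
      by_cases hx : x = a <;> simp [hx, haF]]
    exact DT.val₀ (M := M) inferInstance

omit hM in
theorem exists_enumeration {F : ZFSet.{u}} (h : (F : Set ZFSet.{u}).Finite) :
    ∃ (n : ℕ) (v : ℕ → ZFSet.{u}), (∀ k < n, v k ∈ F) ∧ ∀ x ∈ F, ∃ k ∈ natSet n,
      ap (ZFSet.range fun k : Fin n => ZFSet.pair (natSet k) (v k)) k = x := by
  obtain ⟨n, f, -, hf⟩ := h.fin_param
  let v (k : ℕ) : ZFSet.{u} := if h : k < n then f ⟨k, h⟩ else ∅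
  have hv (k : Fin n) : v k = f k := by simp [v]
  refine ⟨n, v, fun k hk => ?_, fun x hx => ?_⟩
  · rw [← SetLike.mem_coe, ← hf, hv ⟨k, hk⟩]
    exact Set.mem_range_self _
  · rw [← SetLike.mem_coe, ← hf] at hx
    obtain ⟨k, rfl⟩ := hx
    refine ⟨natSet k, by simp, ap_eq (ZFSet.mem_range.2 ⟨k, by rw [hv]⟩) fun z hz => ?_⟩
    obtain ⟨l, hl⟩ := ZFSet.mem_range.1 hz
    obtain ⟨h1, h2⟩ := ZFSet.pair_inj.1 hl
    rw [← h2, hv, Fin.ext (natSet_injective h1)]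

/-- Finiteness is absolute: a finite enumeration of elements of `M` is itself in `M`, so its
existence can be expressed over `M`. -/
instance Def.finite {t : (ℕ → M) → ZFSet.{u}} [ht : DT M t] :
    Def M fun v => (t v : Set ZFSet.{u}).Finite := by
  have := ht.subst (· + 1)
  have := ht.subst (· + 2)
  refine (inferInstance : Def M fun v => ∃ e ∈ M, ∃ n ∈ om, ∀ x ∈ t v, ∃ k ∈ n, ap e k = x).congr
    fun v => ⟨fun h => ?_, ?_⟩
  · obtain ⟨n, w, hw, h⟩ := exists_enumeration h
    refine ⟨_, mem_of_finite ?_ fun x hx => ?_, natSet n, natSet_mem_om n, h⟩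
    · rw [ZFSet.coe_range]
      exact Set.finite_range _
    · obtain ⟨k, rfl⟩ := ZFSet.mem_range.1 hx
      have := DT.const (natSet_mem (M := M) k)
      have := DT.const (mem_of_mem (ht.mem v) (hw k k.2))
      exact DT.val₀ (M := M) inferInstance
  · rintro ⟨e, -, n, hn, h⟩
    obtain ⟨n, rfl⟩ := mem_om.1 hn
    refine ((Set.finite_range fun k : Fin n => ap e (natSet k))).subset fun x hx => ?_
    obtain ⟨k, hk, rfl⟩ := h x hx
    obtain ⟨m, hm, rfl⟩ := mem_natSet.1 hk
    exact ⟨⟨m, hm⟩, rfl⟩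

theorem seqGraph_update_mem {v : ℕ → ZFSet.{u}} (hv : seqGraph v ∈ M) (n : ℕ) {y : ZFSet.{u}}
    (hy : y ∈ M) : seqGraph (Function.update v n y) ∈ M := by
  classical
  have := DT.const hv
  have := DT.const hy
  have := DT.const (natSet_mem (M := M) n)
  convert seqGraph_mem (M := M) (fun k => if k = natSet n then y else ap (seqGraph v) k) using 2
  ext1 k
  simp [Function.update_apply]

/-- Used to keep sequences in `M` when finitely many of their terms are chosen outside `M`. -/
theorem seqGraph_mem_of_eq {v w : ℕ → ZFSet.{u}} (hv : seqGraph v ∈ M) (n : ℕ)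
    (hw : ∀ k < n, w k ∈ M) (h : ∀ k, n ≤ k → w k = v k) : seqGraph w ∈ M := by
  induction n generalizing w with
  | zero => rwa [show w = v from funext fun k => h k (Nat.zero_le k)]
  | succ n ih =>
    have : seqGraph (Function.update w n (v n)) ∈ M := by
      refine ih (fun k hk => ?_) fun k hk => ?_
      · rw [Function.update_of_ne hk.ne]
        exact hw k (by omega)
      · rcases hk.eq_or_lt with rfl | hk
        · simp
        · rw [Function.update_of_ne hk.ne']
          exact h k hk
    simpa using seqGraph_update_mem this n (hw n (by omega))

theorem exists_seq {R : ZFSet.{u} → ZFSet.{u} → Prop} [hR : Def M fun v => R (v 0).1 (v 1).1]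
    (h : ∀ n, ∃ y ∈ M, R (natSet n) y) :
    ∃ v : ℕ → ZFSet.{u}, seqGraph v ∈ M ∧ ∀ n, R (natSet n) (v n) := by
  obtain ⟨c, hc, h⟩ := exists_choice_class (M := M) om_mem (R := R) (by rwa [forall_om])
  have := DT.const hc
  exact ⟨_, seqGraph_mem (ap c), fun n => h _ (natSet_mem_om n)⟩

theorem exists_seq_mem {X : ℕ → ZFSet.{u}} (hX : seqGraph X ∈ M) (h : ∀ n, ∃ y, y ∈ X n) :
    ∃ v : ℕ → ZFSet.{u}, seqGraph v ∈ M ∧ ∀ n, v n ∈ X n := by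
  have := DT.const hX
  obtain ⟨v, hv, h⟩ := exists_seq (M := M) (R := fun k y => y ∈ ap (seqGraph X) k) fun n => by
    obtain ⟨y, hy⟩ := h n
    exact ⟨y, mem_of_mem (apply_mem hX n) hy, by simpa⟩
  exact ⟨v, hv, fun n => by simpa using h n⟩

/-! ### The product set and its boxes -/

omit hM in
theorem mem_prodSet {X : ℕ → ZFSet.{u}} {x : ZFSet.{u}} :
    x ∈ prodSet M X ↔ ∃ v : ℕ → ZFSet.{u}, seqGraph v ∈ M ∧ (∀ n, v n ∈ X n) ∧ x = seqGraph v := by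
  rw [mem_prodSet_iff]
  constructor
  · rintro ⟨hx, v, rfl⟩
    exact ⟨_, hx, fun n => (v n).2, rfl⟩
  · rintro ⟨v, hv, h, rfl⟩
    exact ⟨hv, fun n => ⟨v n, h n⟩, rfl⟩

omit hM in
theorem seqGraph_mem_prodSet {X v : ℕ → ZFSet.{u}} :
    seqGraph v ∈ prodSet M X ↔ seqGraph v ∈ M ∧ ∀ n, v n ∈ X n := by
  rw [mem_prodSet]
  constructor
  · rintro ⟨w, hw, h, e⟩
    have : v = w := funext fun n => by rw [← ap_seqGraph v, e, ap_seqGraph]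
    exact this ▸ ⟨hw, h⟩
  · rintro ⟨hv, h⟩
    exact ⟨v, hv, h, rfl⟩

theorem prodSet_mem {X : ℕ → ZFSet.{u}} (hX : seqGraph X ∈ M) : prodSet M X ∈ M := by
  have := DT.const hX
  -- Two unions of the graph reach the sets `X n`, a third one their elements; this bounds the
  -- values of the sequences.
  refine ((inferInstance : DT M fun _ => ZFSet.sep (fun x => (∀ k ∈ om, ap x k ∈ ap (seqGraph X) k) ∧
    x = lam om fun k => ap x k) (pw M (ZFSet.prod om (ZFSet.sUnion (ZFSet.sUnion
      (ZFSet.sUnion (seqGraph X))))))).congr (t := fun _ => prodSet M X) fun _ => ?_).val₀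
  ext x
  rw [mem_prodSet, ZFSet.mem_sep, mem_pw, forall_om]
  constructor
  · rintro ⟨v, hv, h, rfl⟩
    refine ⟨⟨fun p hp => ?_, hv⟩, by simpa, seqGraph_eq_lam_ap v⟩
    obtain ⟨n, rfl⟩ := ZFSet.mem_range.1 hp
    exact ZFSet.pair_mem_prod.2 ⟨natSet_mem_om n, ZFSet.mem_sUnion_of_mem (h n)
      (mem_sUnion_of_pair_mem_right (pair_mem_seqGraph.2 rfl))⟩
  · rintro ⟨⟨-, hx⟩, h, e⟩
    rw [← seqGraph_eq_lam] at e
    refine ⟨_, e ▸ hx, fun n => ?_, e⟩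
    simpa using h n

/-- The set of all sequences `x` in the product with `x k ∈ u k` for all `k`. -/
noncomputable def box (M : Set ZFSet.{u}) (X : ℕ → ZFSet.{u}) (u : ZFSet.{u}) : ZFSet.{u} :=
  ZFSet.sep (fun x => ∀ k ∈ om, ap x k ∈ ap u k) (prodSet M X)

omit hM in
theorem seqGraph_mem_box {X u v : ℕ → ZFSet.{u}} :
    seqGraph v ∈ box M X (seqGraph u) ↔ seqGraph v ∈ prodSet M X ∧ ∀ k, v k ∈ u k := by
  rw [box, ZFSet.mem_sep, forall_om]
  simp

theorem DT.box {X : ℕ → ZFSet.{u}} (hX : seqGraph X ∈ M) {t : (ℕ → M) → ZFSet.{u}} [ht : DT M t] :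
    DT M fun v => box M X (t v) := by
  have := DT.const (prodSet_mem hX)
  have := ht.subst (· + 1)
  have := ht.subst (· + 2)
  unfold Interp.box
  infer_instance

/-- `u` is a sequence of open sets, all but finitely many of them equal to the whole space. -/
structure IsSupport (M : Set ZFSet.{u}) (X τ : ℕ → ZFSet.{u}) (u : ℕ → ZFSet.{u}) (n : ℕ) : Prop where
  mem : seqGraph u ∈ M
  isOpen : ∀ k, u k ∈ τ k
  eq : ∀ k, n ≤ k → u k = X k

/-- The set of all open boxes of the product. -/
noncomputable def boxes (M : Set ZFSet.{u}) (X τ : ℕ → ZFSet.{u}) : ZFSet.{u} :=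
  ZFSet.sep (fun P => ∃ u ∈ prodSet M τ, (∃ n ∈ om, ∀ k ∈ om, k ∉ n → ap u k = ap (seqGraph X) k) ∧
    P = box M X u) (pw M (prodSet M X))

theorem boxes_mem {X τ : ℕ → ZFSet.{u}} (hX : seqGraph X ∈ M) (hτ : seqGraph τ ∈ M) :
    boxes M X τ ∈ M := by
  have := DT.const (prodSet_mem hX)
  have := DT.const (prodSet_mem hτ)
  have := DT.const hX
  have : DT M fun v => box M X (v 0).1 := DT.box hX
  exact (inferInstance : DT M fun _ => ZFSet.sep (fun P => ∃ u ∈ prodSet M τ,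
    (∃ n ∈ om, ∀ k ∈ om, k ∉ n → ap u k = ap (seqGraph X) k) ∧ P = box M X u)
    (pw M (prodSet M X))).val₀

theorem mem_boxes {X τ : ℕ → ZFSet.{u}} (hX : seqGraph X ∈ M) {P : ZFSet.{u}} :
    P ∈ boxes M X τ ↔ ∃ u n, IsSupport M X τ u n ∧ P = box M X (seqGraph u) := by
  rw [boxes, ZFSet.mem_sep, mem_pw]
  simp only [exists_om, forall_om, natSet_mem_natSet, not_lt, ap_seqGraph]
  constructor
  · rintro ⟨-, u, hu, ⟨n, hn⟩, rfl⟩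
    obtain ⟨u, hu', h, rfl⟩ := mem_prodSet.1 hu
    exact ⟨u, n, ⟨hu', h, by simpa using hn⟩, rfl⟩
  · rintro ⟨u, n, hu, rfl⟩
    have := DT.const hu.mem
    exact ⟨⟨ZFSet.sep_subset, (DT.box hX : DT M fun _ => box M X (seqGraph u)).val₀⟩, seqGraph u,
      seqGraph_mem_prodSet.2 ⟨hu.mem, hu.isOpen⟩, ⟨n, by simpa using hu.eq⟩, rfl⟩

omit hM in
theorem seqGraph_mem_prodBox {X U v : ℕ → ZFSet.{u}} {F : Finset ℕ} :
    seqGraph v ∈ prodBox M X F U ↔ seqGraph v ∈ prodSet M X ∧ ∀ n ∈ F, v n ∈ U n := by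
  simp [prodBox, pair_mem_seqGraph]

omit hM in
theorem box_ext {X : ℕ → ZFSet.{u}} {P Q : ZFSet.{u}} (hP : P ⊆ prodSet M X) (hQ : Q ⊆ prodSet M X)
    (h : ∀ v, seqGraph v ∈ prodSet M X → (seqGraph v ∈ P ↔ seqGraph v ∈ Q)) : P = Q := by
  ext x
  constructor <;> intro hx
  · obtain ⟨v, hv, h', rfl⟩ := mem_prodSet.1 (hP hx)
    exact (h v (hP hx)).1 hx
  · obtain ⟨v, hv, h', rfl⟩ := mem_prodSet.1 (hQ hx)
    exact (h v (hQ hx)).2 hx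

/-- The finitely supported boxes, given by external finite data, are the members of `boxes`, a set
defined inside `M`: unrestricted sides are filled in with the whole space. -/
theorem exists_prodBox_iff {X τ : ℕ → ZFSet.{u}} (hX : seqGraph X ∈ M)
    (hτ : ∀ i, IsSpaceIn M (X i) (τ i)) {P : ZFSet.{u}} :
    P ∈ boxes M X τ ↔ ∃ (F : Finset ℕ) (U : ℕ → ZFSet.{u}), (∀ n ∈ F, U n ∈ τ n) ∧ P = prodBox M X F U := by
  classical
  rw [mem_boxes hX]
  constructor
  · rintro ⟨u, n, hu, rfl⟩
    refine ⟨Finset.range n, u, fun k _ => hu.isOpen k,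
      box_ext ZFSet.sep_subset ZFSet.sep_subset fun v hv => ?_⟩
    rw [seqGraph_mem_box, seqGraph_mem_prodBox]
    refine and_congr_right fun _ => ⟨fun h k _ => h k, fun h k => ?_⟩
    by_cases hk : k < n
    · exact h k (Finset.mem_range.2 hk)
    · rw [hu.eq k (not_lt.1 hk)]
      exact (seqGraph_mem_prodSet.1 hv).2 k
  · rintro ⟨F, U, hU, rfl⟩
    refine ⟨fun k => if k ∈ F then U k else X k, F.sup id + 1, ⟨?_, fun k => ?_, fun k hk => ?_⟩,
      box_ext ZFSet.sep_subset ZFSet.sep_subset fun v hv => ?_⟩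
    · refine seqGraph_mem_of_eq hX (F.sup id + 1) (fun k _ => ?_) fun k hk => ?_
      · split
        · exact mem_of_mem (hτ k).opens_mem (hU k ‹_›)
        · exact (hτ k).carrier_mem
      · rw [if_neg]
        intro h
        have := Finset.le_sup (f := id) h
        simp only [id] at this
        omega
    · split
      · exact hU k ‹_›
      · exact (hτ k).univ_mem
    · rw [if_neg]
      intro h
      have := Finset.le_sup (f := id) h
      simp only [id] at this
      omega
    · rw [seqGraph_mem_box, seqGraph_mem_prodBox]
      refine and_congr_right fun _ => forall_congr' fun k => ?_
      by_cases hk : k ∈ F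
      · simp [hk]
      · simpa [hk] using (seqGraph_mem_prodSet.1 hv).2 k

theorem mem_prodTopology {X τ : ℕ → ZFSet.{u}} (hX : seqGraph X ∈ M)
    (hτ : ∀ i, IsSpaceIn M (X i) (τ i)) {O : ZFSet.{u}} :
    O ∈ prodTopology M X τ ↔ O ∈ pw M (prodSet M X) ∧ ∀ x ∈ O, ∃ P ∈ boxes M X τ, x ∈ P ∧ P ⊆ O := by
  rw [prodTopology, ZFSet.mem_sep, ZFSet.mem_powerset, mem_pw, and_assoc]
  refine and_congr_right fun _ => and_congr_right fun _ => forall₂_congr fun x _ => ?_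
  simp only [exists_prodBox_iff hX hτ]
  constructor
  · rintro ⟨F, U, hU, h⟩
    exact ⟨_, ⟨F, U, hU, rfl⟩, h⟩
  · rintro ⟨_, ⟨F, U, hU, rfl⟩, h⟩
    exact ⟨F, U, hU, h⟩

theorem prodTopology_mem {X τ : ℕ → ZFSet.{u}} (hX : seqGraph X ∈ M) (hτm : seqGraph τ ∈ M)
    (hτ : ∀ i, IsSpaceIn M (X i) (τ i)) : prodTopology M X τ ∈ M := by
  have := DT.const (prodSet_mem hX)
  have := DT.const (boxes_mem hX hτm)
  refine ((inferInstance : DT M fun _ => ZFSet.sep (fun O => ∀ x ∈ O, ∃ P ∈ boxes M X τ, x ∈ P ∧ P ⊆ O)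
    (pw M (prodSet M X))).congr (t := fun _ => prodTopology M X τ) fun _ => ?_).val₀
  ext O
  rw [mem_prodTopology hX hτ, ZFSet.mem_sep]

theorem boxes_subset_prodTopology {X τ : ℕ → ZFSet.{u}} (hX : seqGraph X ∈ M)
    (hτ : ∀ i, IsSpaceIn M (X i) (τ i)) {P : ZFSet.{u}} (hP : P ∈ boxes M X τ) :
    P ∈ prodTopology M X τ :=
  (mem_prodTopology hX hτ).2 ⟨(ZFSet.mem_sep.1 hP).1, fun _ hx => ⟨P, hP, hx, fun _ h => h⟩⟩

theorem IsSupport.inter {X τ u u' : ℕ → ZFSet.{u}} {n n' : ℕ}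
    (hτ : ∀ i, IsSpaceIn M (X i) (τ i)) (hu : IsSupport M X τ u n) (hu' : IsSupport M X τ u' n') :
    IsSupport M X τ (fun k => u k ∩ u' k) (max n n') := by
  refine ⟨?_, fun k => (hτ k).inter_mem _ (hu.isOpen k) _ (hu'.isOpen k), fun k hk => ?_⟩
  · have := DT.const hu.mem
    have := DT.const hu'.mem
    simpa using seqGraph_mem (M := M) fun k => ap (seqGraph u) k ∩ ap (seqGraph u') k
  · rw [hu.eq k (le_of_max_le_left hk), hu'.eq k (le_of_max_le_right hk)]
    ext
    simp

omit hM in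
theorem box_inter {X u u' : ℕ → ZFSet.{u}} : box M X (seqGraph fun k => u k ∩ u' k) =
    box M X (seqGraph u) ∩ box M X (seqGraph u') := by
  refine box_ext ZFSet.sep_subset (fun x hx => ZFSet.sep_subset (ZFSet.mem_inter.1 hx).1) fun v hv => ?_
  simp only [ZFSet.mem_inter, seqGraph_mem_box, forall_and]
  tauto

theorem isSupport_update {X τ : ℕ → ZFSet.{u}} (hX : seqGraph X ∈ M)
    (hτ : ∀ i, IsSpaceIn M (X i) (τ i)) {i : ℕ} {O : ZFSet.{u}} (hO : O ∈ τ i) :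
    IsSupport M X τ (Function.update X i O) (i + 1) := by
  refine ⟨seqGraph_update_mem hX i (mem_of_mem (hτ i).opens_mem hO), fun k => ?_, fun k hk => ?_⟩
  · by_cases hk : k = i
    · subst hk
      simpa
    · rw [Function.update_of_ne hk]
      exact (hτ k).univ_mem
  · rw [Function.update_of_ne (by omega)]

omit hM in
theorem seqGraph_mem_box_update {X v : ℕ → ZFSet.{u}} {i : ℕ} {O : ZFSet.{u}} :
    seqGraph v ∈ box M X (seqGraph (Function.update X i O)) ↔ seqGraph v ∈ prodSet M X ∧ v i ∈ O := by
  rw [seqGraph_mem_box]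
  refine and_congr_right fun hv => ⟨fun h => by simpa using h i, fun h k => ?_⟩
  by_cases hk : k = i
  · subst hk
    simpa
  · rw [Function.update_of_ne hk]
    exact (seqGraph_mem_prodSet.1 hv).2 k

theorem prodSet_mem_boxes {X τ : ℕ → ZFSet.{u}} (hX : seqGraph X ∈ M)
    (hτ : ∀ i, IsSpaceIn M (X i) (τ i)) : prodSet M X ∈ boxes M X τ := by
  refine (mem_boxes hX).2 ⟨X, 0, ⟨hX, fun k => (hτ k).univ_mem, fun _ _ => rfl⟩,
    box_ext (fun _ h => h) ZFSet.sep_subset fun v hv => ?_⟩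
  rw [seqGraph_mem_box]
  exact ⟨fun h => ⟨h, (seqGraph_mem_prodSet.1 h).2⟩, fun h => h.1⟩

theorem isSpaceIn_prod {X τ : ℕ → ZFSet.{u}} (hX : seqGraph X ∈ M) (hτm : seqGraph τ ∈ M)
    (hτ : ∀ i, IsSpaceIn M (X i) (τ i)) : IsSpaceIn M (prodSet M X) (prodTopology M X τ) where
  carrier_mem := prodSet_mem hX
  opens_mem := prodTopology_mem hX hτm hτ
  subset O hO := (mem_pw.1 ((mem_prodTopology hX hτ).1 hO).1).1
  empty_mem := by
    refine (mem_prodTopology hX hτ).2 ⟨mem_pw.2 ⟨ZFSet.empty_subset _, DT.val₀ (M := M) inferInstance⟩, ?_⟩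
    simp
  univ_mem := boxes_subset_prodTopology hX hτ (prodSet_mem_boxes hX hτ)
  inter_mem O hO P hP := by
    rw [mem_prodTopology hX hτ, mem_pw] at *
    refine ⟨⟨fun x hx => hO.1.1 (ZFSet.mem_inter.1 hx).1, ?_⟩, fun x hx => ?_⟩
    · have := DT.const hO.1.2
      have := DT.const hP.1.2
      exact DT.val₀ (M := M) inferInstance
    · obtain ⟨hx1, hx2⟩ := ZFSet.mem_inter.1 hx
      obtain ⟨A, hA, hxA, hAO⟩ := hO.2 x hx1
      obtain ⟨B, hB, hxB, hBP⟩ := hP.2 x hx2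
      obtain ⟨u, n, hu, rfl⟩ := (mem_boxes hX).1 hA
      obtain ⟨w, m, hw, rfl⟩ := (mem_boxes hX).1 hB
      refine ⟨_, (mem_boxes hX).2 ⟨_, _, hu.inter hτ hw, rfl⟩, ?_⟩
      rw [box_inter]
      refine ⟨ZFSet.mem_inter.2 ⟨hxA, hxB⟩, fun y hy => ?_⟩
      obtain ⟨h1, h2⟩ := ZFSet.mem_inter.1 hy
      exact ZFSet.mem_inter.2 ⟨hAO h1, hBP h2⟩
  sUnion_mem A hA h := by
    rw [mem_prodTopology hX hτ, mem_pw]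
    refine ⟨⟨fun x hx => ?_, sUnion_mem hA⟩, fun x hx => ?_⟩ <;>
      obtain ⟨O, hO, hxO⟩ := ZFSet.mem_sUnion.1 hx <;>
      have hO' := (mem_prodTopology hX hτ).1 (h hO)
    · exact (mem_pw.1 hO'.1).1 hxO
    · obtain ⟨P, hP, hxP, hPO⟩ := hO'.2 x hxO
      exact ⟨P, hP, hxP, fun y hy => ZFSet.mem_sUnion_of_mem (hPO hy) hO⟩
  t0 x hx y hy h := by
    obtain ⟨v, hv, hvX, rfl⟩ := mem_prodSet.1 hx
    obtain ⟨w, hw, hwX, rfl⟩ := mem_prodSet.1 hy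
    congr 1
    ext1 i
    refine (hτ i).t0 _ (hvX i) _ (hwX i) fun O hO => ?_
    have := h _ (boxes_subset_prodTopology hX hτ
      ((mem_boxes hX).2 ⟨_, _, isSupport_update hX hτ hO, rfl⟩))
    simpa [seqGraph_mem_box_update, hx, hy] using this

end Interp

namespace Interp

variable {M : Set ZFSet.{u}} [hM : Fact (IsTransitiveModel M)]

/-! ### Witnesses of interpretability -/

/-- The image of `B` under the relation `f`, as a subset of `X`. -/
noncomputable def im (X f B : ZFSet.{u}) : ZFSet.{u} :=
  ZFSet.sep (fun x => ∃ c ∈ B, ZFSet.pair c x ∈ f) X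

omit hM in
theorem mem_im {X f B x : ZFSet.{u}} : x ∈ im X f B ↔ x ∈ X ∧ ∃ c ∈ B, ZFSet.pair c x ∈ f :=
  ZFSet.mem_sep

omit hM in
theorem im_mono {X f B C : ZFSet.{u}} (h : B ⊆ C) : im X f B ⊆ im X f C := fun x hx => by
  obtain ⟨h1, c, hc, h2⟩ := mem_im.1 hx
  exact mem_im.2 ⟨h1, c, h hc, h2⟩

instance DT.im {X f B : (ℕ → M) → ZFSet.{u}} [hX : DT M X] [hf : DT M f] [hB : DT M B] :
    DT M fun v => im (X v) (f v) (B v) := by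
  have := hf.subst (· + 1)
  have := hf.subst (· + 2)
  have := hB.subst (· + 1)
  unfold Interp.im
  infer_instance

/-- The closure of `B'` in the space `K` is contained in `B` and in the first `n` sets of the
sequence `V`. -/
def IsShrinking (K κ V n B B' : ZFSet.{u}) : Prop :=
  ∃ Q ∈ κ, B' ∩ Q = ∅ ∧ ∀ c ∈ K, c ∉ Q → c ∈ B ∧ ∀ m ∈ n, c ∈ ap V m

instance Def.isShrinking {K κ V n B C : (ℕ → M) → ZFSet.{u}} [hK : DT M K] [hκ : DT M κ]
    [hV : DT M V] [hn : DT M n] [hB : DT M B] [hC : DT M C] :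
    Def M fun v => IsShrinking (K v) (κ v) (V v) (n v) (B v) (C v) := by
  have := hC.subst (· + 1)
  have := hK.subst (· + 1)
  have := hB.subst (· + 2)
  have := hn.subst (· + 2)
  have := hV.subst (· + 3)
  unfold IsShrinking
  infer_instance

/-- `⟨X, τ⟩` is the image under the open continuous relation `f` of a Čech complete subspace of the
compact space `⟨K, κ⟩`, namely the intersection of the sequence `V`. -/
structure IsWitness (M : Set ZFSet.{u}) (X τ K κ f V : ZFSet.{u}) : Prop where
  subset : ∀ B ∈ κ, B ⊆ K
  univ_mem : K ∈ κ
  inter_mem : ∀ B ∈ κ, ∀ C ∈ κ, B ∩ C ∈ κ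
  compact : IsCompactIn M K κ
  im_mem : ∀ B ∈ κ, im X f B ∈ τ
  exists_shrinking : ∀ B ∈ κ, ∀ n ∈ om, ∀ c ∈ B, ∀ x ∈ X, ZFSet.pair c x ∈ f →
    ∃ C ∈ κ, c ∈ C ∧ IsShrinking K κ V n B C
  complete : ∀ c ∈ K, (∀ m ∈ om, c ∈ ap V m) → ap f c ∈ X ∧ ZFSet.pair c (ap f c) ∈ f
  continuous : ∀ O ∈ τ, ∀ c ∈ K, ∀ x ∈ O, ZFSet.pair c x ∈ f → ∃ N ∈ κ, c ∈ N ∧ im X f N ⊆ O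
  onto : ∀ x ∈ X, ∃ c ∈ K, ZFSet.pair c x ∈ f

omit hM in
theorem DT.shifts {t : (ℕ → M) → ZFSet.{u}} (h : DT M t) :
    (DT M fun v => t fun n => v (n + 1)) ∧ (DT M fun v => t fun n => v (n + 2)) ∧
      (DT M fun v => t fun n => v (n + 3)) ∧ (DT M fun v => t fun n => v (n + 4)) ∧
      (DT M fun v => t fun n => v (n + 5)) :=
  ⟨h.subst (· + 1), h.subst (· + 2), h.subst (· + 3), h.subst (· + 4), h.subst (· + 5)⟩

instance Def.isCompactIn {K κ : (ℕ → M) → ZFSet.{u}} [hK : DT M K] [hκ : DT M κ] :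
    Def M fun v => IsCompactIn M (K v) (κ v) := by
  have := hK.subst (· + 1)
  have := hκ.subst (· + 1)
  have := hK.subst (· + 2)
  unfold IsCompactIn
  infer_instance

set_option synthInstance.maxHeartbeats 400000 in
set_option synthInstance.maxSize 2000 in
instance Def.isWitness {X τ K κ f V : (ℕ → M) → ZFSet.{u}} [hX : DT M X] [hτ : DT M τ]
    [hK : DT M K] [hκ : DT M κ] [hf : DT M f] [hV : DT M V] :
    Def M fun v => IsWitness M (X v) (τ v) (K v) (κ v) (f v) (V v) := by
  obtain ⟨_, _, _, _, _⟩ := hX.shifts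
  obtain ⟨_, _, _, _, _⟩ := hτ.shifts
  obtain ⟨_, _, _, _, _⟩ := hK.shifts
  obtain ⟨_, _, _, _, _⟩ := hκ.shifts
  obtain ⟨_, _, _, _, _⟩ := hf.shifts
  obtain ⟨_, _, _, _, _⟩ := hV.shifts
  refine (inferInstance : Def M fun v => (∀ B ∈ κ v, B ⊆ K v) ∧ K v ∈ κ v ∧
    (∀ B ∈ κ v, ∀ C ∈ κ v, B ∩ C ∈ κ v) ∧ IsCompactIn M (K v) (κ v) ∧
    (∀ B ∈ κ v, im (X v) (f v) B ∈ τ v) ∧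
    (∀ B ∈ κ v, ∀ n ∈ om, ∀ c ∈ B, ∀ x ∈ X v, ZFSet.pair c x ∈ f v →
      ∃ C ∈ κ v, c ∈ C ∧ IsShrinking (K v) (κ v) (V v) n B C) ∧
    (∀ c ∈ K v, (∀ m ∈ om, c ∈ ap (V v) m) →
      ap (f v) c ∈ X v ∧ ZFSet.pair c (ap (f v) c) ∈ f v) ∧
    (∀ O ∈ τ v, ∀ c ∈ K v, ∀ x ∈ O, ZFSet.pair c x ∈ f v →
      ∃ N ∈ κ v, c ∈ N ∧ im (X v) (f v) N ⊆ O) ∧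
    (∀ x ∈ X v, ∃ c ∈ K v, ZFSet.pair c x ∈ f v)).congr fun v => ?_
  exact ⟨fun h => ⟨h.1, h.2, h.3, h.4, h.5, h.6, h.7, h.8, h.9⟩,
    fun ⟨h1, h2, h3, h4, h5, h6, h7, h8, h9⟩ => ⟨h1, h2, h3, h4, h5, h6, h7, h8, h9⟩⟩

theorem IsSpaceIn.union_mem {X τ O P : ZFSet.{u}} (h : IsSpaceIn M X τ) (hO : O ∈ τ) (hP : P ∈ τ) :
    O ∪ P ∈ τ := by
  have h1 : ({O, P} : ZFSet.{u}) ∈ M :=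
    pair_set_mem (mem_of_mem h.opens_mem hO) (mem_of_mem h.opens_mem hP)
  rw [← ZFSet.sUnion_pair]
  refine h.sUnion_mem _ h1 fun x hx => ?_
  rcases ZFSet.mem_pair.1 hx with rfl | rfl
  exacts [hO, hP]

/-- The space is covered by `O` together with the open sets that miss some neighborhood of `x`. From
a finite subcover, the union of the latter and the intersection of the matching neighborhoods
separate `x` from the complement of `O`. -/
theorem isRegular_of_isCompactIn {K κ : ZFSet.{u}} (h : IsSpaceIn M K κ) (hH : IsHausdorff K κ)
    (hK : IsCompactIn M K κ) : IsRegular K κ := by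
  intro O hO x hx
  have := DT.const h.opens_mem
  have := DT.const h.carrier_mem
  have := DT.const (mem_of_mem h.opens_mem hO)
  have := DT.const (mem_of_mem h.carrier_mem (h.subset O hO hx))
  obtain ⟨F, -, hFC, hF, hFK⟩ := hK
    (ZFSet.sep (fun Q => Q = O ∨ ∃ P ∈ κ, x ∈ P ∧ P ∩ Q = ∅) κ)
    (DT.val₀ (M := M) inferInstance) ZFSet.sep_subset (by
      ext y
      rw [ZFSet.mem_sUnion]
      refine ⟨fun ⟨Q, hQ, hy⟩ => h.subset Q (ZFSet.mem_sep.1 hQ).1 hy, fun hy => ?_⟩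
      by_cases hxy : x = y
      · exact ⟨O, ZFSet.mem_sep.2 ⟨hO, .inl rfl⟩, hxy ▸ hx⟩
      · obtain ⟨P, hP, Q, hQ, hxP, hyQ, e⟩ := hH x (h.subset O hO hx) y hy hxy
        exact ⟨Q, ZFSet.mem_sep.2 ⟨hQ, .inr ⟨P, hP, hxP, e⟩⟩, hyQ⟩)
  have key : ∀ s : Set ZFSet.{u}, s.Finite → (∀ R ∈ s, R ∈ κ ∧ (R = O ∨ ∃ P ∈ κ, x ∈ P ∧ P ∩ R = ∅)) →
      ∃ P ∈ κ, ∃ Q ∈ κ, x ∈ P ∧ P ∩ Q = ∅ ∧ ∀ R ∈ s, ∀ y ∈ R, y ∈ O ∨ y ∈ Q := by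
    intro s hs
    induction s, hs using Set.Finite.induction_on with
    | empty => exact fun _ => ⟨K, h.univ_mem, ∅, h.empty_mem, h.subset O hO hx, by ext; simp, by simp⟩
    | @insert R s _ _ ih =>
      intro hs
      obtain ⟨P, hP, Q, hQ, hxP, e, hR⟩ := ih fun R' hR' => hs R' (.inr hR')
      obtain ⟨hRκ, rfl | ⟨P', hP', hxP', e'⟩⟩ := hs R (.inl rfl)
      · refine ⟨P, hP, Q, hQ, hxP, e, ?_⟩
        rintro R' (rfl | hR') y hy
        exacts [.inl hy, hR R' hR' y hy]
      · refine ⟨P ∩ P', h.inter_mem _ hP _ hP', Q ∪ R, h.union_mem hQ hRκ,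
          ZFSet.mem_inter.2 ⟨hxP, hxP'⟩, ?_, ?_⟩
        · rw [ZFSet.eq_empty] at e e' ⊢
          intro y hy
          simp only [ZFSet.mem_inter, ZFSet.mem_union] at hy e e'
          have := e y
          have := e' y
          tauto
        · rintro R' (rfl | hR') y hy
          · exact .inr (ZFSet.mem_union.2 (.inr hy))
          · exact (hR R' hR' y hy).imp_right fun h => ZFSet.mem_union.2 (.inl h)
  obtain ⟨P, hP, Q, hQ, hxP, e, hR⟩ := key _ hF fun R hR => ZFSet.mem_sep.1 (hFC hR)
  refine ⟨P, hP, Q, hQ, hxP, fun y hy => ?_, e⟩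
  obtain ⟨hy, hyO⟩ := ZFSet.mem_sdiff.1 hy
  rw [← hFK, ZFSet.mem_sUnion] at hy
  obtain ⟨R, hRF, hyR⟩ := hy
  exact (hR R hRF y hyR).resolve_left hyO

theorem IsInterpretableIn.exists_isWitness {X τ : ZFSet.{u}} (h : IsInterpretableIn M X τ) :
    ∃ K ∈ M, ∃ κ ∈ M, ∃ f ∈ M, ∃ V ∈ M, IsWitness M X τ K κ f V := by
  obtain ⟨hX, -, -, Y, σ, f, ⟨hY, K, κ, hK, hH, hKc, ⟨U, hU, hUκ, hYU⟩, hσ⟩, ⟨hf, hfun, hcont⟩, hopen,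
    honto⟩ := h
  have hfY {c x} (h : ZFSet.pair c x ∈ f) : c ∈ Y := (ZFSet.pair_mem_prod.1 (hfun.1 h)).1
  have hfX {c x} (h : ZFSet.pair c x ∈ f) : x ∈ X := (ZFSet.pair_mem_prod.1 (hfun.1 h)).2
  refine ⟨K, hK.carrier_mem, κ, hK.opens_mem, f, hf, seqGraph U, hU, hK.subset, hK.univ_mem,
    hK.inter_mem, hKc, fun B hB => ?_, fun B hB n hn c hc x hx hcx => ?_, fun c hc hcV => ?_,
    fun O hO c hc x hx hcx => ?_, fun x hx => ?_⟩
  · convert hopen (B ∩ Y) ((hσ _).2 ⟨B, hB, rfl⟩) using 1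
    ext x
    simp only [mem_im, ZFSet.mem_sep, ZFSet.mem_inter]
    exact and_congr_right fun _ => exists_congr fun c =>
      ⟨fun h => ⟨⟨h.1, hfY h.2⟩, h.2⟩, fun h => ⟨h.1.1, h.2⟩⟩
  · obtain ⟨n, rfl⟩ := mem_om.1 hn
    -- Intersect `B` with the first `n` sets of the `G_δ` representation; regularity of `K` then
    -- gives a neighborhood of `c` whose closure lies in the intersection.
    have hD : ∃ D ∈ κ, c ∈ D ∧ D ⊆ B ∧ ∀ m < n, D ⊆ U m := by
      clear hn
      induction n with
      | zero => exact ⟨B, hB, hc, fun _ h => h, by simp⟩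
      | succ n ih =>
        obtain ⟨D, hD, hcD, hDB, hDU⟩ := ih
        refine ⟨D ∩ U n, hK.inter_mem _ hD _ (hUκ n),
          ZFSet.mem_inter.2 ⟨hcD, ((hYU c).1 (hfY hcx)).2 n⟩, fun y hy => hDB (ZFSet.mem_inter.1 hy).1,
          fun m hm y hy => ?_⟩
        obtain ⟨h1, h2⟩ := ZFSet.mem_inter.1 hy
        rcases (Nat.lt_succ_iff.1 hm).eq_or_lt with rfl | hm
        exacts [h2, hDU m hm h1]
    obtain ⟨D, hD, hcD, hDB, hDU⟩ := hD
    obtain ⟨P, hP, Q, hQ, hcP, hDQ, e⟩ := isRegular_of_isCompactIn hK hH hKc D hD c hcD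
    refine ⟨P, hP, hcP, Q, hQ, e, fun d hd hdQ => ?_⟩
    have hdD : d ∈ D := by
      by_contra hdD
      exact hdQ (hDQ (ZFSet.mem_sdiff.2 ⟨hd, hdD⟩))
    refine ⟨hDB hdD, fun m hm => ?_⟩
    obtain ⟨m, hmn, rfl⟩ := mem_natSet.1 hm
    rw [ap_seqGraph]
    exact hDU m hmn hdD
  · simp only [forall_om, ap_seqGraph] at hcV
    obtain ⟨w, hw, hu⟩ := hfun.2 c ((hYU c).2 ⟨hc, hcV⟩)
    rw [ap_eq hw hu]
    exact ⟨hfX hw, hw⟩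
  · obtain ⟨N, hN, e⟩ := (hσ _).1 (hcont O hO)
    refine ⟨N, hN, ?_, fun y hy => ?_⟩
    · have : c ∈ N ∩ Y := e ▸ ZFSet.mem_sep.2 ⟨hfY hcx, x, hx, hcx⟩
      exact (ZFSet.mem_inter.1 this).1
    · obtain ⟨_, d, hd, hdy⟩ := mem_im.1 hy
      have : d ∈ N ∩ Y := ZFSet.mem_inter.2 ⟨hd, hfY hdy⟩
      rw [← e] at this
      obtain ⟨_, z, hz, hdz⟩ := ZFSet.mem_sep.1 this
      rwa [(hfun.2 d (hfY hdy)).unique hdy hdz]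
  · obtain ⟨c, hc, h⟩ := honto x hx
    exact ⟨c, ((hYU c).1 hc).1, h⟩

/-- Being a witness is definable over `M`, so witnesses for all factors can be chosen simultaneously
inside `M`. The four components are coded as one nested pair. -/
theorem exists_seq_isWitness {X τ : ℕ → ZFSet.{u}} (hX : seqGraph X ∈ M) (hτ : seqGraph τ ∈ M)
    (h : ∀ i, IsInterpretableIn M (X i) (τ i)) :
    ∃ K κ f V : ℕ → ZFSet.{u}, seqGraph K ∈ M ∧ seqGraph κ ∈ M ∧ seqGraph f ∈ M ∧ seqGraph V ∈ M ∧
      ∀ i, IsWitness M (X i) (τ i) (K i) (κ i) (f i) (V i) := by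
  have := DT.const hX
  have := DT.const hτ
  have hd : Def M fun v => IsWitness M (ap (seqGraph X) (v 0).1) (ap (seqGraph τ) (v 0).1)
      (fst (v 1).1) (fst (snd (v 1).1)) (fst (snd (snd (v 1).1))) (snd (snd (snd (v 1).1))) := inferInstance
  obtain ⟨w, hw, h⟩ := exists_seq (M := M)
    (R := fun i w => IsWitness M (ap (seqGraph X) i) (ap (seqGraph τ) i)
      (fst w) (fst (snd w)) (fst (snd (snd w))) (snd (snd (snd w)))) fun i => by
    obtain ⟨K, hK, κ, hκ, f, hf, V, hV, h⟩ := (h i).exists_isWitness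
    have := DT.const hK
    have := DT.const hκ
    have := DT.const hf
    have := DT.const hV
    exact ⟨ZFSet.pair K (ZFSet.pair κ (ZFSet.pair f V)), DT.val₀ (M := M) inferInstance, by simpa⟩
  have := DT.const hw
  refine ⟨fun i => fst (w i), fun i => fst (snd (w i)), fun i => fst (snd (snd (w i))),
    fun i => snd (snd (snd (w i))), ?_, ?_, ?_, ?_, fun i => by simpa using h i⟩
  · simpa using seqGraph_mem (M := M) fun i => fst (ap (seqGraph w) i)
  · simpa using seqGraph_mem (M := M) fun i => fst (snd (ap (seqGraph w) i))
  · simpa using seqGraph_mem (M := M) fun i => fst (snd (snd (ap (seqGraph w) i)))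
  · simpa using seqGraph_mem (M := M) fun i => snd (snd (snd (ap (seqGraph w) i)))

end Interp

namespace Interp

variable {M : Set ZFSet.{u}} [hM : Fact (IsTransitiveModel M)]

/-! ### Points of the formal space of open sets -/

/-- `G` is a filter of open sets of `⟨X, τ⟩` that is completely prime with respect to the families of
open sets in `M`. -/
structure IsPoint (M : Set ZFSet.{u}) (X τ : ZFSet.{u}) (G : Set ZFSet.{u}) : Prop where
  subset : ∀ O ∈ G, O ∈ τ
  univ_mem : X ∈ G
  inter_mem : ∀ O ∈ G, ∀ P ∈ G, O ∩ P ∈ G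
  mono : ∀ O ∈ G, ∀ P ∈ τ, O ⊆ P → P ∈ G
  exists_mem : ∀ A ∈ M, A ⊆ τ → ZFSet.sUnion A ∈ G → ∃ P ∈ A, P ∈ G

theorem IsPoint.nonempty {X τ : ZFSet.{u}} {G : Set ZFSet.{u}} (hG : IsPoint M X τ G) {O : ZFSet.{u}}
    (hO : O ∈ G) : ∃ x, x ∈ O := by
  by_contra! h
  obtain rfl := (ZFSet.eq_empty O).2 h
  obtain ⟨P, hP, -⟩ := hG.exists_mem ∅ (DT.val₀ (M := M) inferInstance) (ZFSet.empty_subset _)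
    (by rwa [ZFSet.sUnion_empty])
  exact ZFSet.notMem_empty P hP

omit hM in
theorem IsShrinking.subset {K κ V n B C : ZFSet.{u}} (h : IsShrinking K κ V n B C) (hC : C ⊆ K) :
    C ⊆ B := fun c hc => by
  obtain ⟨Q, -, e, h⟩ := h
  exact (h c (hC hc) fun hQ => ZFSet.notMem_empty c (e ▸ ZFSet.mem_inter.2 ⟨hc, hQ⟩)).1

section

variable {X τ K κ f V : ZFSet.{u}} {G : Set ZFSet.{u}}

/-- Complete primeness for the family of images of those `B` with `P B`. This family is in `M` by
definability of `P`, and its union is the part of `O` inside `X`. -/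
theorem IsPoint.exists_im_mem (hG : IsPoint M X τ G) (hX : X ∈ M) (hf : f ∈ M) (hκ : κ ∈ M)
    (h : IsWitness M X τ K κ f V) (P : ZFSet.{u} → Prop) [hP : Def M fun v => P (v 0).1] {O : ZFSet.{u}}
    (hO : O ∈ G) (hPO : ∀ B ∈ κ, P B → im X f B ⊆ O)
    (hOP : ∀ x ∈ O, x ∈ X → ∃ B ∈ κ, P B ∧ x ∈ im X f B) : ∃ B ∈ κ, P B ∧ im X f B ∈ G := by
  have := DT.const hX
  have := DT.const hf
  have := DT.const hκ
  have hO' : O ∩ X ∈ G := hG.inter_mem _ hO _ hG.univ_mem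
  obtain ⟨Q, hQ, hQG⟩ := hG.exists_mem (img (ZFSet.sep P κ) (im X f)) (DT.val₀ (M := M) inferInstance)
    (fun Q hQ => by
      obtain ⟨B, hB, rfl⟩ := mem_img.1 hQ
      exact h.im_mem B (ZFSet.mem_sep.1 hB).1) (by
    convert hO'
    ext x
    rw [ZFSet.mem_sUnion, ZFSet.mem_inter]
    constructor
    · rintro ⟨Q, hQ, hx⟩
      obtain ⟨B, hB, rfl⟩ := mem_img.1 hQ
      obtain ⟨hB, hPB⟩ := ZFSet.mem_sep.1 hB
      exact ⟨hPO B hB hPB hx, (mem_im.1 hx).1⟩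
    · rintro ⟨hx, hxX⟩
      obtain ⟨B, hB, hPB, hxB⟩ := hOP x hx hxX
      exact ⟨_, mem_img.2 ⟨B, ZFSet.mem_sep.2 ⟨hB, hPB⟩, rfl⟩, hxB⟩)
  obtain ⟨B, hB, rfl⟩ := mem_img.1 hQ
  exact ⟨B, (ZFSet.mem_sep.1 hB).1, (ZFSet.mem_sep.1 hB).2, hQG⟩

theorem IsPoint.exists_shrinking (hG : IsPoint M X τ G) (hX : X ∈ M) (hf : f ∈ M) (hκ : κ ∈ M)
    (hK : K ∈ M) (hV : V ∈ M) (h : IsWitness M X τ K κ f V) {B : ZFSet.{u}} (hB : B ∈ κ)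
    (hBG : im X f B ∈ G) {n : ZFSet.{u}} (hn : n ∈ om) :
    ∃ C ∈ κ, IsShrinking K κ V n B C ∧ im X f C ∈ G := by
  have := DT.const hK
  have := DT.const hκ
  have := DT.const hV
  have := DT.const (mem_of_mem om_mem hn : n ∈ M)
  have := DT.const (mem_of_mem hκ hB)
  refine hG.exists_im_mem hX hf hκ h (fun C => IsShrinking K κ V n B C) hBG
    (fun C hC hs => im_mono (hs.subset (h.subset C hC))) fun x hx hxX => ?_
  obtain ⟨-, c, hc, hcx⟩ := mem_im.1 hx
  obtain ⟨C, hC, hcC, hs⟩ := h.exists_shrinking B hB n hn c hc x hxX hcx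
  exact ⟨C, hC, hs, mem_im.2 ⟨hxX, c, hcC, hcx⟩⟩

theorem IsPoint.exists_im_subset (hG : IsPoint M X τ G) (hX : X ∈ M) (hf : f ∈ M) (hκ : κ ∈ M)
    (h : IsWitness M X τ K κ f V) {O : ZFSet.{u}} (hOM : O ∈ M) (hO : O ∈ G) :
    ∃ B ∈ κ, im X f B ⊆ O ∧ im X f B ∈ G := by
  have := DT.const hX
  have := DT.const hf
  have := DT.const hOM
  refine hG.exists_im_mem hX hf hκ h (fun B => im X f B ⊆ O) hO (fun _ _ h => h) fun x hx hxX => ?_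
  obtain ⟨c, hc, hcx⟩ := h.onto x hxX
  obtain ⟨N, hN, hcN, hs⟩ := h.continuous O (hG.subset O hO) c hc x hx hcx
  exact ⟨N, hN, hs, mem_im.2 ⟨hxX, c, hcN, hcx⟩⟩

omit hM in
theorem IsPoint.univ_im_mem (hG : IsPoint M X τ G) (h : IsWitness M X τ K κ f V) : im X f K ∈ G := by
  refine hG.mono X hG.univ_mem _ (h.im_mem K h.univ_mem) fun x hx => ?_
  obtain ⟨c, hc, hcx⟩ := h.onto x hx
  exact mem_im.2 ⟨hx, c, hc, hcx⟩

end

/-- If a box of a product point is covered by finitely many boxes, then one of these is a box of the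
product point. -/
theorem exists_box_of_finite {X τ : ℕ → ZFSet.{u}} (hX : seqGraph X ∈ M)
    (hτ : ∀ i, IsSpaceIn M (X i) (τ i)) {G : ℕ → Set ZFSet.{u}}
    (hG : ∀ k, IsPoint M (X k) (τ k) (G k)) {b : ℕ → ZFSet.{u}} (hb : seqGraph b ∈ M)
    (hbG : ∀ k, b k ∈ G k) {E : ZFSet.{u}} (hE : (E : Set ZFSet.{u}).Finite) (hEb : E ⊆ boxes M X τ)
    (hcov : ∀ v, seqGraph v ∈ prodSet M X → (∀ k, v k ∈ b k) → ∃ e ∈ E, seqGraph v ∈ e) :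
    ∃ u n, IsSupport M X τ u n ∧ box M X (seqGraph u) ∈ E ∧ ∀ k, u k ∈ G k := by
  classical
  by_contra! hcon
  -- Each box of `E` is charged to one coordinate `k e` at which its side is missing from the
  -- filter.
  have h1 : ∀ e, ∃ u k, e ∈ E → (∀ k, u k ∈ τ k) ∧ e = box M X (seqGraph u) ∧ u k ∉ G k := by
    intro e
    by_cases he : e ∈ E
    · obtain ⟨u, n, hu, rfl⟩ := (mem_boxes hX).1 (hEb he)
      obtain ⟨k, hk⟩ := hcon u n hu he
      exact ⟨u, k, fun _ => ⟨hu.isOpen, rfl, hk⟩⟩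
    · exact ⟨X, 0, fun h => absurd h he⟩
  choose u k h1 using h1
  -- The sides charged to coordinate `i` cannot cover `b i`: their union would be in `G i`, and
  -- primeness would put one of them in `G i`.
  have hD (i : ℕ) : ∃ x ∈ b i, ∀ e ∈ E, k e = i → x ∉ u e i := by
    by_contra! hx
    let D := ZFSet.sep (fun O => ∃ e ∈ E, k e = i ∧ O = u e i) (τ i)
    have hDM : D ∈ M := by
      refine mem_of_finite ((hE.image fun e => u e i).subset ?_) fun O hO =>
        mem_of_mem (hτ i).opens_mem (ZFSet.mem_sep.1 hO).1
      intro O hO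
      obtain ⟨-, e, he, -, rfl⟩ := ZFSet.mem_sep.1 hO
      exact ⟨e, he, rfl⟩
    have hDτ : D ⊆ τ i := ZFSet.sep_subset
    obtain ⟨P, hP, hPG⟩ := (hG i).exists_mem D hDM hDτ
      ((hG i).mono _ (hbG i) _ ((hτ i).sUnion_mem D hDM hDτ) fun x hxb => by
        obtain ⟨e, he, hk, hxe⟩ := hx x hxb
        exact ZFSet.mem_sUnion_of_mem hxe (ZFSet.mem_sep.2 ⟨(h1 e he).1 i, e, he, hk, rfl⟩))
    obtain ⟨-, e, he, rfl, rfl⟩ := ZFSet.mem_sep.1 hP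
    exact (h1 e he).2.2 hPG
  choose x hxb hx using hD
  obtain ⟨y, hy, hyb⟩ := exists_seq_mem hb fun n => (hG n).nonempty (hbG n)
  obtain ⟨N, hN⟩ := (hE.image k).bddAbove
  -- The points `x i` are chosen outside `M`, but only the coordinates up to `N` are charged. Beyond
  -- `N` a sequence from `M` is used, so `w` is in `M`.
  let w (i : ℕ) : ZFSet.{u} := if i ≤ N then x i else y i
  have hwb (i : ℕ) : w i ∈ b i := by
    simp only [w]
    split
    exacts [hxb i, hyb i]
  have hw : seqGraph w ∈ M := by
    refine seqGraph_mem_of_eq hy (N + 1) (fun i _ => mem_of_mem (apply_mem hb i) (hwb i)) fun i hi => ?_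
    simp only [w]
    rw [if_neg (by omega)]
  obtain ⟨e, he, hwe⟩ := hcov w (seqGraph_mem_prodSet.2 ⟨hw, fun i =>
    (hτ i).subset _ ((hG i).subset _ (hbG i)) (hwb i)⟩) hwb
  obtain ⟨-, h2, -⟩ := h1 e he
  rw [h2, seqGraph_mem_box] at hwe
  have h3 := hwe.2 (k e)
  simp only [w] at h3
  rw [if_pos (hN ⟨e, he, rfl⟩)] at h3
  exact hx _ e he rfl h3

/-! ### Finite coverings of boxes -/

/-- The box with sides the images of `s i ∩ N i` is covered by a finite subset of `A`. -/
def IsCovered (M : Set ZFSet.{u}) (X f : ℕ → ZFSet.{u}) (A s N : ZFSet.{u}) : Prop :=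
  ∃ E ∈ M, E ⊆ A ∧ (E : Set ZFSet.{u}).Finite ∧ ∀ x ∈ prodSet M X,
    (∀ i ∈ om, ap x i ∈ im (ap (seqGraph X) i) (ap (seqGraph f) i) (ap s i ∩ ap N i)) → ∃ e ∈ E, x ∈ e

omit hM in
theorem isCovered_iff {X f s N : ℕ → ZFSet.{u}} {A : ZFSet.{u}} :
    IsCovered M X f A (seqGraph s) (seqGraph N) ↔ ∃ E ∈ M, E ⊆ A ∧ (E : Set ZFSet.{u}).Finite ∧
      ∀ v, seqGraph v ∈ prodSet M X → (∀ i, v i ∈ im (X i) (f i) (s i ∩ N i)) → ∃ e ∈ E, seqGraph v ∈ e := by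
  refine exists_congr fun E => and_congr_right fun _ => and_congr_right fun _ => and_congr_right fun _ => ?_
  simp only [forall_om, ap_seqGraph]
  constructor
  · intro h v hv hi
    exact h _ hv (by simpa)
  · intro h x hx hi
    obtain ⟨v, hv, hvX, rfl⟩ := mem_prodSet.1 hx
    exact h v hx (by simpa using hi)

theorem Def.isCovered {X f : ℕ → ZFSet.{u}} (hX : seqGraph X ∈ M) (hf : seqGraph f ∈ M)
    {A : ZFSet.{u}} (hA : A ∈ M) {s N : (ℕ → M) → ZFSet.{u}} [hs : DT M s] [hN : DT M N] :
    Def M fun v => IsCovered M X f A (s v) (N v) := by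
  have := DT.const hX
  have := DT.const hf
  have := DT.const hA
  have := DT.const (prodSet_mem hX)
  have := hs.subst (· + 3)
  have := hN.subst (· + 3)
  unfold IsCovered
  infer_instance

/-- A sequence in `M` of interpretable spaces together with witnesses. -/
structure IsWitnessSeq (M : Set ZFSet.{u}) (X τ K κ f V : ℕ → ZFSet.{u}) : Prop where
  X_mem : seqGraph X ∈ M
  τ_mem : seqGraph τ ∈ M
  K_mem : seqGraph K ∈ M
  κ_mem : seqGraph κ ∈ M
  f_mem : seqGraph f ∈ M
  V_mem : seqGraph V ∈ M
  space : ∀ i, IsSpaceIn M (X i) (τ i)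
  witness : ∀ i, IsWitness M (X i) (τ i) (K i) (κ i) (f i) (V i)

/-- A shrinking sequence, in `M`, of boxes that are not covered by finite subsets of `A`. -/
structure IsUncoveredSeq (M : Set ZFSet.{u}) (X K κ f V : ℕ → ZFSet.{u}) (A : ZFSet.{u})
    (s : ℕ → ℕ → ZFSet.{u}) (n₀ : ℕ) : Prop where
  mem : seqGraph (fun j => seqGraph (s j)) ∈ M
  isOpen : ∀ j k, s j k ∈ κ k
  anti : ∀ j k, s (j + 1) k ⊆ s j k
  not_isCovered : ∀ j, ¬ IsCovered M X f A (seqGraph (s j)) (seqGraph K)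
  shrinking : ∀ j k, k ≤ n₀ + j → IsShrinking (K k) (κ k) (V k) (natSet (n₀ + j)) (s j k) (s (j + 1) k)

theorem seqGraph_inter_mem {u v : ℕ → ZFSet.{u}} (hu : seqGraph u ∈ M) (hv : seqGraph v ∈ M) :
    seqGraph (fun k => u k ∩ v k) ∈ M := by
  have := DT.const hu
  have := DT.const hv
  simpa using seqGraph_mem (M := M) fun k => ap (seqGraph u) k ∩ ap (seqGraph v) k

/-- The first `k` terms of `c` have no neighborhoods for which the corresponding subboxes
of the boxes `s j` are covered by finite subsets of `A`. -/
def IsGood (M : Set ZFSet.{u}) (X K κ f : ℕ → ZFSet.{u}) (A σ k c : ZFSet.{u}) : Prop :=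
  ∀ N ∈ prodSet M κ, (∀ i ∈ k, ap c i ∈ ap N i) → (∀ i ∈ om, i ∉ k → ap N i = ap (seqGraph K) i) →
    ∀ j ∈ om, ¬ IsCovered M X f A (ap σ j) N

omit hM in
theorem isGood_iff {X K κ f : ℕ → ZFSet.{u}} {A : ZFSet.{u}} {s : ℕ → ℕ → ZFSet.{u}} {k : ℕ}
    {c : ℕ → ZFSet.{u}} :
    IsGood M X K κ f A (seqGraph fun j => seqGraph (s j)) (natSet k) (seqGraph c) ↔
      ∀ N : ℕ → ZFSet.{u}, seqGraph N ∈ M → (∀ i, N i ∈ κ i) → (∀ i < k, c i ∈ N i) →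
        (∀ i, k ≤ i → N i = K i) → ∀ j, ¬ IsCovered M X f A (seqGraph (s j)) (seqGraph N) := by
  simp only [IsGood, forall_om, ap_seqGraph, forall_mem_natSet, natSet_mem_natSet, not_lt]
  constructor
  · intro h N hN hNκ h1 h2
    exact h _ (seqGraph_mem_prodSet.2 ⟨hN, hNκ⟩) (by simpa) (by simpa)
  · intro h N hN h1 h2
    obtain ⟨N, hNM, hNκ, rfl⟩ := mem_prodSet.1 hN
    exact h N hNM hNκ (by simpa using h1) (by simpa using h2)

theorem Def.isGood {X K κ f : ℕ → ZFSet.{u}} (hX : seqGraph X ∈ M) (hK : seqGraph K ∈ M)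
    (hκ : seqGraph κ ∈ M) (hf : seqGraph f ∈ M) {A : ZFSet.{u}} (hA : A ∈ M)
    {σ k c : (ℕ → M) → ZFSet.{u}} [hσ : DT M σ] [hk : DT M k] [hc : DT M c] :
    Def M fun v => IsGood M X K κ f A (σ v) (k v) (c v) := by
  have := DT.const hK
  have := DT.const (prodSet_mem hκ)
  have := hσ.subst (· + 2)
  have := hk.subst (· + 1)
  have := hk.subst (· + 2)
  have := hc.subst (· + 2)
  have : Def M fun v => IsCovered M X f A (ap (σ fun n => v (n + 2)) (v 0).1) (v 1).1 :=
    Def.isCovered hX hf hA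
  unfold IsGood
  infer_instance

end Interp

namespace Interp

/-! ### The Tychonoff argument inside `M`. -/

variable {M : Set ZFSet.{u}} [hM : Fact (IsTransitiveModel M)]

section

variable {X τ K κ f V : ℕ → ZFSet.{u}} {A : ZFSet.{u}} {s : ℕ → ℕ → ZFSet.{u}} {n₀ : ℕ}

omit hM in
theorem IsUncoveredSeq.antitone (hs : IsUncoveredSeq M X K κ f V A s n₀) {j j' : ℕ} (h : j ≤ j')
    (k : ℕ) : s j' k ⊆ s j k := by
  induction h with
  | refl => exact fun _ h => h
  | step _ ih => exact fun x hx => ih (hs.anti _ k hx)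

/-- Finitely many covered subboxes, differing in the coordinate `k` only, can be merged. -/
theorem IsUncoveredSeq.exists_merge (hw : IsWitnessSeq M X τ K κ f V)
    (hs : IsUncoveredSeq M X K κ f V A s n₀) {c : ℕ → ZFSet.{u}} {k : ℕ} (hck : ∀ i < k, c i ∈ K i)
    {F : Set ZFSet.{u}}
    (hF : F.Finite) (h : ∀ B ∈ F, ∃ N : ℕ → ZFSet.{u}, seqGraph N ∈ M ∧ (∀ i, N i ∈ κ i) ∧
      (∀ i < k, c i ∈ N i) ∧ (∀ i, k + 1 ≤ i → N i = K i) ∧ N k = B ∧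
      ∃ j, IsCovered M X f A (seqGraph (s j)) (seqGraph N)) :
    ∃ N : ℕ → ZFSet.{u}, seqGraph N ∈ M ∧ (∀ i, N i ∈ κ i) ∧ (∀ i < k, c i ∈ N i) ∧
      (∀ i, k ≤ i → N i = K i) ∧ ∃ j, ∃ E ∈ M, E ⊆ A ∧ (E : Set ZFSet.{u}).Finite ∧
        ∀ v, seqGraph v ∈ prodSet M X → (∀ i, v i ∈ im (X i) (f i) (s j i ∩ N i)) →
          (∃ B ∈ F, v k ∈ im (X k) (f k) (s j k ∩ B)) → ∃ e ∈ E, seqGraph v ∈ e := by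
  induction F, hF using Set.Finite.induction_on with
  | empty =>
    exact ⟨K, hw.K_mem, fun i => (hw.witness i).univ_mem, hck, fun _ _ => rfl, 0, ∅,
      DT.val₀ (M := M) inferInstance, ZFSet.empty_subset _, by simp, by simp⟩
  | @insert B F _ _ ih =>
    obtain ⟨N, hN, hNκ, h1, h2, j, E, hE, hEA, hEf, hcov⟩ := ih fun B hB => h B (.inr hB)
    obtain ⟨N', hN', hNκ', h1', h2', rfl, j', hcov'⟩ := h B (.inl rfl)
    obtain ⟨E', hE', hEA', hEf', hcov'⟩ := isCovered_iff.1 hcov'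
    have := DT.const hE
    have := DT.const hE'
    have hinter {B B' C C' : ZFSet.{u}} (h : B ⊆ B') (h' : C ⊆ C') : B ∩ C ⊆ B' ∩ C' := fun y hy =>
      ZFSet.mem_inter.2 ⟨h (ZFSet.mem_inter.1 hy).1, h' (ZFSet.mem_inter.1 hy).2⟩
    have hleft (B C : ZFSet.{u}) : B ∩ C ⊆ B := fun y hy => (ZFSet.mem_inter.1 hy).1
    have hright (B C : ZFSet.{u}) : B ∩ C ⊆ C := fun y hy => (ZFSet.mem_inter.1 hy).2
    have hj := hs.antitone (le_max_left j j')
    have hj' := hs.antitone (le_max_right j j')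
    have hKκ := (hw.witness k).univ_mem
    -- The neighborhoods are intersected at the coordinates other than `k`, while coordinate `k` is
    -- released to the whole space `K k`. The later of the two stages works for both covers, since
    -- the boxes `s j` decrease.
    refine ⟨fun i => N i ∩ Function.update N' k (K k) i, seqGraph_inter_mem hN
      (seqGraph_update_mem hN' k (apply_mem hw.K_mem k)), fun i => ?_, fun i hi => ?_, fun i hi => ?_,
      max j j', E ∪ E', DT.val₀ (M := M) inferInstance, fun e he => ?_, ?_, fun v hv hvi hvB => ?_⟩
    · refine (hw.witness i).inter_mem _ (hNκ i) _ ?_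
      by_cases hik : i = k
      · subst hik
        simpa
      · simpa [hik] using hNκ' i
    · refine ZFSet.mem_inter.2 ⟨h1 i hi, ?_⟩
      rw [Function.update_of_ne hi.ne]
      exact h1' i hi
    · have : Function.update N' k (K k) i = K i := by
        rcases hi.eq_or_lt with rfl | hi
        · simp
        · rw [Function.update_of_ne hi.ne', h2' i hi]
      dsimp only
      rw [h2 i hi, this]
      ext
      simp
    · exact (ZFSet.mem_union.1 he).elim (fun h => hEA h) fun h => hEA' h
    · rw [ZFSet.coe_union]
      exact hEf.union hEf'
    · obtain ⟨B, rfl | hB, hvB⟩ := hvB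
      · obtain ⟨e, he, hve⟩ := hcov' v hv fun i => by
          by_cases hik : i = k
          · subst hik
            exact im_mono (hinter (hj' _) fun _ h => h) hvB
          · refine im_mono (hinter (hj' _) ?_) (hvi i)
            dsimp only
            rw [Function.update_of_ne hik]
            exact hright _ _
        exact ⟨e, ZFSet.mem_union.2 (.inr he), hve⟩
      · obtain ⟨e, he, hve⟩ := hcov v hv (fun i => im_mono (hinter (hj i) (hleft _ _)) (hvi i))
          ⟨B, hB, im_mono (hinter (hj k) fun _ h => h) hvB⟩
        exact ⟨e, ZFSet.mem_union.2 (.inl he), hve⟩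

/-- If every `d` in `K k` failed, each would have a neighborhood that occurs as the side at `k` of a
finitely covered subbox. The set `C` of these neighborhoods is a cover of `K k` in `M`; merging the
covers for a finite subcover contradicts goodness of the first `k` terms. -/
theorem IsUncoveredSeq.exists_isGood_update (hw : IsWitnessSeq M X τ K κ f V) (hA : A ∈ M)
    (hs : IsUncoveredSeq M X K κ f V A s n₀) {c : ℕ → ZFSet.{u}} (hc : seqGraph c ∈ M) {k : ℕ}
    (hck : ∀ i < k, c i ∈ K i)
    (h : IsGood M X K κ f A (seqGraph fun j => seqGraph (s j)) (natSet k) (seqGraph c)) :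
    ∃ d ∈ K k, IsGood M X K κ f A (seqGraph fun j => seqGraph (s j)) (natSet (k + 1))
      (seqGraph (Function.update c k d)) := by
  by_contra! hcon
  have := DT.const hs.mem
  have := DT.const hc
  have := DT.const hw.K_mem
  have := DT.const (prodSet_mem hw.κ_mem)
  have := DT.const (natSet_mem (M := M) k)
  have := DT.const (natSet_mem (M := M) (k + 1))
  have hκk := apply_mem hw.κ_mem k
  have := DT.const hκk
  have : Def M fun v => IsCovered M X f A (ap (seqGraph fun j => seqGraph (s j)) (v 0).1) (v 1).1 :=
    Def.isCovered hw.X_mem hw.f_mem hA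
  let C : ZFSet.{u} := ZFSet.sep (fun B => ∃ N ∈ prodSet M κ, (∀ i ∈ natSet k, ap (seqGraph c) i ∈ ap N i) ∧
    (∀ i ∈ om, i ∉ natSet (k + 1) → ap N i = ap (seqGraph K) i) ∧ ap N (natSet k) = B ∧
    ∃ j ∈ om, IsCovered M X f A (ap (seqGraph fun j => seqGraph (s j)) j) N) (κ k)
  have hCM : C ∈ M := DT.val₀ (M := M) inferInstance
  have hC {B : ZFSet.{u}} : B ∈ C ↔ ∃ N : ℕ → ZFSet.{u}, seqGraph N ∈ M ∧ (∀ i, N i ∈ κ i) ∧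
      (∀ i < k, c i ∈ N i) ∧ (∀ i, k + 1 ≤ i → N i = K i) ∧ N k = B ∧
      ∃ j, IsCovered M X f A (seqGraph (s j)) (seqGraph N) := by
    simp only [C, ZFSet.mem_sep, forall_mem_natSet, forall_om, exists_om, ap_seqGraph,
      natSet_mem_natSet, not_lt]
    constructor
    · rintro ⟨-, N, hN, h⟩
      obtain ⟨N, hNM, hNκ, rfl⟩ := mem_prodSet.1 hN
      exact ⟨N, hNM, hNκ, by simpa using h⟩
    · rintro ⟨N, hNM, hNκ, h⟩
      exact ⟨h.2.2.1 ▸ hNκ k, seqGraph N, seqGraph_mem_prodSet.2 ⟨hNM, hNκ⟩, by simpa using h⟩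
  obtain ⟨F, -, hFC, hF, hFK⟩ := (hw.witness k).compact C hCM ZFSet.sep_subset (by
    ext d
    rw [ZFSet.mem_sUnion]
    refine ⟨fun ⟨B, hB, hd⟩ => (hw.witness k).subset B (ZFSet.mem_sep.1 hB).1 hd, fun hd => ?_⟩
    have := hcon d hd
    rw [isGood_iff] at this
    push Not at this
    obtain ⟨N, hN, hNκ, h1, h2, j, hj⟩ := this
    refine ⟨N k, hC.2 ⟨N, hN, hNκ, fun i hi => ?_, h2, rfl, j, hj⟩, by simpa using h1 k (by omega)⟩
    simpa [hi.ne] using h1 i (by omega))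
  obtain ⟨N, hN, hNκ, h1, h2, j, E, hE, hEA, hEf, hcov⟩ := hs.exists_merge hw hck hF fun B hB => hC.1 (hFC hB)
  refine isGood_iff.1 h N hN hNκ h1 h2 j (isCovered_iff.2 ⟨E, hE, hEA, hEf, fun v hv hi =>
    hcov v hv hi ?_⟩)
  obtain ⟨hvX, d, hd, hdv⟩ := mem_im.1 (hi k)
  obtain ⟨hd1, hd2⟩ := ZFSet.mem_inter.1 hd
  rw [h2 k le_rfl, ← hFK, ZFSet.mem_sUnion] at hd2
  obtain ⟨B, hB, hdB⟩ := hd2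
  exact ⟨B, hB, mem_im.2 ⟨hvX, d, ZFSet.mem_inter.2 ⟨hd1, hdB⟩, hdv⟩⟩

/-- The points of the compactifications, chosen so that no finite number of them has neighborhoods
covered by finite subsets of `A`. -/
theorem IsUncoveredSeq.exists_isGood (hw : IsWitnessSeq M X τ K κ f V) (hA : A ∈ M)
    (hs : IsUncoveredSeq M X K κ f V A s n₀) : ∃ c : ℕ → ZFSet.{u}, seqGraph c ∈ M ∧ (∀ k, c k ∈ K k) ∧
      ∀ k, IsGood M X K κ f A (seqGraph fun j => seqGraph (s j)) (natSet k) (seqGraph c) := by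
  have := DT.const hs.mem
  have := DT.const hw.K_mem
  have hPK := prodSet_mem hw.K_mem
  have := DT.const hPK
  -- Dependent choice runs over pairs of a length `k` and a full sequence, of which only the first
  -- `k` terms count and stay fixed at later steps.
  let S : ZFSet.{u} := ZFSet.sep (fun q => IsGood M X K κ f A (seqGraph fun j => seqGraph (s j))
    (fst q) (snd q)) (ZFSet.prod om (prodSet M K))
  have hS : S ∈ M := by
    have : Def M fun v => IsGood M X K κ f A (seqGraph fun j => seqGraph (s j))
      (fst (v 0).1) (snd (v 0).1) := Def.isGood hw.X_mem hw.K_mem hw.κ_mem hw.f_mem hA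
    exact DT.val₀ (M := M) inferInstance
  have hmem {q : ZFSet.{u}} : q ∈ S ↔ ∃ (k : ℕ) (c : ℕ → ZFSet.{u}), seqGraph c ∈ prodSet M K ∧
      q = ZFSet.pair (natSet k) (seqGraph c) ∧
      IsGood M X K κ f A (seqGraph fun j => seqGraph (s j)) (natSet k) (seqGraph c) := by
    rw [ZFSet.mem_sep, ZFSet.mem_prod]
    constructor
    · rintro ⟨⟨k, hk, c, hc, rfl⟩, h⟩
      obtain ⟨k, rfl⟩ := mem_om.1 hk
      obtain ⟨c, -, -, rfl⟩ := mem_prodSet.1 hc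
      exact ⟨k, c, hc, rfl, by simpa using h⟩
    · rintro ⟨k, c, hc, rfl, h⟩
      exact ⟨⟨_, natSet_mem_om k, _, hc, rfl⟩, by simpa using h⟩
  have hKn (k : ℕ) : ∃ y, y ∈ K k := by
    by_contra! hy
    refine hs.not_isCovered 0 (isCovered_iff.2 ⟨∅, DT.val₀ (M := M) inferInstance, ZFSet.empty_subset _,
      by simp, fun v _ hv => ?_⟩)
    obtain ⟨-, d, hd, -⟩ := mem_im.1 (hv k)
    exact absurd (ZFSet.mem_inter.1 hd).2 (hy d)
  obtain ⟨c₀, hc₀, hc₀K⟩ := exists_seq_mem hw.K_mem hKn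
  obtain ⟨q, hq, hq0, hqS, hqR⟩ := exists_dependent_choice hS (a := ZFSet.pair (natSet 0) (seqGraph c₀))
    (R := fun q q' => fst q' = insert (fst q) (fst q) ∧ ∀ i ∈ fst q, ap (snd q') i = ap (snd q) i)
    (fun q hq => by
      obtain ⟨k, c, hc, rfl, h⟩ := hmem.1 hq
      obtain ⟨hcM, hcK⟩ := seqGraph_mem_prodSet.1 hc
      obtain ⟨d, hd, h'⟩ := hs.exists_isGood_update hw hA hcM (fun i _ => hcK i) h
      refine ⟨_, hmem.2 ⟨k + 1, Function.update c k d, seqGraph_mem_prodSet.2 ⟨?_, fun i => ?_⟩, rfl, h'⟩, ?_⟩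
      · exact seqGraph_update_mem hcM k (mem_of_mem (apply_mem hw.K_mem k) hd)
      · by_cases hi : i = k
        · subst hi
          simpa
        · simpa [hi] using hcK i
      · simp only [fst_pair, snd_pair, forall_mem_natSet, ap_seqGraph]
        exact ⟨natSet_succ k, fun i hi => by simp [hi.ne]⟩)
    (hmem.2 ⟨0, c₀, seqGraph_mem_prodSet.2 ⟨hc₀, hc₀K⟩, rfl, isGood_iff.2 fun N _ _ _ h j => by
      rw [funext fun i => h i (Nat.zero_le i)]
      exact hs.not_isCovered j⟩)
  choose n c hc hqe hgood using fun j => hmem.1 (hqS j)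
  have hn (j : ℕ) : n j = j := by
    induction j with
    | zero =>
      rw [hqe 0, ZFSet.pair_inj] at hq0
      exact natSet_injective hq0.1
    | succ j ih =>
      have := (hqR j).1
      rw [hqe j, hqe (j + 1), fst_pair, fst_pair, ← natSet_succ, natSet_inj, ih] at this
      exact this
  have hcs {i j : ℕ} (hij : i < j) : c j i = c (i + 1) i := by
    induction j, hij using Nat.le_induction with
    | base => rfl
    | succ j hj ih =>
      have := (hqR j).2
      simp only [hqe, fst_pair, snd_pair, forall_mem_natSet, ap_seqGraph, hn] at this
      rw [this i hj, ih]
  have := DT.const hq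
  -- The term of index `i` is settled at stage `i + 1` and never changes afterwards, so the diagonal
  -- agrees with stage `k` below `k`.
  refine ⟨fun i => c (i + 1) i, ?_, fun k => (seqGraph_mem_prodSet.1 (hc _)).2 k, fun k => ?_⟩
  · convert seqGraph_mem (M := M) fun i => ap (snd (ap (seqGraph q) (insert i i))) i using 2
    ext1 i
    rw [← natSet_succ, ap_seqGraph, hqe, snd_pair, ap_seqGraph]
  · have := hgood k
    rw [hn, isGood_iff] at this
    rw [isGood_iff]
    intro N hN hNκ h1 h2
    exact this N hN hNκ (fun i hi => hcs hi ▸ h1 i hi) h2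

/-- The required point is the image under the maps `f i` of the good sequence `c`. Shrinking places
each `c i` in the `G_δ`, where `f i` is defined. -/
theorem IsUncoveredSeq.exists_notMem (hw : IsWitnessSeq M X τ K κ f V) (hA : A ∈ M)
    (hAb : A ⊆ boxes M X τ) (hs : IsUncoveredSeq M X K κ f V A s n₀) :
    ∃ x, seqGraph x ∈ prodSet M X ∧ (∀ i, x i ∈ im (X i) (f i) (s 0 i)) ∧ ∀ P ∈ A, seqGraph x ∉ P := by
  obtain ⟨c, hc, hcK, hgood⟩ := hs.exists_isGood hw hA
  have hshrink (i j : ℕ) (hij : i ≤ n₀ + j) : c i ∈ s j i ∧ ∀ m < n₀ + j, c i ∈ ap (V i) (natSet m) := by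
    obtain ⟨Q, hQ, e, h⟩ := hs.shrinking j i hij
    by_cases hcQ : c i ∈ Q
    · exfalso
      -- Otherwise `Q` is a neighborhood of `c i` disjoint from side `i` of the box at stage `j +
      -- 1`; the resulting subbox has empty image and is covered by the empty family.
      refine isGood_iff.1 (hgood (i + 1)) (Function.update K i Q) ?_ (fun l => ?_) (fun l hl => ?_)
        (fun l hl => ?_) (j + 1) (isCovered_iff.2 ⟨∅, DT.val₀ (M := M) inferInstance, ZFSet.empty_subset _,
          by simp, fun v _ hv => ?_⟩)
      · exact seqGraph_update_mem hw.K_mem i (mem_of_mem (apply_mem hw.κ_mem i) hQ)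
      · by_cases hl : l = i
        · subst hl
          simpa
        · simpa [hl] using (hw.witness l).univ_mem
      · by_cases hl : l = i
        · subst hl
          simpa
        · simpa [hl] using hcK l
      · rw [Function.update_of_ne (by omega)]
      · obtain ⟨-, d, hd, -⟩ := mem_im.1 (hv i)
        rw [Function.update_self, e] at hd
        exact absurd hd (ZFSet.notMem_empty d)
    · have := h _ (hcK i) hcQ
      rwa [forall_mem_natSet] at this
  have hcs (i : ℕ) : c i ∈ s 0 i := hs.antitone (Nat.zero_le i) i (hshrink i i (by omega)).1
  have hcf (i : ℕ) : ap (f i) (c i) ∈ X i ∧ ZFSet.pair (c i) (ap (f i) (c i)) ∈ f i :=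
    (hw.witness i).complete _ (hcK i) (forall_om.2 fun m =>
      (hshrink i (i + m + 1) (by omega)).2 m (by omega))
  have hx : seqGraph (fun i => ap (f i) (c i)) ∈ prodSet M X := by
    refine seqGraph_mem_prodSet.2 ⟨?_, fun i => (hcf i).1⟩
    have := DT.const hw.f_mem
    have := DT.const hc
    simpa using seqGraph_mem (M := M) fun i => ap (ap (seqGraph f) i) (ap (seqGraph c) i)
  refine ⟨fun i => ap (f i) (c i), hx, fun i => mem_im.2 ⟨(hcf i).1, c i, hcs i, (hcf i).2⟩,
    fun P hP hxP => ?_⟩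
  obtain ⟨u, n, hu, rfl⟩ := (mem_boxes hw.X_mem).1 (hAb hP)
  have hxu := (seqGraph_mem_box.1 hxP).2
  -- If the image lay in a box of `A`, continuity at its finitely many restricted coordinates would
  -- give neighborhoods of `c` mapped into that box, so this single box would be a finite cover.
  choose N hN hcN hNu using fun i =>
    (hw.witness i).continuous _ (hu.isOpen i) (c i) (hcK i) _ (hxu i) (hcf i).2
  refine isGood_iff.1 (hgood n) (fun i => if i < n then N i else K i) ?_ (fun i => ?_) (fun i hi => ?_)
    (fun i hi => ?_) 0 (isCovered_iff.2 ⟨{box M X (seqGraph u)}, ?_, ?_, by simp, fun v hv hvi =>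
      ⟨_, ZFSet.mem_singleton.2 rfl, seqGraph_mem_box.2 ⟨hv, fun i => ?_⟩⟩⟩)
  · refine seqGraph_mem_of_eq hw.K_mem n (fun i hi => ?_) fun i hi => if_neg (not_lt.2 hi)
    rw [if_pos hi]
    exact mem_of_mem (apply_mem hw.κ_mem i) (hN i)
  · split
    exacts [hN i, (hw.witness i).univ_mem]
  · rw [if_pos hi]
    exact hcN i
  · exact if_neg (not_lt.2 hi)
  · have := DT.const (mem_of_mem hA hP)
    exact DT.val₀ (M := M) inferInstance
  · intro x hx
    rwa [ZFSet.mem_singleton.1 hx]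
  · by_cases hi : i < n
    · refine hNu i (im_mono ?_ (hvi i))
      rw [if_pos hi]
      exact fun y hy => (ZFSet.mem_inter.1 hy).2
    · rw [hu.eq i (not_lt.1 hi)]
      exact (seqGraph_mem_prodSet.1 hv).2 i

end

end Interp

namespace Interp

/-! ### Transferring covers to points outside `M`. -/

variable {M : Set ZFSet.{u}} [hM : Fact (IsTransitiveModel M)]

/-- The points of the formal product of interpretable spaces do not see more coverings than the
points in `M`: a box around a product point that is covered by a set of boxes
contains the product point in one of these boxes. -/
theorem exists_box_of_cover {X τ K κ f V : ℕ → ZFSet.{u}} {A : ZFSet.{u}}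
    (hw : IsWitnessSeq M X τ K κ f V) (hA : A ∈ M) (hAb : A ⊆ boxes M X τ) {G : ℕ → Set ZFSet.{u}}
    (hG : ∀ k, IsPoint M (X k) (τ k) (G k)) {u₀ : ℕ → ZFSet.{u}} {n₀ : ℕ} (hu : IsSupport M X τ u₀ n₀)
    (huG : ∀ k, u₀ k ∈ G k) (hcov : ∀ x, seqGraph x ∈ box M X (seqGraph u₀) → ∃ P ∈ A, seqGraph x ∈ P) :
    ∃ u n, IsSupport M X τ u n ∧ box M X (seqGraph u) ∈ A ∧ ∀ k, u k ∈ G k := by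
  classical
  by_contra hcon
  have hX (k : ℕ) := apply_mem hw.X_mem k
  have hK (k : ℕ) := apply_mem hw.K_mem k
  have hκ (k : ℕ) := apply_mem hw.κ_mem k
  have hf (k : ℕ) := apply_mem hw.f_mem k
  have hV (k : ℕ) := apply_mem hw.V_mem k
  -- A box whose sides have images in the filters is not finitely covered: otherwise the finite case
  -- would give a box of `A` containing the product point.
  have hun (s : ℕ → ZFSet.{u}) (hs : seqGraph s ∈ M) (hsκ : ∀ k, s k ∈ κ k)
      (hsG : ∀ k, im (X k) (f k) (s k) ∈ G k) :
      ¬ IsCovered M X f A (seqGraph s) (seqGraph K) := by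
    intro hc
    obtain ⟨E, -, hEA, hEf, hE⟩ := isCovered_iff.1 hc
    have := DT.const hs
    have := DT.const hw.X_mem
    have := DT.const hw.f_mem
    obtain ⟨u, n, hun, huE, huG⟩ := exists_box_of_finite (E := E) hw.X_mem hw.space hG
      (b := fun k => im (X k) (f k) (s k)) (by
        simpa using seqGraph_mem (M := M) fun k =>
          im (ap (seqGraph X) k) (ap (seqGraph f) k) (ap (seqGraph s) k)) hsG hEf
      (fun e he => hAb (hEA he)) fun v hv hvb => hE v hv fun i => by
        rw [ZFSet.inter_eq_left_of_subset ((hw.witness i).subset _ (hsκ i))]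
        exact hvb i
    exact hcon ⟨u, n, hun, hEA huE, huG⟩
  have := DT.const hw.K_mem
  have := DT.const hw.κ_mem
  have := DT.const hw.V_mem
  have := DT.const (prodSet_mem hw.κ_mem)
  let T : ZFSet.{u} := ZFSet.sep (fun p => ¬ IsCovered M X f A (snd p) (seqGraph K))
    (ZFSet.prod om (prodSet M κ))
  have hT : T ∈ M := by
    have : Def M fun v => IsCovered M X f A (snd (v 0).1) (seqGraph K) :=
      Def.isCovered hw.X_mem hw.f_mem hA
    exact DT.val₀ (M := M) inferInstance
  -- From length `n` to length `n + 1`, only the coordinates `k ≤ n` are shrunk, into the first `n`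
  -- sets of their `G_δ` sequences. Each step alters finitely many sides, and every coordinate is
  -- shrunk from some step on.
  let R (p q : ZFSet.{u}) : Prop := fst q = insert (fst p) (fst p) ∧
    (∀ k ∈ fst q, IsShrinking (ap (seqGraph K) k) (ap (seqGraph κ) k) (ap (seqGraph V) k) (fst p)
      (ap (snd p) k) (ap (snd q) k)) ∧ ∀ k ∈ om, k ∉ fst q → ap (snd q) k = ap (snd p) k
  have hR : Def M fun v => R (v 0).1 (v 1).1 := inferInstance
  have hRiff {m n : ℕ} {s t : ℕ → ZFSet.{u}} :
      R (ZFSet.pair (natSet m) (seqGraph s)) (ZFSet.pair (natSet n) (seqGraph t)) ↔ n = m + 1 ∧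
        (∀ k < n, IsShrinking (K k) (κ k) (V k) (natSet m) (s k) (t k)) ∧ ∀ k, n ≤ k → t k = s k := by
    simp only [R, fst_pair, snd_pair, forall_mem_natSet, forall_om, ap_seqGraph, natSet_mem_natSet,
      not_lt, ← natSet_succ, natSet_inj]
  choose B₀ hB₀ hB₀u hB₀G using fun k =>
    (hG k).exists_im_subset (hX k) (hf k) (hκ k) (hw.witness k) (apply_mem hu.mem k) (huG k)
  let s₀ (k : ℕ) : ZFSet.{u} := if k < n₀ then B₀ k else K k
  have hs₀κ (k : ℕ) : s₀ k ∈ κ k := by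
    simp only [s₀]
    split
    exacts [hB₀ k, (hw.witness k).univ_mem]
  have hs₀G (k : ℕ) : im (X k) (f k) (s₀ k) ∈ G k := by
    simp only [s₀]
    split
    exacts [hB₀G k, (hG k).univ_im_mem (hw.witness k)]
  have hs₀u (k : ℕ) : im (X k) (f k) (s₀ k) ⊆ u₀ k := by
    simp only [s₀]
    split
    · exact hB₀u k
    · rw [hu.eq k (not_lt.1 ‹_›)]
      exact ZFSet.sep_subset
  have hs₀ : seqGraph s₀ ∈ M := seqGraph_mem_of_eq hw.K_mem n₀
    (fun k _ => mem_of_mem (hκ k) (hs₀κ k)) fun k hk => if_neg (not_lt.2 hk)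
  -- The set of boxes with images in the filters `G k` need not be in `M`, but its members are, and
  -- each has an `R`-successor in the set. The branch obtained in `M` may leave this set; it retains
  -- only being uncovered and shrinking.
  obtain ⟨p, hp, hp0, hpT, hpR⟩ := exists_branch hT (R := R)
    {p | ∃ (n : ℕ) (s : ℕ → ZFSet.{u}), p = ZFSet.pair (natSet n) (seqGraph s) ∧ seqGraph s ∈ M ∧
      (∀ k, s k ∈ κ k) ∧ ∀ k, im (X k) (f k) (s k) ∈ G k} (by
      rintro _ ⟨n, s, rfl, hs, hsκ, hsG⟩
      refine ZFSet.mem_sep.2 ⟨ZFSet.pair_mem_prod.2 ⟨natSet_mem_om n,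
        seqGraph_mem_prodSet.2 ⟨hs, hsκ⟩⟩, ?_⟩
      rw [snd_pair]
      exact hun s hs hsκ hsG) (by
      rintro _ ⟨n, s, rfl, hs, hsκ, hsG⟩
      choose C hC hCs hCG using fun k => (hG k).exists_shrinking (hX k) (hf k) (hκ k) (hK k) (hV k)
        (hw.witness k) (hsκ k) (hsG k) (natSet_mem_om n)
      have htκ (k : ℕ) : (if k < n + 1 then C k else s k) ∈ κ k := by
        split
        exacts [hC k, hsκ k]
      refine ⟨_, ⟨n + 1, fun k => if k < n + 1 then C k else s k, rfl, ?_, htκ, fun k => ?_⟩,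
        hRiff.2 ⟨rfl, fun k hk => ?_, fun k hk => if_neg (not_lt.2 hk)⟩⟩
      · exact seqGraph_mem_of_eq hs (n + 1) (fun k _ => mem_of_mem (hκ k) (htκ k))
          fun k hk => if_neg (not_lt.2 hk)
      · dsimp only
        split
        exacts [hCG k, hsG k]
      · rw [if_pos hk]
        exact hCs k)
    (a := ZFSet.pair (natSet n₀) (seqGraph s₀)) ⟨n₀, s₀, rfl, hs₀, hs₀κ, hs₀G⟩
  have hpe (j : ℕ) : ∃ (n : ℕ) (s : ℕ → ZFSet.{u}), (∀ k, s k ∈ κ k) ∧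
      p j = ZFSet.pair (natSet n) (seqGraph s) ∧ ¬ IsCovered M X f A (seqGraph s) (seqGraph K) := by
    obtain ⟨h, h'⟩ := ZFSet.mem_sep.1 (hpT j)
    obtain ⟨n, hn, s, hs, e⟩ := ZFSet.mem_prod.1 h
    obtain ⟨n, rfl⟩ := mem_om.1 hn
    obtain ⟨s, -, hsκ, rfl⟩ := mem_prodSet.1 hs
    rw [e, snd_pair] at h'
    exact ⟨n, s, hsκ, e, h'⟩
  choose n s hsκ hpe hsc using hpe
  have hR' (j : ℕ) : n (j + 1) = n j + 1 ∧ (∀ k < n (j + 1), IsShrinking (K k) (κ k) (V k)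
      (natSet (n j)) (s j k) (s (j + 1) k)) ∧ ∀ k, n (j + 1) ≤ k → s (j + 1) k = s j k := by
    have h := hpR j
    rwa [hpe j, hpe (j + 1), hRiff] at h
  have hn (j : ℕ) : n j = n₀ + j := by
    induction j with
    | zero =>
      rw [hpe 0, ZFSet.pair_inj] at hp0
      exact natSet_injective hp0.1
    | succ j ih => rw [(hR' j).1, ih, add_assoc]
  have hs0 : s 0 = s₀ := by
    rw [hpe 0, ZFSet.pair_inj] at hp0
    ext1 k
    rw [← ap_seqGraph (s 0), hp0.2, ap_seqGraph]
  have := DT.const hp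
  obtain ⟨x, hx, hxs, hxA⟩ := IsUncoveredSeq.exists_notMem (s := s) (n₀ := n₀) hw hA hAb
    { mem := by
        convert seqGraph_mem (M := M) fun j => snd (ap (seqGraph p) j) using 2
        ext1 j
        rw [ap_seqGraph, hpe, snd_pair]
      isOpen := hsκ
      anti := fun j k => by
        by_cases hk : k < n (j + 1)
        · exact ((hR' j).2.1 k hk).subset ((hw.witness k).subset _ (hsκ _ k))
        · rw [(hR' j).2.2 k (not_lt.1 hk)]
      not_isCovered := hsc
      shrinking := fun j k hk => by
        rw [← hn j]
        exact (hR' j).2.1 k (by rw [hn]; omega) }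
  obtain ⟨P, hP, hxP⟩ := hcov x (seqGraph_mem_box.2 ⟨hx, fun k => hs₀u k (hs0 ▸ hxs k)⟩)
  exact hxA P hP hxP

end Interp

namespace Interp

variable {M : Set ZFSet.{u}} [hM : Fact (IsTransitiveModel M)]

/-! ### Points of preinterpretations -/

section

variable {X τ : ZFSet.{u}} {Xh : Type u} [TopologicalSpace Xh] [T0Space Xh]

/-- The open sets of the model whose interpretations contain the point `y`. -/
def Preinterpretation.filter (π : Preinterpretation M X τ Xh) (y : Xh) : Set ZFSet.{u} :=
  {O | ∃ h : O ∈ τ, y ∈ π.op ⟨O, h⟩}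

omit hM in
theorem Preinterpretation.mem_filter (π : Preinterpretation M X τ Xh) {y : Xh} (O : τ) :
    O.1 ∈ π.filter y ↔ y ∈ π.op O :=
  ⟨fun ⟨_, h⟩ => h, fun h => ⟨O.2, h⟩⟩

omit hM in
theorem Preinterpretation.isPoint (π : Preinterpretation M X τ Xh) (hX : IsSpaceIn M X τ) (y : Xh) :
    IsPoint M X τ (π.filter y) where
  subset := fun O ⟨h, _⟩ => h
  univ_mem := ⟨hX.univ_mem, by rw [π.op_univ ⟨X, hX.univ_mem⟩ rfl]; trivial⟩
  inter_mem := fun O ⟨h, hO⟩ P ⟨h', hP⟩ => ⟨hX.inter_mem _ h _ h', by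
    rw [π.op_inter ⟨O, h⟩ ⟨P, h'⟩ ⟨_, _⟩ rfl]
    exact ⟨hO, hP⟩⟩
  mono := fun O ⟨h, hO⟩ P hP hOP => ⟨hP, by
    rw [π.op_inter ⟨O, h⟩ ⟨P, hP⟩ ⟨O, h⟩ (ZFSet.inter_eq_left_of_subset hOP).symm] at hO
    exact hO.2⟩
  exists_mem := fun A hA hAτ ⟨h, hy⟩ => by
    rw [π.op_sUnion A hA hAτ _ rfl] at hy
    obtain ⟨P, hP, hy⟩ := hy
    exact ⟨P.1, hP, P.2, hy⟩

omit hM in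
theorem Preinterpretation.eq_of_filter_eq (π : Preinterpretation M X τ Xh) {y z : Xh}
    (h : ∀ O : τ, y ∈ π.op O ↔ z ∈ π.op O) : y = z := by
  refine Inseparable.eq ?_
  rw [π.isBasis.inseparable_iff]
  rintro _ ⟨O, rfl⟩
  exact h O

/-- The space of all points of the formal space `⟨X, τ⟩`. -/
def PointSpace (M : Set ZFSet.{u}) (X τ : ZFSet.{u}) : Type u :=
  -- `Shrink` places the space in the universe over which the maximality of an interpretation
  -- quantifies.
  {s : Set (Shrink.{u} τ) // IsPoint M X τ {O | ∃ h : O ∈ τ, equivShrink τ ⟨O, h⟩ ∈ s}}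

/-- The set of all points in the open set `O`. -/
def PointSpace.op (O : τ) : Set (PointSpace M X τ) := {s | equivShrink τ O ∈ s.1}

instance : TopologicalSpace (PointSpace M X τ) :=
  TopologicalSpace.generateFrom (Set.range PointSpace.op)

instance : T0Space (PointSpace M X τ) := by
  refine ⟨fun s t h => Subtype.ext (Set.ext fun i => ?_)⟩
  have := h.mem_open_iff (TopologicalSpace.isOpen_generateFrom_of_mem ⟨(equivShrink τ).symm i, rfl⟩)
  simpa [PointSpace.op] using this

/-- The point of the point space given by a completely prime filter. -/
def PointSpace.mk {G : Set ZFSet.{u}} (hG : IsPoint M X τ G) : PointSpace M X τ :=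
  ⟨{i | ((equivShrink τ).symm i).1 ∈ G}, by
    convert hG
    ext O
    exact ⟨fun ⟨h, hO⟩ => by simpa using hO, fun hO => ⟨hG.subset O hO, by simpa⟩⟩⟩

omit hM in
theorem PointSpace.mk_mem_op {G : Set ZFSet.{u}} (hG : IsPoint M X τ G) {O : τ} :
    PointSpace.mk hG ∈ PointSpace.op O ↔ O.1 ∈ G := by
  change equivShrink τ O ∈ {i | ((equivShrink τ).symm i).1 ∈ G} ↔ _
  simp

omit hM in
theorem PointSpace.mem_op (s : PointSpace M X τ) {O : τ} :
    s ∈ PointSpace.op O ↔ O.1 ∈ {O | ∃ h : O ∈ τ, equivShrink τ ⟨O, h⟩ ∈ s.1} :=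
  ⟨fun h => ⟨O.2, h⟩, fun ⟨_, h⟩ => h⟩

omit hM in
theorem IsSpaceIn.isPoint (hX : IsSpaceIn M X τ) (x : X) : IsPoint M X τ {O | O ∈ τ ∧ x.1 ∈ O} where
  subset := fun _ h => h.1
  univ_mem := ⟨hX.univ_mem, x.2⟩
  inter_mem := fun _ h _ h' => ⟨hX.inter_mem _ h.1 _ h'.1, ZFSet.mem_inter.2 ⟨h.2, h'.2⟩⟩
  mono := fun _ h _ hP hOP => ⟨hP, hOP h.2⟩
  exists_mem := fun A _ hAτ h => by
    obtain ⟨P, hP, hx⟩ := ZFSet.mem_sUnion.1 h.2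
    exact ⟨P, hP, hAτ hP, hx⟩

/-- The preinterpretation in the space of all points. -/
def PointSpace.preinterpretation (hX : IsSpaceIn M X τ) : Preinterpretation M X τ (PointSpace M X τ) where
  pt x := PointSpace.mk (hX.isPoint x)
  op := PointSpace.op
  mem_iff x O := by
    rw [PointSpace.mk_mem_op]
    exact ⟨fun h => ⟨O.2, h⟩, fun h => h.2⟩
  op_inter O P Q e := by
    ext s
    rw [Set.mem_inter_iff, s.mem_op, s.mem_op, s.mem_op, e]
    exact ⟨fun h => ⟨s.2.mono _ h _ O.2 fun y hy => (ZFSet.mem_inter.1 hy).1,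
      s.2.mono _ h _ P.2 fun y hy => (ZFSet.mem_inter.1 hy).2⟩, fun h => s.2.inter_mem _ h.1 _ h.2⟩
  op_sUnion A hA hAτ O e := by
    ext s
    rw [s.mem_op, e]
    constructor
    · intro h
      obtain ⟨P, hP, hs⟩ := s.2.exists_mem A hA hAτ h
      exact ⟨⟨P, hAτ hP⟩, hP, s.mem_op.2 hs⟩
    · rintro ⟨P, hP, hs⟩
      exact s.2.mono _ (s.mem_op.1 hs) _ (hX.sUnion_mem A hA hAτ) fun y hy => ZFSet.mem_sUnion_of_mem hy hP
  op_empty O e := by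
    ext s
    rw [s.mem_op, e]
    refine ⟨fun h => ?_, fun h => h.elim⟩
    obtain ⟨P, hP, -⟩ := s.2.exists_mem ∅ (e ▸ hM.out.transitive _ hX.opens_mem _ O.2) (ZFSet.empty_subset _)
      (by rwa [ZFSet.sUnion_empty])
    exact absurd hP (ZFSet.notMem_empty P)
  op_univ O e := by
    ext s
    rw [s.mem_op, e]
    exact ⟨fun _ => trivial, fun _ => s.2.univ_mem⟩
  isBasis := by
    refine ⟨?_, ?_, rfl⟩
    · rintro _ ⟨O, rfl⟩ _ ⟨P, rfl⟩ s ⟨hs, hs'⟩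
      have hOP := hX.inter_mem _ O.2 _ P.2
      refine ⟨_, ⟨⟨_, hOP⟩, rfl⟩, s.mem_op.2 (s.2.inter_mem _ (s.mem_op.1 hs) _ (s.mem_op.1 hs')), ?_⟩
      intro t ht
      have ht := t.mem_op.1 ht
      exact ⟨t.mem_op.2 (t.2.mono _ ht _ O.2 fun y hy => (ZFSet.mem_inter.1 hy).1),
        t.mem_op.2 (t.2.mono _ ht _ P.2 fun y hy => (ZFSet.mem_inter.1 hy).2)⟩
    · refine Set.eq_univ_of_forall fun s => ⟨_, ⟨⟨X, hX.univ_mem⟩, rfl⟩, s.mem_op.2 s.2.univ_mem⟩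

/-- Every completely prime filter is given by a point of the interpretation. -/
theorem IsInterpretation.exists_point {π : Preinterpretation M X τ Xh} (hπ : IsInterpretation π)
    {G : Set ZFSet.{u}} (hG : IsPoint M X τ G) : ∃ y, ∀ O : τ, y ∈ π.op O ↔ O.1 ∈ G := by
  obtain ⟨h, -, hh⟩ := hπ.2 (PointSpace M X τ) (PointSpace.preinterpretation hπ.1)
  refine ⟨h (PointSpace.mk hG), fun O => ?_⟩
  rw [← PointSpace.mk_mem_op hG, ← Set.mem_preimage, hh]
  rfl

/-- Interpretations of regular spaces are Hausdorff. -/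
theorem Preinterpretation.t2Space (π : Preinterpretation M X τ Xh) (hX : IsSpaceIn M X τ)
    (hr : IsRegular X τ) : T2Space Xh := by
  have key {y z : Xh} {O : τ} (hy : y ∈ π.op O) (hz : z ∉ π.op O) :
      ∃ U V : Set Xh, IsOpen U ∧ IsOpen V ∧ y ∈ U ∧ z ∈ V ∧ Disjoint U V := by
    have := DT.const hX.carrier_mem
    have := DT.const hX.opens_mem
    have := DT.const (mem_of_mem hX.opens_mem O.2)
    -- Regularity in `M` writes `O` as the union of the open `P ⊆ O` disjoint from some open `Q`
    -- that covers the rest of `X`; primeness at `y` selects one such `P`.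
    obtain ⟨P, hP, hPτ, hyP⟩ := (π.isPoint hX y).exists_mem
      (ZFSet.sep (fun P => P ⊆ O.1 ∧ ∃ Q ∈ τ, X \ O.1 ⊆ Q ∧ P ∩ Q = ∅) τ) (DT.val₀ (M := M) inferInstance)
      ZFSet.sep_subset (by
        convert (π.mem_filter O).2 hy
        ext x
        rw [ZFSet.mem_sUnion]
        constructor
        · rintro ⟨P, hP, hx⟩
          exact (ZFSet.mem_sep.1 hP).2.1 hx
        · intro hx
          obtain ⟨P, hP, Q, hQ, hxP, h1, h2⟩ := hr O.1 O.2 x hx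
          refine ⟨P ∩ O.1, ZFSet.mem_sep.2 ⟨hX.inter_mem _ hP _ O.2,
            fun y hy => (ZFSet.mem_inter.1 hy).2, Q, hQ, h1, ?_⟩, ZFSet.mem_inter.2 ⟨hxP, hx⟩⟩
          rw [ZFSet.eq_empty] at h2 ⊢
          intro y hy
          simp only [ZFSet.mem_inter] at hy h2
          exact h2 y ⟨hy.1.1, hy.2⟩)
    obtain ⟨-, -, Q, hQ, hOQ, hPQ⟩ := ZFSet.mem_sep.1 hP
    refine ⟨π.op ⟨P, hPτ⟩, π.op ⟨Q, hQ⟩, π.isBasis.isOpen ⟨_, rfl⟩, π.isBasis.isOpen ⟨_, rfl⟩, hyP, ?_, ?_⟩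
    -- As `O` and `Q` cover `X`, primeness at `z` for this pair puts `z` into the interpretation of
    -- `Q`.
    · have h1 : ({O.1, Q} : ZFSet.{u}) ∈ M := pair_set_mem (mem_of_mem hX.opens_mem O.2)
        (mem_of_mem hX.opens_mem hQ)
      obtain ⟨R, hR, hRτ, hzR⟩ := (π.isPoint hX z).exists_mem _ h1 (fun R hR => by
        rcases ZFSet.mem_pair.1 hR with rfl | rfl
        exacts [O.2, hQ]) (by
        convert (π.isPoint hX z).univ_mem
        ext x
        rw [ZFSet.sUnion_pair, ZFSet.mem_union]
        refine ⟨fun h => h.elim (fun h => hX.subset _ O.2 h) fun h => hX.subset _ hQ h, fun hx => ?_⟩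
        by_cases hxO : x ∈ O.1
        · exact .inl hxO
        · exact .inr (hOQ (ZFSet.mem_sdiff.2 ⟨hx, hxO⟩)))
      rcases ZFSet.mem_pair.1 hR with rfl | rfl
      · exact absurd hzR hz
      · exact hzR
    · rw [Set.disjoint_iff_inter_eq_empty, ← π.op_inter _ _ ⟨_, hX.inter_mem _ hPτ _ hQ⟩ rfl]
      exact π.op_empty _ hPQ
  refine ⟨fun y z hyz => ?_⟩
  have : ∃ O : τ, ¬ (y ∈ π.op O ↔ z ∈ π.op O) := by
    by_contra! h
    exact hyz (π.eq_of_filter_eq h)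
  obtain ⟨O, hO⟩ := this
  by_cases hy : y ∈ π.op O
  · exact key hy (by tauto)
  · obtain ⟨U, V, hU, hV, h1, h2, h3⟩ := key (y := z) (z := y) (by tauto) hy
    exact ⟨V, U, hV, hU, h2, h1, h3.symm⟩

end

end Interp

namespace Interp

variable {M : Set ZFSet.{u}} [hM : Fact (IsTransitiveModel M)]

/-! ### Points of the product -/

/-- The inverse image of `O` under the `i`-th projection of the product. -/
noncomputable def cylinder (M : Set ZFSet.{u}) (X : ℕ → ZFSet.{u}) (i : ℕ) (O : ZFSet.{u}) : ZFSet.{u} :=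
  ZFSet.sep (fun x => ap x (natSet i) ∈ O) (prodSet M X)

section

variable {X τ : ℕ → ZFSet.{u}}

omit hM in
theorem seqGraph_mem_cylinder {v : ℕ → ZFSet.{u}} {i : ℕ} {O : ZFSet.{u}} :
    seqGraph v ∈ cylinder M X i O ↔ seqGraph v ∈ prodSet M X ∧ v i ∈ O := by
  rw [cylinder, ZFSet.mem_sep, ap_seqGraph]

theorem cylinder_mem (hX : seqGraph X ∈ M) (hτ : ∀ i, IsSpaceIn M (X i) (τ i)) {i : ℕ} {O : ZFSet.{u}}
    (hO : O ∈ τ i) : cylinder M X i O ∈ prodTopology M X τ := by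
  have : cylinder M X i O = box M X (seqGraph (Function.update X i O)) :=
    box_ext ZFSet.sep_subset ZFSet.sep_subset fun v hv => by
      rw [seqGraph_mem_cylinder, seqGraph_mem_box_update]
  rw [this]
  exact boxes_subset_prodTopology hX hτ ((mem_boxes hX).2 ⟨_, _, isSupport_update hX hτ hO, rfl⟩)

/-- A completely prime filter of the product determines completely prime filters of the factors. -/
theorem IsPoint.proj (hX : seqGraph X ∈ M) (hτ : ∀ i, IsSpaceIn M (X i) (τ i)) {H : Set ZFSet.{u}}
    (hH : IsPoint M (prodSet M X) (prodTopology M X τ) H) (i : ℕ) :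
    IsPoint M (X i) (τ i) {O | O ∈ τ i ∧ cylinder M X i O ∈ H} where
  subset := fun _ h => h.1
  univ_mem := ⟨(hτ i).univ_mem, by
    convert hH.univ_mem
    refine box_ext ZFSet.sep_subset (fun _ h => h) fun v hv => ?_
    rw [seqGraph_mem_cylinder]
    exact ⟨fun h => h.1, fun h => ⟨h, (seqGraph_mem_prodSet.1 h).2 i⟩⟩⟩
  inter_mem := fun O hO P hP => ⟨(hτ i).inter_mem _ hO.1 _ hP.1, by
    convert hH.inter_mem _ hO.2 _ hP.2
    ext x
    simp only [cylinder, ZFSet.mem_sep, ZFSet.mem_inter]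
    tauto⟩
  mono := fun O hO P hP hOP => ⟨hP, hH.mono _ hO.2 _ (cylinder_mem hX hτ hP) fun x hx =>
    ZFSet.mem_sep.2 ⟨(ZFSet.mem_sep.1 hx).1, hOP (ZFSet.mem_sep.1 hx).2⟩⟩
  exists_mem := fun A hA hAτ h => by
    have := DT.const hA
    have := DT.const (natSet_mem (M := M) i)
    have := DT.const (prodSet_mem hX)
    have : DT M fun v => cylinder M X i (v 0).1 := by
      unfold cylinder
      infer_instance
    obtain ⟨Q, hQ, hQH⟩ := hH.exists_mem (img A (cylinder M X i)) (DT.val₀ (M := M) inferInstance)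
      (fun Q hQ => by
        obtain ⟨P, hP, rfl⟩ := mem_img.1 hQ
        exact cylinder_mem hX hτ (hAτ hP)) (by
        convert h.2
        ext x
        simp only [ZFSet.mem_sUnion, mem_img, cylinder, ZFSet.mem_sep]
        constructor
        · rintro ⟨_, ⟨P, hP, rfl⟩, hx⟩
          exact ⟨(ZFSet.mem_sep.1 hx).1, P, hP, (ZFSet.mem_sep.1 hx).2⟩
        · rintro ⟨hx, P, hP, hxP⟩
          exact ⟨_, ⟨P, hP, rfl⟩, ZFSet.mem_sep.2 ⟨hx, hxP⟩⟩)
    obtain ⟨P, hP, rfl⟩ := mem_img.1 hQ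
    exact ⟨P, hP, hAτ hP, hQH⟩

/-- A box is the intersection of finitely many cylinders, since its sides from `n` on impose no
condition. -/
theorem IsPoint.box_mem_iff (hX : seqGraph X ∈ M) (hτ : ∀ i, IsSpaceIn M (X i) (τ i))
    {H : Set ZFSet.{u}} (hH : IsPoint M (prodSet M X) (prodTopology M X τ) H) {u : ℕ → ZFSet.{u}} {n : ℕ}
    (hu : IsSupport M X τ u n) : box M X (seqGraph u) ∈ H ↔ ∀ k, cylinder M X k (u k) ∈ H := by
  constructor
  · intro h k
    refine hH.mono _ h _ (cylinder_mem hX hτ (hu.isOpen k)) fun x hx => ?_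
    obtain ⟨hx, h⟩ := ZFSet.mem_sep.1 hx
    exact ZFSet.mem_sep.2 ⟨hx, by simpa using h _ (natSet_mem_om k)⟩
  · intro h
    have key (m : ℕ) : ZFSet.sep (fun x => ∀ k < m, ap x (natSet k) ∈ u k) (prodSet M X) ∈ H := by
      induction m with
      | zero =>
        convert hH.univ_mem
        ext
        simp
      | succ m ih =>
        convert hH.inter_mem _ ih _ (h m)
        ext x
        simp only [cylinder, ZFSet.mem_sep, ZFSet.mem_inter, Order.lt_add_one_iff, le_iff_lt_or_eq]
        constructor
        · exact fun h => ⟨⟨h.1, fun k hk => h.2 k (.inl hk)⟩, h.1, h.2 m (.inr rfl)⟩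
        · rintro ⟨⟨h1, h2⟩, -, h3⟩
          refine ⟨h1, ?_⟩
          rintro k (hk | rfl)
          exacts [h2 k hk, h3]
    convert key n
    refine box_ext ZFSet.sep_subset ZFSet.sep_subset fun v hv => ?_
    rw [seqGraph_mem_box, ZFSet.mem_sep]
    refine and_congr_right fun _ => ⟨fun h k _ => by simpa using h k, fun h k => ?_⟩
    by_cases hk : k < n
    · simpa using h k hk
    · rw [hu.eq k (not_lt.1 hk)]
      exact (seqGraph_mem_prodSet.1 hv).2 k

/-- The boxes inside `O` form a set of `M` with union `O`, so complete primeness selects one of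
them. -/
theorem IsPoint.exists_box (hX : seqGraph X ∈ M) (hτm : seqGraph τ ∈ M)
    (hτ : ∀ i, IsSpaceIn M (X i) (τ i)) {H : Set ZFSet.{u}}
    (hH : IsPoint M (prodSet M X) (prodTopology M X τ) H) {O : ZFSet.{u}} (hO : O ∈ H) :
    ∃ u n, IsSupport M X τ u n ∧ box M X (seqGraph u) ⊆ O ∧ ∀ k, cylinder M X k (u k) ∈ H := by
  have hOτ := (mem_prodTopology hX hτ).1 (hH.subset O hO)
  have := DT.const (boxes_mem hX hτm)
  have := DT.const (mem_pw.1 hOτ.1).2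
  obtain ⟨P, hP, hPH⟩ := hH.exists_mem (ZFSet.sep (fun P => P ⊆ O) (boxes M X τ))
    (DT.val₀ (M := M) inferInstance)
    (fun P hP => boxes_subset_prodTopology hX hτ (ZFSet.mem_sep.1 hP).1) (by
      convert hO
      ext x
      simp only [ZFSet.mem_sUnion, ZFSet.mem_sep]
      exact ⟨fun ⟨P, hP, hx⟩ => hP.2 hx, fun hx => by
        obtain ⟨P, hP, hxP, hPO⟩ := hOτ.2 x hx
        exact ⟨P, ⟨hP, hPO⟩, hxP⟩⟩)
  obtain ⟨hP, hPO⟩ := ZFSet.mem_sep.1 hP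
  obtain ⟨u, n, hu, rfl⟩ := (mem_boxes hX).1 hP
  exact ⟨u, n, hu, hPO, (hH.box_mem_iff hX hτ hu).1 hPH⟩

/-- Any element of `u k` can be inserted at coordinate `k` of a sequence in the first box. Such a
sequence exists in `M` because all sides are nonempty. -/
theorem subset_of_box_subset {u w : ℕ → ZFSet.{u}} (hu : seqGraph u ∈ M) (huX : ∀ k, u k ⊆ X k)
    (hne : ∀ k, ∃ x, x ∈ u k) (h : box M X (seqGraph u) ⊆ box M X (seqGraph w)) (k : ℕ) : u k ⊆ w k := by
  intro a ha
  obtain ⟨v, hv, hvu⟩ := exists_seq_mem hu hne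
  have hvu' (i : ℕ) : Function.update v k a i ∈ u i := by
    by_cases hi : i = k
    · subst hi
      simpa
    · simpa [hi] using hvu i
  have := h (seqGraph_mem_box.2 ⟨seqGraph_mem_prodSet.2 ⟨seqGraph_update_mem hv k
    (mem_of_mem (apply_mem hu k) ha), fun i => huX i (hvu' i)⟩, hvu'⟩)
  simpa using (seqGraph_mem_box.1 this).2 k

/-! ### The interpretation of the product -/

variable {Xh : ℕ → Type u} [∀ i, TopologicalSpace (Xh i)] [∀ i, T0Space (Xh i)]

/-- The interpretation of an open subset of the product. -/
def prodOp (π : ∀ i, Preinterpretation M (X i) (τ i) (Xh i)) (O : ZFSet.{u}) : Set (∀ i, Xh i) :=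
  {y | ∃ u n, IsSupport M X τ u n ∧ box M X (seqGraph u) ⊆ O ∧ ∀ k, u k ∈ (π k).filter (y k)}

omit hM in
theorem prodOp_mono (π : ∀ i, Preinterpretation M (X i) (τ i) (Xh i)) {O P : ZFSet.{u}} (h : O ⊆ P) :
    prodOp π O ⊆ prodOp π P :=
  fun _ ⟨u, n, hu, huO, hy⟩ => ⟨u, n, hu, fun _ hx => h (huO hx), hy⟩

omit hM in
theorem isOpen_prodOp (hτ : ∀ i, IsSpaceIn M (X i) (τ i))
    (π : ∀ i, Preinterpretation M (X i) (τ i) (Xh i)) (O : ZFSet.{u}) : IsOpen (prodOp π O) := by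
  rw [isOpen_pi_iff]
  rintro y ⟨u, n, hu, huO, hy⟩
  refine ⟨Finset.range n, fun k => (π k).op ⟨u k, hu.isOpen k⟩, fun k _ =>
    ⟨(π k).isBasis.isOpen ⟨_, rfl⟩, (hy k).2⟩, fun z hz => ⟨u, n, hu, huO, fun k => ?_⟩⟩
  by_cases hk : k < n
  · exact ⟨hu.isOpen k, hz k (by simpa using hk)⟩
  · rw [hu.eq k (not_lt.1 hk)]
    exact ((π k).isPoint (hτ k) (z k)).univ_mem

/-- `prodOp` is defined by boxes inside the given set, so a box needs this check that it receives no
unexpected points. Members of a completely prime filter are nonempty, hence the inclusion of boxes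
holds side by side. -/
theorem prodOp_box_subset (hτ : ∀ i, IsSpaceIn M (X i) (τ i))
    (π : ∀ i, Preinterpretation M (X i) (τ i) (Xh i)) {w : ℕ → ZFSet.{u}} {n : ℕ}
    (hw : IsSupport M X τ w n) {y : ∀ i, Xh i} (hy : y ∈ prodOp π (box M X (seqGraph w))) (k : ℕ) :
    w k ∈ (π k).filter (y k) := by
  obtain ⟨u, m, hu, huw, hy⟩ := hy
  have hp (k : ℕ) := (π k).isPoint (hτ k) (y k)
  exact (hp k).mono _ (hy k) _ (hw.isOpen k) (subset_of_box_subset hu.mem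
    (fun k => (hτ k).subset _ (hu.isOpen k)) (fun k => (hp k).nonempty (hy k)) huw k)

theorem exists_prodOp_subset (hX : seqGraph X ∈ M) (hτ : ∀ i, IsSpaceIn M (X i) (τ i))
    (π : ∀ i, Preinterpretation M (X i) (τ i) (Xh i)) {y : ∀ i, Xh i} {U : Set (∀ i, Xh i)}
    (hU : IsOpen U) (hy : y ∈ U) : ∃ O ∈ prodTopology M X τ, y ∈ prodOp π O ∧ prodOp π O ⊆ U := by
  classical
  obtain ⟨I, W, hW, hWU⟩ := isOpen_pi_iff.1 hU y hy
  have hO (k : ℕ) : ∃ O : τ k, k ∈ I → y k ∈ (π k).op O ∧ (π k).op O ⊆ W k := by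
    by_cases hk : k ∈ I
    · obtain ⟨_, ⟨O, rfl⟩, h1, h2⟩ := (π k).isBasis.exists_subset_of_mem_open (hW k hk).2 (hW k hk).1
      exact ⟨O, fun _ => ⟨h1, h2⟩⟩
    · exact ⟨⟨_, (hτ k).univ_mem⟩, fun h => absurd h hk⟩
  choose O hO using hO
  let w (k : ℕ) : ZFSet.{u} := if k ∈ I then O k else X k
  have hwτ (k : ℕ) : w k ∈ τ k := by
    simp only [w]
    split
    exacts [(O k).2, (hτ k).univ_mem]
  have hw0 (k : ℕ) (hk : I.sup id + 1 ≤ k) : w k = X k := if_neg fun h => by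
    have := Finset.le_sup (f := id) h
    simp only [id] at this
    omega
  have hw : IsSupport M X τ w (I.sup id + 1) :=
    ⟨seqGraph_mem_of_eq hX _ (fun k _ => mem_of_mem (hτ k).opens_mem (hwτ k)) hw0, hwτ, hw0⟩
  refine ⟨box M X (seqGraph w), boxes_subset_prodTopology hX hτ ((mem_boxes hX).2 ⟨_, _, hw, rfl⟩),
    ⟨w, _, hw, fun _ h => h, fun k => ?_⟩, fun z hz => hWU fun k hk => ?_⟩
  · simp only [w]
    split
    · exact ((π k).mem_filter (O k)).2 (hO k ‹_›).1
    · exact ((π k).isPoint (hτ k) (y k)).univ_mem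
  · have := prodOp_box_subset hτ π hw hz k
    simp only [w] at this
    rw [if_pos (Finset.mem_coe.1 hk), (π k).mem_filter (O k)] at this
    exact (hO k (Finset.mem_coe.1 hk)).2 this

/-- The product of interpretations of interpretable spaces, as a preinterpretation. -/
noncomputable def prodPreinterpretation {K κ f V : ℕ → ZFSet.{u}} (hw : IsWitnessSeq M X τ K κ f V)
    (π : ∀ i, Preinterpretation M (X i) (τ i) (Xh i)) :
    Preinterpretation M (prodSet M X) (prodTopology M X τ) (∀ i, Xh i) where
  pt := prodMap M fun i => (π i).pt
  op O := prodOp π O.1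
  mem_iff x O := by
    have hx (u : ℕ → ZFSet.{u}) (hu : ∀ k, u k ∈ τ k) : (∀ k, u k ∈ (π k).filter (prodMap M (fun i => (π i).pt) x k)) ↔
        x.1 ∈ box M X (seqGraph u) := by
      rw [← seqGraph_coord x, seqGraph_mem_box, seqGraph_coord]
      simp only [x.2, true_and]
      refine forall_congr' fun k => ?_
      rw [(π k).mem_filter ⟨u k, hu k⟩]
      exact ((π k).mem_iff _ _).symm
    constructor
    · intro h
      obtain ⟨P, hP, hxP, hPO⟩ := ((mem_prodTopology hw.X_mem hw.space).1 O.2).2 x.1 h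
      obtain ⟨u, n, hu, rfl⟩ := (mem_boxes hw.X_mem).1 hP
      exact ⟨u, n, hu, hPO, (hx u hu.isOpen).2 hxP⟩
    · rintro ⟨u, n, hu, huO, h⟩
      exact huO ((hx u hu.isOpen).1 h)
  op_inter O P Q e := by
    rw [e]
    refine Set.Subset.antisymm (fun y hy => ⟨prodOp_mono π (fun x hx => (ZFSet.mem_inter.1 hx).1) hy,
      prodOp_mono π (fun x hx => (ZFSet.mem_inter.1 hx).2) hy⟩) ?_
    rintro y ⟨⟨u, n, hu, huO, hy⟩, ⟨w, m, hw', hwP, hy'⟩⟩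
    refine ⟨_, _, hu.inter hw.space hw', ?_, fun k =>
      ((π k).isPoint (hw.space k) (y k)).inter_mem _ (hy k) _ (hy' k)⟩
    rw [box_inter]
    exact fun x hx => ZFSet.mem_inter.2 ⟨huO (ZFSet.mem_inter.1 hx).1, hwP (ZFSet.mem_inter.1 hx).2⟩
  op_sUnion A hA hAτ O e := by
    ext y
    constructor
    · rintro ⟨u, n, hu, huO, hy⟩
      have := DT.const hA
      have := DT.const (boxes_mem hw.X_mem hw.τ_mem)
      -- `A` is replaced by the set of all boxes contained in one of its members, which has the same
      -- union.
      obtain ⟨u', n', hu', huA, hy'⟩ := exists_box_of_cover hw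
        (A := ZFSet.sep (fun P => ∃ O ∈ A, P ⊆ O) (boxes M X τ)) (DT.val₀ (M := M) inferInstance)
        ZFSet.sep_subset (fun k => (π k).isPoint (hw.space k) (y k)) hu hy (fun x hx => by
          obtain ⟨Q, hQ, hxQ⟩ := ZFSet.mem_sUnion.1 (e ▸ huO hx)
          obtain ⟨P, hP, hxP, hPQ⟩ := ((mem_prodTopology hw.X_mem hw.space).1 (hAτ hQ)).2 _ hxQ
          exact ⟨P, ZFSet.mem_sep.2 ⟨hP, Q, hQ, hPQ⟩, hxP⟩)
      obtain ⟨-, Q, hQ, h⟩ := ZFSet.mem_sep.1 huA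
      exact ⟨⟨Q, hAτ hQ⟩, hQ, u', n', hu', h, hy'⟩
    · rintro ⟨P, hP, hy⟩
      rw [e]
      exact prodOp_mono π (fun x hx => ZFSet.mem_sUnion_of_mem hx hP) hy
  op_empty O e := by
    rw [e, Set.eq_empty_iff_forall_notMem]
    rintro y ⟨u, n, hu, huO, hy⟩
    obtain ⟨v, hv, hvu⟩ := exists_seq_mem hu.mem fun k =>
      ((π k).isPoint (hw.space k) (y k)).nonempty (hy k)
    exact ZFSet.notMem_empty _ (huO (seqGraph_mem_box.2 ⟨seqGraph_mem_prodSet.2 ⟨hv, fun k =>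
      (hw.space k).subset _ (hu.isOpen k) (hvu k)⟩, hvu⟩))
  op_univ O e := by
    refine Set.eq_univ_of_forall fun y => ⟨X, 0, ⟨hw.X_mem, fun k => (hw.space k).univ_mem, fun _ _ => rfl⟩,
      ?_, fun k => ((π k).isPoint (hw.space k) (y k)).univ_mem⟩
    rw [e]
    exact ZFSet.sep_subset
  isBasis := TopologicalSpace.isTopologicalBasis_of_isOpen_of_nhds
    (by
      rintro _ ⟨O, rfl⟩
      exact isOpen_prodOp hw.space π _)
    fun y U hy hU => by
      obtain ⟨O, hO, h1, h2⟩ := exists_prodOp_subset hw.X_mem hw.space π hU hy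
      exact ⟨_, ⟨⟨O, hO⟩, rfl⟩, h1, h2⟩

/-- The filter of a point `z` of a preinterpretation of the product projects to completely prime
filters on the factors, which the given interpretations realize by points; these are the coordinates
of `h z`. Boxes and cylinders then show that `h` pulls the open sets back correctly. -/
theorem isInterpretation_prod {K κ f V : ℕ → ZFSet.{u}} (hw : IsWitnessSeq M X τ K κ f V)
    {π : ∀ i, Preinterpretation M (X i) (τ i) (Xh i)} (hπ : ∀ i, IsInterpretation (π i)) :
    IsInterpretation (prodPreinterpretation hw π) := by
  have hsp := isSpaceIn_prod hw.X_mem hw.τ_mem hw.space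
  refine ⟨hsp, fun Z _ _ χ => ?_⟩
  choose h hh using fun z i => (hπ i).exists_point ((χ.isPoint hsp z).proj hw.X_mem hw.space i)
  have hfil (z : Z) (i : ℕ) (O : ZFSet.{u}) (hO : O ∈ τ i) :
      O ∈ (π i).filter (h z i) ↔ cylinder M X i O ∈ χ.filter z :=
    ((π i).mem_filter ⟨O, hO⟩).trans ((hh z i ⟨O, hO⟩).trans ⟨fun h => h.2, fun h => ⟨hO, h⟩⟩)
  refine ⟨h, fun x => ?_, fun O => ?_⟩
  · ext1 i
    refine (π i).eq_of_filter_eq fun O => ?_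
    rw [hh]
    have hO := cylinder_mem hw.X_mem hw.space O.2
    refine ((π i).mem_iff (coord x i) O).symm.trans ?_
    have : x.1 ∈ cylinder M X i O.1 ↔ (coord x i).1 ∈ O.1 := by
      have h1 := x.2
      rw [← seqGraph_coord x] at h1 ⊢
      rw [seqGraph_mem_cylinder]
      exact ⟨fun h => h.2, fun h => ⟨h1, h⟩⟩
    rw [← this, χ.mem_iff x ⟨_, hO⟩, ← χ.mem_filter ⟨_, hO⟩]
    exact ⟨fun h => ⟨O.2, h⟩, fun h => h.2⟩
  · ext z
    rw [Set.mem_preimage, ← χ.mem_filter]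
    have hz := χ.isPoint hsp z
    constructor
    · rintro ⟨u, n, hu, huO, hy⟩
      refine hz.mono _ ((hz.box_mem_iff hw.X_mem hw.space hu).2 fun k => ?_) _ O.2 huO
      exact (hfil z k _ (hu.isOpen k)).1 (hy k)
    · intro hO
      obtain ⟨u, n, hu, huO, hk⟩ := hz.exists_box hw.X_mem hw.τ_mem hw.space hO
      exact ⟨u, n, hu, huO, fun k => (hfil z k _ (hu.isOpen k)).2 (hk k)⟩

end

/-! ### Projections -/

section

variable {X τ : ℕ → ZFSet.{u}}

omit hM in
theorem pair_mem_projGraph {v : ℕ → ZFSet.{u}} (hv : seqGraph v ∈ prodSet M X) {i : ℕ} {y : ZFSet.{u}} :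
    ZFSet.pair (seqGraph v) y ∈ projGraph M X i ↔ y = v i := by
  simp only [projGraph, ZFSet.mem_pairSep, ZFSet.pair_inj]
  constructor
  · rintro ⟨_, -, _, -, ⟨rfl, rfl⟩, h⟩
    exact pair_mem_seqGraph.1 h
  · rintro rfl
    exact ⟨_, hv, _, (seqGraph_mem_prodSet.1 hv).2 i, ⟨rfl, rfl⟩, pair_mem_seqGraph.2 rfl⟩

theorem isContinuousIn_projGraph (hX : seqGraph X ∈ M) (hτ : ∀ i, IsSpaceIn M (X i) (τ i)) (i : ℕ) :
    IsContinuousIn M (prodSet M X) (prodTopology M X τ) (X i) (τ i) (projGraph M X i) := by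
  have hsub : projGraph M X i ⊆ ZFSet.prod (prodSet M X) (X i) := fun p hp => by
    obtain ⟨a, ha, b, hb, rfl, -⟩ := ZFSet.mem_pairSep.1 hp
    exact ZFSet.pair_mem_prod.2 ⟨ha, hb⟩
  refine ⟨?_, ⟨hsub, fun x hx => ?_⟩, fun O hO => ?_⟩
  · have := DT.const (prodSet_mem hX)
    have := DT.const (natSet_mem (M := M) i)
    refine ((inferInstance : DT M fun _ => lam (prodSet M X) fun x => ap x (natSet i)).congr
      (t := fun _ => projGraph M X i) fun _ => ?_).val₀
    ext p
    rw [mem_lam]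
    constructor
    · intro hp
      obtain ⟨x, hx, y, hy, rfl⟩ := ZFSet.mem_prod.1 (hsub hp)
      obtain ⟨v, -, -, rfl⟩ := mem_prodSet.1 hx
      exact ⟨_, hx, by rw [(pair_mem_projGraph hx).1 hp, ap_seqGraph]⟩
    · rintro ⟨x, hx, rfl⟩
      obtain ⟨v, -, -, rfl⟩ := mem_prodSet.1 hx
      rw [ap_seqGraph]
      exact (pair_mem_projGraph hx).2 rfl
  · obtain ⟨v, -, -, rfl⟩ := mem_prodSet.1 hx
    exact ⟨v i, (pair_mem_projGraph hx).2 rfl, fun y hy => (pair_mem_projGraph hx).1 hy⟩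
  · convert cylinder_mem hX hτ hO using 1
    refine box_ext ZFSet.sep_subset ZFSet.sep_subset fun v hv => ?_
    rw [seqGraph_mem_cylinder, ZFSet.mem_sep]
    refine and_congr_right fun _ => ⟨fun ⟨y, hy, h⟩ => ?_, fun h => ⟨_, h, (pair_mem_projGraph hv).2 rfl⟩⟩
    rwa [← (pair_mem_projGraph hv).1 h]

/-- Two continuous maps into a Hausdorff space that agree on a dense set coincide. The points of `M`
are dense because a nonempty basic open set is the interpretation of a nonempty set of `M`. -/
theorem isInterpretationOfMap_proj_iff {Xh : ℕ → Type u} [∀ i, TopologicalSpace (Xh i)]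
    [∀ i, T0Space (Xh i)] {K κ f V : ℕ → ZFSet.{u}} (hw : IsWitnessSeq M X τ K κ f V)
    (hr : ∀ i, IsRegular (X i) (τ i)) (π : ∀ i, Preinterpretation M (X i) (τ i) (Xh i)) (i : ℕ)
    (g : (∀ n, Xh n) → Xh i) :
    IsInterpretationOfMap M (prodSet M X) (prodTopology M X τ) (X i) (τ i)
      (prodMap M fun n => (π n).pt) (π i).pt (projGraph M X i) g ↔ g = fun y => y i := by
  have hpair (x : prodSet M X) (y : X i) : ZFSet.pair x.1 y.1 ∈ projGraph M X i ↔ y = coord x i := by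
    have h := x.2
    rw [← seqGraph_coord x] at h ⊢
    rw [pair_mem_projGraph h, Subtype.ext_iff]
  constructor
  · rintro ⟨-, hg, h⟩
    have := (π i).t2Space (hw.space i) (hr i)
    refine hg.ext_on (s := Set.range (prodMap M fun n => (π n).pt)) ?_ (continuous_apply i) ?_
    · refine (prodPreinterpretation hw π).isBasis.dense_iff.2 ?_
      rintro _ ⟨O, rfl⟩ hne
      obtain ⟨x, hx⟩ : ∃ x, x ∈ O.1 := by
        by_contra! hx
        rw [(prodPreinterpretation hw π).op_empty O ((ZFSet.eq_empty _).2 hx)] at hne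
        exact Set.not_nonempty_empty hne
      have hxX := (mem_pw.1 ((mem_prodTopology hw.X_mem hw.space).1 O.2).1).1 hx
      exact ⟨_, ((prodPreinterpretation hw π).mem_iff ⟨x, hxX⟩ O).1 hx, ⟨x, hxX⟩, rfl⟩
    · rintro _ ⟨x, rfl⟩
      exact h x (coord x i) ((hpair _ _).2 rfl)
  · rintro rfl
    refine ⟨isContinuousIn_projGraph hw.X_mem hw.space i, continuous_apply i, fun x y hxy => ?_⟩
    rw [(hpair x y).1 hxy]
    rfl

end

end Interp

theorem mainTheorem7 (M : Set ZFSet.{u}) (hM : Interp.IsTransitiveModel M)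
    (X τ : ℕ → ZFSet.{u})
    (hseq : Interp.seqGraph (fun i => ZFSet.pair (X i) (τ i)) ∈ M)
    (hX : ∀ i, Interp.IsInterpretableIn M (X i) (τ i))
    (Xh : ℕ → Type u) [∀ i, TopologicalSpace (Xh i)] [∀ i, T0Space (Xh i)]
    (π : ∀ i, Interp.Preinterpretation M (X i) (τ i) (Xh i))
    (hπ : ∀ i, Interp.IsInterpretation (π i)) :
    Interp.ExtendsToInterpretation M (Interp.prodSet M X) (Interp.prodTopology M X τ)
        (Interp.prodMap M (fun i => (π i).pt)) ∧
      ∀ (i : ℕ) (g : (∀ n, Xh n) → Xh i),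
        Interp.IsInterpretationOfMap M (Interp.prodSet M X) (Interp.prodTopology M X τ)
            (X i) (τ i) (Interp.prodMap M (fun n => (π n).pt)) (π i).pt
            (Interp.projGraph M X i) g ↔
          g = fun y => y i := by
  have := Fact.mk hM
  have := Interp.DT.const hseq
  -- The given sequence consists of pairs; its two component sequences are definable from it.
  have hXm : Interp.seqGraph X ∈ M := by
    simpa using Interp.seqGraph_mem (M := M) fun i =>
      Interp.fst (Interp.ap (Interp.seqGraph fun i => ZFSet.pair (X i) (τ i)) i)
  have hτm : Interp.seqGraph τ ∈ M := by
    simpa using Interp.seqGraph_mem (M := M) fun i =>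
      Interp.snd (Interp.ap (Interp.seqGraph fun i => ZFSet.pair (X i) (τ i)) i)
  obtain ⟨K, κ, f, V, hK, hκ, hf, hV, h⟩ := Interp.exists_seq_isWitness hXm hτm hX
  have hw : Interp.IsWitnessSeq M X τ K κ f V := ⟨hXm, hτm, hK, hκ, hf, hV, fun i => (hX i).1, h⟩
  exact ⟨⟨_, rfl, Interp.isInterpretation_prod hw hπ⟩,
    Interp.isInterpretationOfMap_proj_iff hw (fun i => (hX i).2.1) π⟩
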